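/- **Theorem (REPO for tabular MDPs with aggregate feedback).** *Setting.* Let $\mathcal M=(\mathcal X,\mathcal A,x_1,r,P,H)$ be a finite-horizon MDP with finite state set $\mathcal X$, finite action set $\mathcal A$, fixed initial state $x_1$, mean rewards $r_h:\mathcal X\times\mathcal A\to[0,1]$ and transition laws $P_h(\cdot\mid x,a)$, $h\in[H]$, $H\ge 1$. In each of $K\ge 1$ episodes the learner picks a stochastic Markov policy $\pi^k$, observes the trajectory $\iota^k=(x_h^k,a_h^k)_{h\in[H]}$ that results from playing $\pi^k$, and observes only the aggregate reward $v^k=\sum_{h\in[H]} r_h^k$, where $r_h^k\in[0,1]$ has mean $r_h(x_h^k,a_h^k)$ given the past and $\iota^k$. Let $V^{\pi}(x_1)$ be the expected cumulative reward of $\pi$, let $\pi^\star$ maximize $V^\pi(x_1)$ over stochastic Markov policies, $V^\star=V^{\pi^\star}$, and $\mathrm{Regret}=\sum_{k=1}^{K}\big(V^{\star}(x_1)-V^{\pi^k}(x_1)\big)$. *Notation.* Let $d=|\mathcal X||\mathcal A|$, let $\phi(x,a)\in\mathbb R^{d}$ be the one-hot encoding of $(x,a)$, $\phi_h^k=\phi(x_h^k,a_h^k)$,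 and let $\phi^k\in\mathbb R^{dH}$ be the concatenation of $\phi_1^k,\dots,\phi_H^k$. For $\zeta\in\mathbb R^{dH}$ let $\zeta_1,\dots,\zeta_H\in\mathbb R^d$ be its consecutive blocks. Put $$\Lambda_h^k=\lambda_p I+\sum_{\tau<k}\phi_h^\tau(\phi_h^\tau)^{\mathsf T},\quad \Lambda^k=\lambda_r I+\sum_{\tau<k}\phi^\tau(\phi^\tau)^{\mathsf T},\quad \hat\theta^k=(\Lambda^k)^{-1}\sum_{\tau<k}\phi^\tau v^\tau .$$ *Algorithm (simplified REPO: no warm-up, no truncation or clipping).* In episode $k=1,\dots,K$: 1. If $k=1$, or $\det\Lambda_h^k\ge 2\det\Lambda_h^{k_e}$ for some $h$, or $\det\Lambda^k\ge 2\det\Lambda^{k_e}$, where $k_e$ is the first episode of the current epoch, start a new epoch: set $k_e=k$, draw independently $\zeta^{k_e,i}\sim\mathcal N\big(0,\,2\beta_r^2(\Lambda^{k_e})^{-1}+2H\beta_p^2\,\mathrm{diag}(\Lambda_1^{k_e},\dots,\Lambda_H^{k_e})^{-1}\big)$ for $i\in[m]$, and reset $p^k(i)=1/m$, $\pi_h^{k,i}(a\mid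 x)=1/|\mathcal A|$. 2. Draw $i_k\sim p^k$, play $\pi^k=\pi^{k,i_k}$, and observe $\iota^k$ and $v^k$. 3. With $\hat\psi_h V=(\Lambda_h^{k_e})^{-1}\sum_{\tau<k_e}\phi_h^\tau V(x_{h+1}^\tau)$ and $\hat V_{H+1}^{k,i}=0$, compute for every $i\in[m]$ and $h=H,\dots,1$ $$\hat Q_h^{k,i}(x,a)=\phi(x,a)^{\mathsf T}\big(\hat\theta_h^k+\zeta_h^{k_e,i}+\hat\psi_h\hat V_{h+1}^{k,i}\big),\quad \hat V_h^{k,i}(x)=\sum_{a}\pi_h^{k,i}(a\mid x)\hat Q_h^{k,i}(x,a),$$ and set $\pi_h^{k+1,i}(a\mid x)\propto\pi_h^{k,i}(a\mid x)\,e^{\eta_o\hat Q_h^{k,i}(x,a)}$ and $p^{k+1}(i)\propto p^k(i)\,e^{\eta_x\hat V_1^{k,i}(x_1)}$. *Parameters.* For $\delta\in(0,1)$: $\lambda_p=1$, $\lambda_r=H$, $m=\lceil 9\log(7K/\delta)\rceil$, $\beta_r=2H\sqrt{2dH\log(14K/\delta)}$, $\beta_\zeta=\sqrt{11dH\log(14mK/\delta)}$,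 $\beta_p=4H\sqrt{3d\log(14KH/\delta)}$, $\beta_Q=2H\beta_p\beta_\zeta$, $$\eta_x=\sqrt{\frac{3dH\log(2K)\log m}{K\beta_Q^2}},\qquad \eta_o=\sqrt{\frac{3dH\log(2K)\log|\mathcal A|}{K\beta_Q^2}} .$$ *Claim.* With probability at least $1-\delta$, $$\mathrm{Regret}\le 1747\,\sqrt{K|\mathcal X|^3|\mathcal A|^3H^7\max\{H,|\mathcal X|\}}\;\log^2\frac{20KH|\mathcal X||\mathcal A|m}{\delta}.$$ -/

import Mathlib

open MeasureTheory ProbabilityTheory Matrix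

noncomputable section

namespace REPO

/-! ### Finite-horizon tabular MDPs -/

/-- A finite-horizon MDP with horizon `H`; the steps `1, …, H` are indexed by `Fin H`.
`r h x a` is the mean reward and `P h x a` the law of the next state. -/
structure MDP (X A : Type*) [Fintype X] (H : ℕ) where
  init : X
  r : Fin H → X → A → ℝ
  P : Fin H → X → A → X → ℝ
  r_mem : ∀ h x a, r h x a ∈ Set.Icc (0 : ℝ) 1
  P_mem : ∀ h x a, P h x a ∈ stdSimplex ℝ X

/-- The states `x_1, …, x_{H+1}` and the actions `a_1, …, a_H` of one episode. -/
@[ext] structure Trajectory (X A : Type*) (H : ℕ) where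
  states : Fin (H + 1) → X
  actions : Fin H → A

/-- A trajectory as a pair. -/
def Trajectory.equivProd (X A : Type*) (H : ℕ) :
    (Fin (H + 1) → X) × (Fin H → A) ≃ Trajectory X A H where
  toFun q := ⟨q.1, q.2⟩
  invFun τ := (τ.states, τ.actions)
  left_inv _ := rfl
  right_inv _ := rfl

instance {X A : Type*} {H : ℕ} [Fintype X] [Fintype A] : Fintype (Trajectory X A H) :=
  Fintype.ofEquiv _ (Trajectory.equivProd X A H)

instance {X A : Type*} {H : ℕ} : MeasurableSpace (Trajectory X A H) := ⊤

section Model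

variable {X A : Type*} [Fintype X] [Fintype A] [DecidableEq X] [DecidableEq A] {H : ℕ}

/-- The state at step `h`. -/
def Trajectory.state (τ : Trajectory X A H) (h : Fin H) : X := τ.states h.castSucc

/-- The state reached after step `h`. -/
def Trajectory.next (τ : Trajectory X A H) (h : Fin H) : X := τ.states h.succ

/-- The action at step `h`. -/
def Trajectory.action (τ : Trajectory X A H) (h : Fin H) : A := τ.actions h

/-- `π` is a stochastic Markov policy. -/
def IsPolicy (π : Fin H → X → A → ℝ) : Prop := ∀ h x, π h x ∈ stdSimplex ℝ A

/-- The probability of the trajectory `τ` when `π` is played in `M`. -/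
def trajProb (M : MDP X A H) (π : Fin H → X → A → ℝ) (τ : Trajectory X A H) : ℝ :=
  (if τ.states 0 = M.init then 1 else 0) *
    ∏ h, π h (τ.state h) (τ.action h) * M.P h (τ.state h) (τ.action h) (τ.next h)

/-- The value `V_1^π(x_1)`: the expected cumulative reward of `π`. -/
def value (M : MDP X A H) (π : Fin H → X → A → ℝ) : ℝ :=
  ∑ τ : Trajectory X A H, trajProb M π τ * ∑ h, M.r h (τ.state h) (τ.action h)

/-- `π` maximizes the value among all stochastic Markov policies. -/
def IsOptimal (M : MDP X A H) (π : Fin H → X → A → ℝ) : Prop :=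
  IsPolicy π ∧ ∀ π' : Fin H → X → A → ℝ, IsPolicy π' → value M π' ≤ value M π

/-! ### The algorithm -/

/-- The input parameters of the algorithm. -/
structure Params where
  m : ℕ
  etaO : ℝ
  etaX : ℝ
  lamR : ℝ
  lamP : ℝ
  betaR : ℝ
  betaP : ℝ

/-- The one-hot feature vector `φ(x, a)`, of dimension `d = |X| |A|`. -/
def feat (x : X) (a : A) : X × A → ℝ := Pi.single (x, a) 1

/-- The features of a trajectory at step `h`. -/
def Trajectory.feat (τ : Trajectory X A H) (h : Fin H) : X × A → ℝ :=
  REPO.feat (τ.state h) (τ.action h)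

/-- The concatenated features of a trajectory, of dimension `d H`. -/
def Trajectory.featAll (τ : Trajectory X A H) : (X × A) × Fin H → ℝ :=
  fun j => τ.feat j.2 j.1

/-- The space of the perturbation vectors, `ℝ^{dH}`. -/
abbrev Noise (X A : Type*) (H : ℕ) := EuclideanSpace ℝ ((X × A) × Fin H)

/- In what follows, `traj k`, `v k` and `ζ k` are the trajectory, the episode reward and the
perturbations of episode `k`; episodes are numbered `0, …, K - 1`. -/

/-- The covariance matrix `Λ_h^k` of the features at step `h` of the episodes before `k`. -/
def covStep (p : Params) (traj : ℕ → Trajectory X A H) (k : ℕ) (h : Fin H) :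
    Matrix (X × A) (X × A) ℝ :=
  p.lamP • (1 : Matrix (X × A) (X × A) ℝ) +
    ∑ τ ∈ Finset.range k, vecMulVec ((traj τ).feat h) ((traj τ).feat h)

/-- The aggregate covariance matrix `Λ^k` of the episodes before `k`. -/
def covAll (p : Params) (traj : ℕ → Trajectory X A H) (k : ℕ) :
    Matrix ((X × A) × Fin H) ((X × A) × Fin H) ℝ :=
  p.lamR • (1 : Matrix ((X × A) × Fin H) ((X × A) × Fin H) ℝ) +
    ∑ τ ∈ Finset.range k, vecMulVec (traj τ).featAll (traj τ).featAll

open Classical in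
/-- The first episode of the epoch that contains episode `k`. -/
def epochStart (p : Params) (traj : ℕ → Trajectory X A H) : ℕ → ℕ
  | 0 => 0
  | k + 1 =>
    if (∃ h, (covStep p traj (k + 1) h).det ≥
            2 * (covStep p traj (epochStart p traj k) h).det) ∨
        (covAll p traj (k + 1)).det ≥ 2 * (covAll p traj (epochStart p traj k)).det
    then k + 1
    else epochStart p traj k

/-- The covariance matrix of the perturbations that are drawn if an epoch starts at episode `k`. -/
def covNoise (p : Params) (traj : ℕ → Trajectory X A H) (k : ℕ) :
    Matrix ((X × A) × Fin H) ((X × A) × Fin H) ℝ :=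
  (2 * p.betaR ^ 2) • (covAll p traj k)⁻¹ +
    (2 * H * p.betaP ^ 2) • (blockDiagonal (covStep p traj k))⁻¹

/-- The least squares estimate of the aggregate reward vector, from all episodes before `k`. -/
def thetaHat (p : Params) (traj : ℕ → Trajectory X A H) (v : ℕ → ℝ) (k : ℕ) :
    (X × A) × Fin H → ℝ :=
  (covAll p traj k)⁻¹ *ᵥ ∑ τ ∈ Finset.range k, v τ • (traj τ).featAll

/-- The least squares dynamics backup operator, from the episodes before episode `k`.
The algorithm evaluates it at the first episode of the current epoch. -/
def psiHat (p : Params) (traj : ℕ → Trajectory X A H) (k : ℕ) (h : Fin H) (V : X → ℝ) :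
    X × A → ℝ :=
  (covStep p traj k h)⁻¹ *ᵥ ∑ τ ∈ Finset.range k, V ((traj τ).next h) • (traj τ).feat h

/-- The backup `φ(x, a)ᵀ (θ_h + ψ_h V)`, for a (perturbed) reward vector `θ`. -/
def backup (θ : (X × A) × Fin H → ℝ) (ψ : Fin H → (X → ℝ) → X × A → ℝ)
    (h : Fin H) (V : X → ℝ) (x : X) (a : A) : ℝ :=
  feat x a ⬝ᵥ ((fun j => θ (j, h)) + ψ h V)

/-- The value estimates `V_h`, computed backwards from `V_{H+1} = 0`. -/
def evalV (θ : (X × A) × Fin H → ℝ) (ψ : Fin H → (X → ℝ) → X × A → ℝ)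
    (π : Fin H → X → A → ℝ) (h : Fin (H + 1)) : X → ℝ :=
  Fin.reverseInduction (motive := fun _ => X → ℝ) (fun _ => 0)
    (fun h V x => ∑ a, π h x a * backup θ ψ h V x a) h

/-- The estimates `Q_h`. -/
def evalQ (θ : (X × A) × Fin H → ℝ) (ψ : Fin H → (X → ℝ) → X × A → ℝ)
    (π : Fin H → X → A → ℝ) (h : Fin H) (x : X) (a : A) : ℝ :=
  backup θ ψ h (evalV θ ψ π h.succ) x a

/-- The multiplicative weights update: weights proportional to `w a * exp (η * u a)`. -/
def expUpdate {ι : Type*} [Fintype ι] (η : ℝ) (w u : ι → ℝ) (a : ι) : ℝ :=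
  w a * Real.exp (η * u a) / ∑ b, w b * Real.exp (η * u b)

/-- The perturbed reward vector of ensemble member `i` in episode `k`. -/
def rewardHat (p : Params) (traj : ℕ → Trajectory X A H) (v : ℕ → ℝ)
    (ζ : ℕ → Fin p.m → Noise X A H) (k : ℕ) (i : Fin p.m) : (X × A) × Fin H → ℝ :=
  fun j => thetaHat p traj v k j + ζ (epochStart p traj k) i j

open Classical in
/-- The policy of ensemble member `i` in episode `k`. -/
def policy (p : Params) (traj : ℕ → Trajectory X A H) (v : ℕ → ℝ)
    (ζ : ℕ → Fin p.m → Noise X A H) : ℕ → Fin p.m → Fin H → X → A → ℝ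
  | 0 => fun _ _ _ _ => 1 / Fintype.card A
  | k + 1 => fun i h x =>
    if epochStart p traj (k + 1) = k + 1 then fun _ => 1 / Fintype.card A
    else expUpdate p.etaO (policy p traj v ζ k i h x)
      (evalQ (rewardHat p traj v ζ k i) (psiHat p traj (epochStart p traj k))
        (policy p traj v ζ k i) h x)

/-- The value estimate at the initial state `x₁` for ensemble member `i` in episode `k`. -/
def initValueHat (p : Params) (x₁ : X) (traj : ℕ → Trajectory X A H) (v : ℕ → ℝ)
    (ζ : ℕ → Fin p.m → Noise X A H) (k : ℕ) (i : Fin p.m) : ℝ :=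
  evalV (rewardHat p traj v ζ k i) (psiHat p traj (epochStart p traj k))
    (policy p traj v ζ k i) 0 x₁

open Classical in
/-- The distribution over the ensemble in episode `k`. -/
def weights (p : Params) (x₁ : X) (traj : ℕ → Trajectory X A H) (v : ℕ → ℝ)
    (ζ : ℕ → Fin p.m → Noise X A H) : ℕ → Fin p.m → ℝ
  | 0 => fun _ => 1 / p.m
  | k + 1 =>
    if epochStart p traj (k + 1) = k + 1 then fun _ => 1 / p.m
    else expUpdate p.etaX (weights p x₁ traj v ζ k) (initValueHat p x₁ traj v ζ k)

/-! ### Runs of the algorithm -/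

/-- The random objects of the interaction between the algorithm and the MDP: the perturbations
`ζ k` (only drawn, hence only meaningful, when an epoch starts at `k`), the ensemble index `idx k`,
the trajectory `traj k` and the rewards `rew k h` of episode `k`. -/
structure Interaction (X A : Type*) (H m : ℕ) (Ω : Type*) where
  ζ : ℕ → Ω → Fin m → Noise X A H
  idx : ℕ → Ω → Fin m
  traj : ℕ → Ω → Trajectory X A H
  rew : ℕ → Fin H → Ω → ℝ

namespace Interaction

variable {m : ℕ} {Ω : Type*}

/-- The observed cumulative reward of episode `k`. -/
def agg (S : Interaction X A H m Ω) (k : ℕ) (ω : Ω) : ℝ := ∑ h, S.rew k h ω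

/-- Everything that the learner has drawn or observed before episode `k`. -/
def past (S : Interaction X A H m Ω) (k : ℕ) (ω : Ω) :
    Fin k → (Fin m → Noise X A H) × Fin m × Trajectory X A H × ℝ :=
  fun j => (S.ζ j ω, S.idx j ω, S.traj j ω, S.agg j ω)

/-- The information when the index of episode `k` is drawn. -/
@[reducible] def infoIdx (S : Interaction X A H m Ω) (k : ℕ) : MeasurableSpace Ω :=
  MeasurableSpace.comap (fun ω => (S.past k ω, S.ζ k ω)) inferInstance

/-- The information when the policy of episode `k` is played. -/
@[reducible] def infoTraj (S : Interaction X A H m Ω) (k : ℕ) : MeasurableSpace Ω :=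
  MeasurableSpace.comap (fun ω => (S.past k ω, S.ζ k ω, S.idx k ω)) inferInstance

/-- The information when the rewards of episode `k` are drawn. -/
@[reducible] def infoRew (S : Interaction X A H m Ω) (k : ℕ) : MeasurableSpace Ω :=
  MeasurableSpace.comap (fun ω => (S.past k ω, S.ζ k ω, S.idx k ω, S.traj k ω)) inferInstance

end Interaction

/-- The policy that the learner plays in episode `k`. -/
def played {Ω : Type*} (p : Params) (S : Interaction X A H p.m Ω) (k : ℕ) (ω : Ω) :
    Fin H → X → A → ℝ :=
  policy p (S.traj · ω) (S.agg · ω) (S.ζ · ω) k (S.idx k ω)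

/-- `S` is a run of the algorithm with parameters `p` for `K` episodes in the MDP `M`. -/
structure IsRun {Ω : Type*} [MeasurableSpace Ω] (μ : Measure Ω) [IsProbabilityMeasure μ]
    (M : MDP X A H) (p : Params) (K : ℕ) (S : Interaction X A H p.m Ω) : Prop where
  meas_ζ : ∀ k, Measurable (S.ζ k)
  meas_idx : ∀ k, Measurable (S.idx k)
  meas_traj : ∀ k, Measurable (S.traj k)
  meas_rew : ∀ k h, Measurable (S.rew k h)
  /-- When an epoch starts, the perturbations are i.i.d. centred Gaussian given the past. -/
  law_ζ : ∀ k < K, ∀ᵐ ω ∂μ, epochStart p (S.traj · ω) k = k →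
    condDistrib (S.ζ k) (S.past k) μ (S.past k ω) =
      Measure.pi fun _ => multivariateGaussian 0 (covNoise p (S.traj · ω) k)
  /-- The index is drawn from the current weights. -/
  law_idx : ∀ k < K, ∀ i,
    μ⟦S.idx k ⁻¹' {i} | S.infoIdx k⟧ =ᵐ[μ]
      fun ω => weights p M.init (S.traj · ω) (S.agg · ω) (S.ζ · ω) k i
  /-- The trajectory is drawn by playing the chosen policy in the MDP. -/
  law_traj : ∀ k < K, ∀ τ,
    μ⟦S.traj k ⁻¹' {τ} | S.infoTraj k⟧ =ᵐ[μ] fun ω => trajProb M (played p S k ω) τ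
  /-- The rewards lie in `[0, 1]` and have the prescribed conditional means. -/
  rew_mem : ∀ k < K, ∀ h, ∀ᵐ ω ∂μ, S.rew k h ω ∈ Set.Icc (0 : ℝ) 1
  mean_rew : ∀ k < K, ∀ h,
    μ[S.rew k h | S.infoRew k] =ᵐ[μ]
      fun ω => M.r h ((S.traj k ω).state h) ((S.traj k ω).action h)

/-- The regret over `K` episodes with respect to the policy `πstar`. -/
def regret {Ω : Type*} (M : MDP X A H) (p : Params) (K : ℕ) (S : Interaction X A H p.m Ω)
    (πstar : Fin H → X → A → ℝ) (ω : Ω) : ℝ :=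
  ∑ k ∈ Finset.range K, (value M πstar - value M (played p S k ω))

end Model

/-! ### The choice of parameters, for `nX` states, `nA` actions, horizon `H`, `K` episodes -/

/-- The ensemble size. -/
def ensembleSize (K : ℕ) (δ : ℝ) : ℕ := ⌈9 * Real.log (7 * K / δ)⌉₊

def betaR (nX nA H K : ℕ) (δ : ℝ) : ℝ :=
  2 * H * √(2 * (nX * nA) * H * Real.log (14 * K / δ))

def betaZeta (nX nA H K : ℕ) (δ : ℝ) : ℝ :=
  √(11 * (nX * nA) * H * Real.log (14 * ensembleSize K δ * K / δ))

def betaP (nX nA H K : ℕ) (δ : ℝ) : ℝ :=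
  4 * H * √(3 * (nX * nA) * Real.log (14 * K * H / δ))

def betaQ (nX nA H K : ℕ) (δ : ℝ) : ℝ :=
  2 * H * betaP nX nA H K δ * betaZeta nX nA H K δ

def tunedParams (nX nA H K : ℕ) (δ : ℝ) : Params where
  m := ensembleSize K δ
  etaO := √(3 * (nX * nA) * H * Real.log (2 * K) * Real.log nA / (K * betaQ nX nA H K δ ^ 2))
  etaX := √(3 * (nX * nA) * H * Real.log (2 * K) * Real.log (ensembleSize K δ) /
    (K * betaQ nX nA H K δ ^ 2))
  lamR := H
  lamP := 1
  betaR := betaR nX nA H K δ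
  betaP := betaP nX nA H K δ

end REPO

end

/-! In each epoch let I be an ensemble member whose perturbation turns out to be optimistic. In
episode k the gap V* - V^{π^k} splits into four parts: (a) V* - V̂^{k,I}; (b) V̂^{k,I} minus the
p^k-average of the estimates; (c) that average minus V̂^{k,i_k}; (d) V̂^{k,i_k} - V^{π^k}.
`sum_regret_le` adds them up.

The tabular structure removes the need for clipping. With λ_p = 1 the least squares backup is the
backup of a genuine substochastic kernel, visit counts divided by one plus the number of visits
(`psiHat_eq`, `isSubKernel_empKernel`). Every value estimate is therefore an occupancy measure
paired with the perturbed reward vector. An occupancy measure is nonnegative with mass at most one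
per step, so its squared norm is at most H = λ_r. On the favourable event this bounds all value
estimates by one constant B (`abs_valueHat_le`).

Part (a) uses the value difference identity along the empirical kernel and π*. With o the occupancy
measure of π* under that kernel, V̂ - V* is o·(reward error) + o·ζ + o·(error of the kernel on V*)
minus the advantage of π* over the current policy. The direction o is fixed before ζ is drawn, and
the kernel error acts on the single function V*, so no covering of value functions is needed. The
covariance of ζ makes its standard deviation along o at least the sum of the two confidence widths;
a centred Gaussian reaches its standard deviation with probability at least 1/9, so one of the m
members cancels both errors in every epoch with high probability. The advantage that remains is
averaged against o, which is frozen during an epoch, so the exponential weights bound holds at each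
state and step and can be integrated (`sum_advantage_le`).

Part (b) is the exponential weights bound over the ensemble (`sum_ensemble_gap_le`). Both bounds are
paid once per epoch, and the log-determinants allow only O(dH log K) epochs
(`epochCount_mul_log_two_le`).

Part (c) is a bounded martingale. Part (d), by the value difference identity along the true kernel,
is at most the expected bonus of the trajectory; a second martingale replaces expected by realized
bonuses, whose sum is controlled by the elliptical potential and by counting visits. The doubling
rule makes the stale matrices of the epoch cost only a constant factor. Here the estimates are
random functions, so the kernel error is needed for all bounded functions at once: a union over sign
vectors costs a factor √|X|. This is the source of |X| in max{H, |X|}, while H comes from the regret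
of the policies.

The favourable event is the intersection of seven events, each failing with probability at most δ/7.
The martingale inequalities come from nonnegative processes whose one-step growth is bounded by an
affine function of the noise, so orthogonality of the noise to bounded past quantities suffices
(`integral_le_one_of_noise`). -/

set_option linter.unusedSectionVars false

noncomputable section

namespace REPO

/-! ### Rank-one updates of positive definite matrices -/

section RankOne

variable {n : Type*} [Fintype n] [DecidableEq n]

/-- The bilinear form of the inverse of `A`. -/
def invForm (A : Matrix n n ℝ) (x y : n → ℝ) : ℝ := x ⬝ᵥ A⁻¹ *ᵥ y

lemma invForm_add_left (A : Matrix n n ℝ) (x y z : n → ℝ) :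
    invForm A (x + y) z = invForm A x z + invForm A y z := by
  simp [invForm, add_dotProduct]

lemma invForm_add_right (A : Matrix n n ℝ) (x y z : n → ℝ) :
    invForm A x (y + z) = invForm A x y + invForm A x z := by
  simp [invForm, mulVec_add]

lemma invForm_smul_left (A : Matrix n n ℝ) (c : ℝ) (x y : n → ℝ) :
    invForm A (c • x) y = c * invForm A x y := by
  simp [invForm]

lemma invForm_smul_right (A : Matrix n n ℝ) (c : ℝ) (x y : n → ℝ) :
    invForm A x (c • y) = c * invForm A x y := by
  simp [invForm, mulVec_smul]

lemma dotProduct_mulVec_comm_of_isHermitian {A : Matrix n n ℝ} (hA : A.IsHermitian)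
    (x y : n → ℝ) : x ⬝ᵥ A *ᵥ y = y ⬝ᵥ A *ᵥ x := by
  have h : Aᵀ = A := by simpa [conjTranspose_eq_transpose_of_trivial] using hA.eq
  rw [dotProduct_mulVec, ← mulVec_transpose, h, dotProduct_comm]

lemma invForm_comm {A : Matrix n n ℝ} (hA : A.PosDef) (x y : n → ℝ) :
    invForm A x y = invForm A y x :=
  dotProduct_mulVec_comm_of_isHermitian hA.inv.isHermitian x y

lemma invForm_self_nonneg {A : Matrix n n ℝ} (hA : A.PosDef) (x : n → ℝ) :
    0 ≤ invForm A x x := by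
  simpa [invForm] using hA.inv.posSemidef.dotProduct_mulVec_nonneg x

/-- Cauchy-Schwarz, from the discriminant of the nonnegative quadratic t ↦ form of x + t y. -/
lemma invForm_sq_le {A : Matrix n n ℝ} (hA : A.PosDef) (x y : n → ℝ) :
    invForm A x y ^ 2 ≤ invForm A x x * invForm A y y := by
  have h : ∀ t : ℝ, 0 ≤ invForm A y y * (t * t) + 2 * invForm A x y * t + invForm A x x := by
    intro t
    have := invForm_self_nonneg hA (x + t • y)
    simp only [invForm_add_left, invForm_add_right, invForm_smul_left, invForm_smul_right,
      invForm_comm hA y x] at this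
    linarith
  have := discrim_le_zero h
  rw [discrim] at this
  nlinarith

lemma posDef_add_vecMulVec {A : Matrix n n ℝ} (hA : A.PosDef) (u : n → ℝ) :
    (A + vecMulVec u u).PosDef :=
  hA.add_posSemidef (by simpa using posSemidef_vecMulVec_self_star u)

lemma isUnit_det_of_posDef {A : Matrix n n ℝ} (hA : A.PosDef) : IsUnit A.det :=
  (isUnit_iff_isUnit_det A).1 hA.isUnit

/-- The Sherman-Morrison formula, verified by multiplying out. -/
lemma inv_add_vecMulVec {A : Matrix n n ℝ} (hA : A.PosDef) (u : n → ℝ) :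
    (A + vecMulVec u u)⁻¹ =
      A⁻¹ - (1 + invForm A u u)⁻¹ • vecMulVec (A⁻¹ *ᵥ u) (A⁻¹ *ᵥ u) := by
  have hw : 1 + invForm A u u ≠ 0 := by have := invForm_self_nonneg hA u; positivity
  have hT : (A⁻¹)ᵀ = A⁻¹ := by
    simpa [conjTranspose_eq_transpose_of_trivial] using hA.inv.isHermitian.eq
  have hu : u ᵥ* A⁻¹ = A⁻¹ *ᵥ u := by rw [← mulVec_transpose, hT]
  apply inv_eq_right_inv
  rw [Matrix.add_mul, Matrix.mul_sub, Matrix.mul_sub, mul_nonsing_inv _ (isUnit_det_of_posDef hA),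
    vecMulVec_mul, hu, Matrix.mul_smul, Matrix.mul_smul, mul_vecMulVec, mulVec_mulVec,
    mul_nonsing_inv _ (isUnit_det_of_posDef hA), one_mulVec, vecMulVec_mul_vecMulVec]
  have h2 : u ⬝ᵥ (A⁻¹ *ᵥ u) = invForm A u u := rfl
  rw [h2]
  ext i j
  simp only [Matrix.add_apply, Matrix.sub_apply, Matrix.smul_apply, vecMulVec_apply, smul_eq_mul, one_apply,
    Pi.smul_apply]
  field_simp
  ring

/-- The matrix determinant lemma. Together with the previous formula it reduces every statement
about a new observation to scalars. -/
lemma det_add_vecMulVec {A : Matrix n n ℝ} (hA : A.PosDef) (u : n → ℝ) :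
    (A + vecMulVec u u).det = A.det * (1 + invForm A u u) := by
  rw [vecMulVec_eq Unit, det_add_replicateCol_mul_replicateRow (isUnit_det_of_posDef hA)]
  congr 1
  rw [det_unique]
  simp [invForm, Matrix.mul_assoc, Matrix.mul_apply, dotProduct, mulVec]

lemma invForm_add_vecMulVec {A : Matrix n n ℝ} (hA : A.PosDef) (u x y : n → ℝ) :
    invForm (A + vecMulVec u u) x y =
      invForm A x y - invForm A x u * invForm A u y / (1 + invForm A u u) := by
  have h : (A⁻¹ *ᵥ u) ⬝ᵥ y = invForm A u y := by
    rw [dotProduct_comm]; exact dotProduct_mulVec_comm_of_isHermitian hA.inv.isHermitian y u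
  rw [invForm, inv_add_vecMulVec hA, sub_mulVec, dotProduct_sub, smul_mulVec, dotProduct_smul,
    vecMulVec_mulVec, h]
  simp only [invForm, smul_eq_mul, op_smul_eq_smul, dotProduct_smul]
  ring

/-- The regularized Gram matrix of the first `k` vectors of a sequence. -/
def gram (lam : ℝ) (φ : ℕ → n → ℝ) (k : ℕ) : Matrix n n ℝ :=
  lam • (1 : Matrix n n ℝ) + ∑ τ ∈ Finset.range k, vecMulVec (φ τ) (φ τ)

variable {lam : ℝ} {φ : ℕ → n → ℝ}

lemma gram_succ (k : ℕ) : gram lam φ (k + 1) = gram lam φ k + vecMulVec (φ k) (φ k) := by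
  simp [gram, Finset.sum_range_succ, add_assoc]

lemma gram_zero : gram lam φ 0 = lam • (1 : Matrix n n ℝ) := by simp [gram]

lemma posDef_gram (hlam : 0 < lam) (k : ℕ) : (gram lam φ k).PosDef := by
  induction k with
  | zero => rw [gram_zero]; exact PosDef.one.smul hlam
  | succ k ih => rw [gram_succ]; exact posDef_add_vecMulVec ih _

lemma det_gram_pos (hlam : 0 < lam) (k : ℕ) : 0 < (gram lam φ k).det :=
  (posDef_gram hlam k).det_pos

lemma det_gram_mono (hlam : 0 < lam) : Monotone fun k => (gram lam φ k).det := by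
  refine monotone_nat_of_le_succ fun k => ?_
  rw [gram_succ, det_add_vecMulVec (posDef_gram hlam k)]
  have := invForm_self_nonneg (posDef_gram (φ := φ) hlam k) (φ k)
  nlinarith [det_gram_pos (φ := φ) hlam k]

lemma invForm_gram_antitone (hlam : 0 < lam) (x : n → ℝ) :
    Antitone fun k => invForm (gram lam φ k) x x := by
  refine antitone_nat_of_succ_le fun k => ?_
  have hA := posDef_gram (φ := φ) hlam k
  rw [gram_succ, invForm_add_vecMulVec hA, invForm_comm hA (φ k) x]
  have := invForm_self_nonneg hA (φ k)
  have : 0 ≤ invForm (gram lam φ k) x (φ k) * invForm (gram lam φ k) x (φ k) /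
    (1 + invForm (gram lam φ k) (φ k) (φ k)) := div_nonneg (mul_self_nonneg _) (by linarith)
  linarith

lemma invForm_smul_one (hlam : 0 < lam) (x y : n → ℝ) :
    invForm (lam • (1 : Matrix n n ℝ)) x y = x ⬝ᵥ y / lam := by
  have : (lam • (1 : Matrix n n ℝ))⁻¹ = lam⁻¹ • 1 := by
    apply inv_eq_right_inv
    rw [Matrix.smul_mul, Matrix.mul_smul, smul_smul, mul_inv_cancel₀ hlam.ne']; simp
  rw [invForm, this, smul_mulVec]
  simp; ring

lemma invForm_gram_le (hlam : 0 < lam) (x : n → ℝ) (k : ℕ) :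
    invForm (gram lam φ k) x x ≤ x ⬝ᵥ x / lam := by
  have := invForm_gram_antitone (φ := φ) hlam x (Nat.zero_le k)
  simpa [gram_zero, invForm_smul_one hlam] using this

/-- Comparison of the inverse forms by the ratio of the determinants. -/
lemma invForm_gram_mul_det_le (hlam : 0 < lam) (x : n → ℝ) {j k : ℕ} (hjk : j ≤ k) :
    invForm (gram lam φ j) x x * (gram lam φ j).det ≤
      invForm (gram lam φ k) x x * (gram lam φ k).det := by
  refine monotone_nat_of_le_succ (f := fun k => invForm (gram lam φ k) x x * (gram lam φ k).det)
    (fun k => ?_) hjk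
  have hA := posDef_gram (φ := φ) hlam k
  have hw := invForm_self_nonneg hA (φ k)
  rw [gram_succ, invForm_add_vecMulVec hA, invForm_comm hA (φ k) x, det_add_vecMulVec hA]
  -- One update multiplies the determinant by 1 + w and lowers the form by (x,φ)²/(1 + w); after
  -- clearing denominators the product grows exactly because of Cauchy-Schwarz.
  have hcs := invForm_sq_le hA x (φ k)
  have hd := det_gram_pos (φ := φ) hlam k
  have h1 : (1 + invForm (gram lam φ k) (φ k) (φ k)) ≠ 0 := by positivity
  have : (invForm (gram lam φ k) x x - invForm (gram lam φ k) x (φ k) *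
      invForm (gram lam φ k) x (φ k) / (1 + invForm (gram lam φ k) (φ k) (φ k))) *
      ((gram lam φ k).det * (1 + invForm (gram lam φ k) (φ k) (φ k))) =
      (gram lam φ k).det * (invForm (gram lam φ k) x x * (1 + invForm (gram lam φ k) (φ k) (φ k)) -
      invForm (gram lam φ k) x (φ k) ^ 2) := by
    field_simp
  rw [this]
  nlinarith

/-- The potential lemma: the sum of the log-determinant increments. -/
lemma sum_log_one_add_invForm (hlam : 0 < lam) (k : ℕ) :
    ∑ τ ∈ Finset.range k, Real.log (1 + invForm (gram lam φ τ) (φ τ) (φ τ)) =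
      Real.log (gram lam φ k).det - Real.log (gram lam φ 0).det := by
  rw [← Finset.sum_range_sub (fun k => Real.log (gram lam φ k).det)]
  refine Finset.sum_congr rfl fun τ _ => ?_
  have hw := invForm_self_nonneg (posDef_gram (φ := φ) hlam τ) (φ τ)
  rw [gram_succ, det_add_vecMulVec (posDef_gram hlam τ),
    Real.log_mul (det_gram_pos hlam τ).ne' (by positivity)]
  ring

lemma gram_quadForm (x : n → ℝ) (k : ℕ) :
    x ⬝ᵥ gram lam φ k *ᵥ x = lam * (x ⬝ᵥ x) + ∑ τ ∈ Finset.range k, (x ⬝ᵥ φ τ) ^ 2 := by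
  induction k with
  | zero => simp [gram_zero, smul_mulVec]
  | succ k ih =>
    rw [gram_succ, add_mulVec, dotProduct_add, ih, Finset.sum_range_succ, vecMulVec_mulVec]
    simp [dotProduct_comm (φ k) x]
    ring

lemma dotProduct_sq_le (x y : n → ℝ) : (x ⬝ᵥ y) ^ 2 ≤ (x ⬝ᵥ x) * (y ⬝ᵥ y) := by
  simpa [dotProduct, sq] using Finset.sum_mul_sq_le_sq_mul_sq Finset.univ x y

/-- Each eigenvalue is the quadratic form at a unit eigenvector, hence at most `lam + k * b`; the
determinant is their product. -/
lemma det_gram_le (hlam : 0 < lam) {b : ℝ} (hb : ∀ τ, φ τ ⬝ᵥ φ τ ≤ b) (k : ℕ) :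
    (gram lam φ k).det ≤ (lam + k * b) ^ Fintype.card n := by
  have hA := posDef_gram (φ := φ) hlam k
  rw [hA.isHermitian.det_eq_prod_eigenvalues]
  change ∏ i, hA.isHermitian.eigenvalues i ≤ _
  refine (Finset.prod_le_prod (fun i _ => (hA.eigenvalues_pos i).le) fun i _ => ?_).trans
    (by simp : ∏ _i : n, (lam + k * b) ≤ (lam + k * b) ^ Fintype.card n)
  rw [hA.isHermitian.eigenvalues_eq]
  set v : n → ℝ := ⇑(hA.isHermitian.eigenvectorBasis i) with hv
  have hv1 : v ⬝ᵥ v = 1 := by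
    have := (hA.isHermitian.eigenvectorBasis).orthonormal.1 i
    have h2 := EuclideanSpace.real_norm_sq_eq (hA.isHermitian.eigenvectorBasis i)
    rw [this] at h2
    simp only [dotProduct, hv]
    rw [← one_pow 2, h2]
    simp [sq]
  simp only [star_trivial, RCLike.re_to_real]
  rw [gram_quadForm, hv1, mul_one]
  gcongr
  calc ∑ τ ∈ Finset.range k, (v ⬝ᵥ φ τ) ^ 2 ≤ ∑ τ ∈ Finset.range k, b :=
        Finset.sum_le_sum fun τ _ => (dotProduct_sq_le _ _).trans (by rw [hv1, one_mul]; exact hb τ)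
    _ = k * b := by simp

end RankOne

/-! ### Exponential supermartingales -/

section Scalar

/-- The convex exponential lies below its chord on [-R, R]. This is the only use of boundedness in
Hoeffding's lemma, both for the noise and for exponential weights. -/
lemma exp_mul_le_cosh_add {b y R : ℝ} (hR : 0 < R) (hy : |y| ≤ R) :
    Real.exp (b * y) ≤ Real.cosh (b * R) + y / R * Real.sinh (b * R) := by
  obtain ⟨h1, h2⟩ := abs_le.1 hy
  have := convexOn_exp.2 (Set.mem_univ (b * R)) (Set.mem_univ (-(b * R)))
    (show 0 ≤ (1 + y / R) / 2 by
        have : -1 ≤ y / R := by rw [le_div_iff₀ hR]; linarith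
        linarith)
    (show 0 ≤ (1 - y / R) / 2 by
        have : y / R ≤ 1 := by rw [div_le_iff₀ hR]; linarith
        linarith) (by ring)
  simp only [smul_eq_mul] at this
  have e : (1 + y / R) / 2 * (b * R) + (1 - y / R) / 2 * -(b * R) = b * y := by field_simp; ring
  rw [e] at this
  rw [Real.cosh_eq, Real.sinh_eq]
  linarith

lemma abs_sinh_le_exp_half_sq (x : ℝ) : |Real.sinh x| ≤ Real.exp (x ^ 2 / 2) := by
  refine le_trans ?_ (Real.cosh_le_exp_half_sq x)
  rw [Real.abs_sinh, ← Real.cosh_abs]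
  exact Real.sinh_lt_cosh _ |>.le

/-- The slope of the affine majorant of the Hoeffding exponential. -/
def hoeffdingCoeff (b R : ℝ) : ℝ := Real.exp (-((b * R) ^ 2 / 2)) * Real.sinh (b * R) / R

/-- Hoeffding's lemma in pointwise form: a majorant affine in y, with constant term 1, so that
integrating against noise needs no exponential moment. -/
lemma exp_sub_le_one_add {b y R : ℝ} (hR : 0 < R) (hy : |y| ≤ R) :
    Real.exp (b * y - (b * R) ^ 2 / 2) ≤ 1 + y * hoeffdingCoeff b R := by
  have h1 := exp_mul_le_cosh_add (b := b) hR hy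
  have h2 := Real.cosh_le_exp_half_sq (b * R)
  rw [sub_eq_add_neg, Real.exp_add]
  have h3 := Real.exp_pos (-((b * R) ^ 2 / 2))
  have h4 : Real.exp (-((b * R) ^ 2 / 2)) * Real.exp ((b * R) ^ 2 / 2) = 1 := by
    rw [← Real.exp_add]; simp
  calc _ ≤ (Real.exp ((b * R) ^ 2 / 2) + y / R * Real.sinh (b * R)) *
        Real.exp (-((b * R) ^ 2 / 2)) := by gcongr; linarith
    _ = 1 + y * hoeffdingCoeff b R := by
      rw [add_mul, mul_comm (Real.exp ((b * R) ^ 2 / 2)), h4, hoeffdingCoeff]; ring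

lemma abs_hoeffdingCoeff_le {b R : ℝ} (hR : 0 < R) : |hoeffdingCoeff b R| ≤ 1 / R := by
  rw [hoeffdingCoeff, abs_div, abs_mul, abs_of_pos hR, Real.abs_exp]
  gcongr
  calc _ ≤ Real.exp (-((b * R) ^ 2 / 2)) * Real.exp ((b * R) ^ 2 / 2) := by
        gcongr; exact abs_sinh_le_exp_half_sq _
    _ = 1 := by rw [← Real.exp_add]; simp

/-- Equivalent to w/(1 + w) ≤ log (1 + w): the determinant factor pays for the quadratic term of the
noise in one self-normalized step. -/
lemma inv_sqrt_one_add_mul_exp_le {w : ℝ} (hw : 0 ≤ w) :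
    (√(1 + w))⁻¹ * Real.exp (w / (1 + w) / 2) ≤ 1 := by
  have h1 : (0 : ℝ) < 1 + w := by linarith
  rw [inv_mul_le_iff₀ (Real.sqrt_pos.2 h1), mul_one]
  apply Real.le_sqrt_of_sq_le
  rw [← Real.exp_nat_mul]
  have e : ((2 : ℕ) : ℝ) * (w / (1 + w) / 2) = w / (1 + w) := by push_cast; ring
  rw [e, ← Real.le_log_iff_exp_le h1]
  have := Real.one_sub_inv_le_log_of_pos h1
  have e2 : 1 - (1 + w)⁻¹ = w / (1 + w) := by field_simp; ring
  linarith

/-- The slope of the affine majorant of one step of the self-normalized exponential. -/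
def selfNormCoeff (R w s : ℝ) : ℝ :=
  (√(1 + w))⁻¹ * Real.exp (w / (1 + w) / 2) *
    (Real.exp (-(s ^ 2 / (2 * R ^ 2 * (1 + w))) + (s / (R ^ 2 * (1 + w)) * R) ^ 2 / 2) *
      hoeffdingCoeff (s / (R ^ 2 * (1 + w))) R)

lemma selfNorm_exponent_le {R w s : ℝ} (hR : 0 < R) (hw : 0 ≤ w) :
    -(s ^ 2 / (2 * R ^ 2 * (1 + w))) + (s / (R ^ 2 * (1 + w)) * R) ^ 2 / 2 ≤ 0 := by
  have h1 : (0 : ℝ) < 1 + w := by linarith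
  have e : -(s ^ 2 / (2 * R ^ 2 * (1 + w))) + (s / (R ^ 2 * (1 + w)) * R) ^ 2 / 2 =
      -(s ^ 2 * w / (2 * R ^ 2 * (1 + w) ^ 2)) := by
    field_simp; ring
  rw [e]
  have : 0 ≤ s ^ 2 * w / (2 * R ^ 2 * (1 + w) ^ 2) := by positivity
  linarith

/-- The exponent is the change of the self-normalized square under one observation. Its y² part is
absorbed by the determinant, its linear part by Hoeffding, and the negative s² part leaves a
nonpositive remainder. For bounded noise this replaces the method of mixtures. -/
lemma selfNorm_step {R w s y : ℝ} (hR : 0 < R) (hw : 0 ≤ w) (hy : |y| ≤ R) :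
    (√(1 + w))⁻¹ * Real.exp ((2 * y * s + y ^ 2 * w - s ^ 2) / (1 + w) / (2 * R ^ 2)) ≤
      1 + y * selfNormCoeff R w s := by
  have h1 : (0 : ℝ) < 1 + w := by linarith
  -- The coefficient of y in the exponent.
  set b := s / (R ^ 2 * (1 + w)) with hb
  set E := -(s ^ 2 / (2 * R ^ 2 * (1 + w))) + (b * R) ^ 2 / 2 with hE
  have hE0 : E ≤ 0 := selfNorm_exponent_le hR hw
  have hA := inv_sqrt_one_add_mul_exp_le hw
  have hA0 : 0 ≤ (√(1 + w))⁻¹ * Real.exp (w / (1 + w) / 2) := by positivity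
  have hstep := exp_sub_le_one_add (b := b) hR hy
  have hy2 : y ^ 2 ≤ R ^ 2 := sq_le_sq' (abs_le.1 hy).1 (abs_le.1 hy).2
  -- Replacing y² by R² is the only loss; after that the two sides agree identically.
  have key : (2 * y * s + y ^ 2 * w - s ^ 2) / (1 + w) / (2 * R ^ 2) ≤
      w / (1 + w) / 2 + (E + (b * y - (b * R) ^ 2 / 2)) := by
    have e : w / (1 + w) / 2 + (E + (b * y - (b * R) ^ 2 / 2)) =
        (2 * y * s + R ^ 2 * w - s ^ 2) / (1 + w) / (2 * R ^ 2) := by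
      rw [hE, hb]; field_simp; ring
    rw [e]; gcongr
  have hexp : Real.exp E ≤ 1 := Real.exp_le_one_iff.2 hE0
  calc _ ≤ (√(1 + w))⁻¹ * Real.exp (w / (1 + w) / 2 + (E + (b * y - (b * R) ^ 2 / 2))) := by gcongr
    _ = ((√(1 + w))⁻¹ * Real.exp (w / (1 + w) / 2)) *
        (Real.exp E * Real.exp (b * y - (b * R) ^ 2 / 2)) := by
      rw [Real.exp_add, Real.exp_add E]; ring
    _ ≤ ((√(1 + w))⁻¹ * Real.exp (w / (1 + w) / 2)) *
        (Real.exp E * (1 + y * hoeffdingCoeff b R)) := by gcongr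
    _ = ((√(1 + w))⁻¹ * Real.exp (w / (1 + w) / 2)) * Real.exp E + y * selfNormCoeff R w s := by
      rw [selfNormCoeff]; ring
    _ ≤ 1 + y * selfNormCoeff R w s := by
      gcongr
      exact mul_le_one₀ hA (Real.exp_pos _).le hexp

lemma abs_selfNormCoeff_le {R w : ℝ} (s : ℝ) (hR : 0 < R) (hw : 0 ≤ w) :
    |selfNormCoeff R w s| ≤ 1 / R := by
  have hA := inv_sqrt_one_add_mul_exp_le hw
  have hA0 : 0 ≤ (√(1 + w))⁻¹ * Real.exp (w / (1 + w) / 2) := by positivity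
  have hexp := Real.exp_le_one_iff.2 (selfNorm_exponent_le (s := s) hR hw)
  rw [selfNormCoeff, abs_mul, abs_mul (Real.exp _), abs_of_nonneg hA0, Real.abs_exp]
  calc _ ≤ 1 * (1 * (1 / R)) := by gcongr; exact abs_hoeffdingCoeff_le hR
    _ = 1 / R := by ring

end Scalar

/-! ### The self-normalized exponential and its growth in one step. -/

section SelfNorm

variable {n : Type*} [Fintype n] [DecidableEq n]

/-- The exponential of the self-normalized noise. -/
def selfNorm (lam R : ℝ) (φ : ℕ → n → ℝ) (ε : ℕ → ℝ) (k : ℕ) : ℝ :=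
  (√((gram lam φ k).det / (gram lam φ 0).det))⁻¹ *
    Real.exp (invForm (gram lam φ k) (∑ τ ∈ Finset.range k, ε τ • φ τ)
      (∑ τ ∈ Finset.range k, ε τ • φ τ) / (2 * R ^ 2))

/-- The slope of the affine majorant of one step of `selfNorm`. -/
def selfNormSlope (lam R : ℝ) (φ : ℕ → n → ℝ) (ε : ℕ → ℝ) (k : ℕ) : ℝ :=
  selfNorm lam R φ ε k * selfNormCoeff R (invForm (gram lam φ k) (φ k) (φ k))
    (invForm (gram lam φ k) (φ k) (∑ τ ∈ Finset.range k, ε τ • φ τ))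

variable {lam R : ℝ} {φ : ℕ → n → ℝ} {ε : ℕ → ℝ}

lemma selfNorm_nonneg (k : ℕ) : 0 ≤ selfNorm lam R φ ε k := by
  rw [selfNorm]; positivity

lemma selfNorm_zero (hlam : 0 < lam) : selfNorm lam R φ ε 0 = 1 := by
  simp [selfNorm, invForm, div_self (det_gram_pos (φ := φ) hlam 0).ne']

lemma selfNorm_succ_le (hlam : 0 < lam) (hR : 0 < R) {k : ℕ} (hε : |ε k| ≤ R) :
    selfNorm lam R φ ε (k + 1) ≤
      selfNorm lam R φ ε k + selfNormSlope lam R φ ε k * ε k := by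
  set A := gram lam φ k with hAdef
  have hA : A.PosDef := posDef_gram hlam k
  set S := ∑ τ ∈ Finset.range k, ε τ • φ τ with hS
  set w := invForm A (φ k) (φ k) with hw
  set s := invForm A (φ k) S with hs
  have hw0 : 0 ≤ w := invForm_self_nonneg hA _
  have h1 : (0 : ℝ) < 1 + w := by linarith
  -- Sherman-Morrison applied to the new noise sum: the change depends only on the scalars `w`, `s`
  -- and `ε k`.
  have hform : invForm (gram lam φ (k + 1)) (S + ε k • φ k) (S + ε k • φ k) =
      invForm A S S + (2 * ε k * s + ε k ^ 2 * w - s ^ 2) / (1 + w) := by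
    rw [gram_succ, invForm_add_vecMulVec hA]
    simp only [invForm_add_left, invForm_add_right, invForm_smul_left, invForm_smul_right,
      invForm_comm hA S (φ k), ← hw, ← hs]
    field_simp
    ring
  have hdet : (√((gram lam φ (k + 1)).det / (gram lam φ 0).det))⁻¹ =
      (√(A.det / (gram lam φ 0).det))⁻¹ * (√(1 + w))⁻¹ := by
    rw [gram_succ, det_add_vecMulVec hA, mul_div_right_comm, Real.sqrt_mul', mul_inv]
    exact h1.le
  have hD : selfNorm lam R φ ε (k + 1) = selfNorm lam R φ ε k * ((√(1 + w))⁻¹ *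
      Real.exp ((2 * ε k * s + ε k ^ 2 * w - s ^ 2) / (1 + w) / (2 * R ^ 2))) := by
    rw [selfNorm, Finset.sum_range_succ, ← hS, hform, hdet, add_div, Real.exp_add, selfNorm]
    ring
  rw [hD, selfNormSlope]
  have := mul_le_mul_of_nonneg_left (selfNorm_step (s := s) hR hw0 hε)
    (selfNorm_nonneg (lam := lam) (R := R) (φ := φ) (ε := ε) k)
  linarith

lemma abs_selfNormSlope_le (hlam : 0 < lam) (hR : 0 < R) (k : ℕ) :
    |selfNormSlope lam R φ ε k| ≤ selfNorm lam R φ ε k / R := by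
  rw [selfNormSlope, abs_mul, abs_of_nonneg (selfNorm_nonneg k), div_eq_mul_one_div]
  gcongr
  · exact selfNorm_nonneg k
  · exact abs_selfNormCoeff_le _ hR (invForm_self_nonneg (posDef_gram hlam k) _)

/-- The affine term is at most the current value, so the process at most doubles in a step. The
bound serves only integrability. -/
lemma selfNorm_le_two_pow (hlam : 0 < lam) (hR : 0 < R) (k : ℕ) (hε : ∀ j < k, |ε j| ≤ R) :
    selfNorm lam R φ ε k ≤ 2 ^ k := by
  induction k with
  | zero => simp [selfNorm_zero hlam]
  | succ k ih =>
    have h1 := selfNorm_succ_le (lam := lam) (φ := φ) hlam hR (hε k (by simp))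
    have h2 := ih fun j hj => hε j (by omega)
    have h3 := abs_selfNormSlope_le (φ := φ) (ε := ε) hlam hR k
    have h4 : selfNormSlope lam R φ ε k * ε k ≤ selfNorm lam R φ ε k / R * R := by
      refine (le_abs_self _).trans ?_
      rw [abs_mul]
      exact mul_le_mul h3 (hε k (by simp)) (abs_nonneg _)
        (div_nonneg (selfNorm_nonneg k) hR.le)
    rw [div_mul_cancel₀ _ hR.ne'] at h4
    rw [pow_succ]; linarith

/-- A bound on `selfNorm` bounds the self-normalized noise. -/
lemma invForm_le_of_selfNorm_lt (hlam : 0 < lam) (hR : 0 < R) {k : ℕ} {δ : ℝ}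
    (h : selfNorm lam R φ ε k < 1 / δ) :
    invForm (gram lam φ k) (∑ τ ∈ Finset.range k, ε τ • φ τ) (∑ τ ∈ Finset.range k, ε τ • φ τ) ≤
      R ^ 2 * (Real.log ((gram lam φ k).det / (gram lam φ 0).det) + 2 * Real.log (1 / δ)) := by
  have hq : 0 < (gram lam φ k).det / (gram lam φ 0).det :=
    div_pos (det_gram_pos hlam k) (det_gram_pos hlam 0)
  have h2 : 0 < selfNorm lam R φ ε k := by
    rw [selfNorm]; have := Real.sqrt_pos.2 hq; positivity
  have h3 := Real.log_lt_log h2 h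
  rw [selfNorm, Real.log_mul (by have := Real.sqrt_pos.2 hq; positivity) (Real.exp_ne_zero _),
    Real.log_exp, Real.log_inv, Real.log_sqrt hq.le] at h3
  have h4 : invForm (gram lam φ k) (∑ τ ∈ Finset.range k, ε τ • φ τ)
      (∑ τ ∈ Finset.range k, ε τ • φ τ) / (2 * R ^ 2) ≤
      (Real.log ((gram lam φ k).det / (gram lam φ 0).det) + 2 * Real.log (1 / δ)) / 2 := by linarith
  rw [div_le_iff₀ (by positivity)] at h4
  linarith

end SelfNorm

/-! ### Measurability of the self-normalized process. -/

section Measurability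

variable {n : Type*} [Fintype n] [DecidableEq n] {Ω : Type*} [MeasurableSpace Ω]

lemma measurable_det {A : Ω → Matrix n n ℝ} (hA : ∀ i j, Measurable fun ω => A ω i j) :
    Measurable fun ω => (A ω).det := by
  simp only [det_apply]
  fun_prop

lemma measurable_inv_apply {A : Ω → Matrix n n ℝ} (hA : ∀ i j, Measurable fun ω => A ω i j)
    (i j : n) : Measurable fun ω => (A ω)⁻¹ i j := by
  simp only [Matrix.inv_def, Ring.inverse_eq_inv', Matrix.smul_apply, smul_eq_mul, adjugate_apply]
  refine (measurable_det hA).inv.mul (measurable_det fun a b => ?_)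
  simp only [updateRow_apply]
  split_ifs
  · exact measurable_const
  · exact hA a b

lemma measurable_invForm {A : Ω → Matrix n n ℝ} {x y : Ω → n → ℝ}
    (hA : ∀ i j, Measurable fun ω => A ω i j) (hx : ∀ i, Measurable fun ω => x ω i)
    (hy : ∀ i, Measurable fun ω => y ω i) : Measurable fun ω => invForm (A ω) (x ω) (y ω) := by
  simp only [invForm, dotProduct, mulVec]
  exact Finset.measurable_sum _ fun i _ => (hx i).mul <|
    Finset.measurable_sum _ fun j _ => (measurable_inv_apply hA i j).mul (hy j)

lemma measurable_gram_apply {lam : ℝ} {φ : ℕ → Ω → n → ℝ} {k : ℕ}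
    (hφ : ∀ j < k, ∀ i, Measurable fun ω => φ j ω i) (i j : n) :
    Measurable fun ω => gram lam (φ · ω) k i j := by
  simp only [gram, Matrix.add_apply, Matrix.sum_apply, vecMulVec_apply]
  exact measurable_const.add (Finset.measurable_sum _ fun τ hτ =>
    (hφ τ (by simpa using hτ) i).mul (hφ τ (by simpa using hτ) j))

variable {lam R : ℝ} {φ : ℕ → Ω → n → ℝ} {ε : ℕ → Ω → ℝ} {k : ℕ}

lemma measurable_errSum (hφ : ∀ j < k, ∀ i, Measurable fun ω => φ j ω i)
    (hε : ∀ j < k, Measurable (ε j)) (i : n) :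
    Measurable fun ω => (∑ τ ∈ Finset.range k, ε τ ω • φ τ ω) i := by
  simp only [Finset.sum_apply, Pi.smul_apply, smul_eq_mul]
  exact Finset.measurable_sum _ fun τ hτ =>
    (hε τ (by simpa using hτ)).mul (hφ τ (by simpa using hτ) i)

lemma measurable_selfNorm (hφ : ∀ j < k, ∀ i, Measurable fun ω => φ j ω i)
    (hε : ∀ j < k, Measurable (ε j)) :
    Measurable fun ω => selfNorm lam R (φ · ω) (ε · ω) k := by
  have h1 := measurable_det (measurable_gram_apply (lam := lam) hφ)
  have h3 := measurable_invForm (measurable_gram_apply (lam := lam) hφ)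
    (measurable_errSum hφ hε) (measurable_errSum hφ hε)
  simp only [selfNorm, gram_zero]
  fun_prop

lemma measurable_selfNormSlope (hφ : ∀ j < k + 1, ∀ i, Measurable fun ω => φ j ω i)
    (hε : ∀ j < k, Measurable (ε j)) :
    Measurable fun ω => selfNormSlope lam R (φ · ω) (ε · ω) k := by
  have hφ' : ∀ j < k, ∀ i, Measurable fun ω => φ j ω i := fun j hj => hφ j (by omega)
  have h1 := measurable_selfNorm (lam := lam) (R := R) hφ' hε
  have h2 := measurable_invForm (measurable_gram_apply (lam := lam) hφ')
    (hφ k (by omega)) (hφ k (by omega))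
  have h3 := measurable_invForm (measurable_gram_apply (lam := lam) hφ')
    (hφ k (by omega)) (measurable_errSum hφ' hε)
  have h4 : Measurable fun q : ℝ × ℝ => selfNormCoeff R q.1 q.2 := by
    unfold selfNormCoeff hoeffdingCoeff
    have := Real.continuous_sinh.measurable
    fun_prop
  exact h1.mul (h4.comp (h2.prodMk h3))

end Measurability

/-! ### Martingale inequalities from orthogonality, and integrals over draws with a known
conditional law. -/

section Concentration

variable {Ω : Type*} [mΩ : MeasurableSpace Ω] {μ : Measure Ω} [IsProbabilityMeasure μ]

/-- `y` is orthogonal to all bounded `m`-measurable functions. -/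
def IsNoise {Ω : Type*} {mΩ : MeasurableSpace Ω} (μ : Measure Ω) (m : MeasurableSpace Ω)
    (y : Ω → ℝ) : Prop :=
  ∀ Z : Ω → ℝ, Measurable[m] Z → (∃ C, ∀ᵐ ω ∂μ, |Z ω| ≤ C) → ∫ ω, Z ω * y ω ∂μ = 0

/-- Markov's inequality at level 1/δ. -/
lemma measure_le_of_integral_le_one {D : Ω → ℝ} (hD : 0 ≤ D) (hint : Integrable D μ)
    (h1 : ∫ ω, D ω ∂μ ≤ 1) {δ : ℝ} (hδ : 0 < δ) :
    μ {ω | 1 / δ ≤ D ω} ≤ ENNReal.ofReal δ := by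
  have := mul_meas_ge_le_integral_of_nonneg (Filter.Eventually.of_forall hD) hint (1 / δ)
  rw [← ENNReal.ofReal_toReal (measure_ne_top μ {ω | 1 / δ ≤ D ω})]
  apply ENNReal.ofReal_le_ofReal
  have h2 : 1 / δ * μ.real {ω | 1 / δ ≤ D ω} ≤ 1 := this.trans h1
  rw [div_mul_eq_mul_div, div_le_one hδ, one_mul] at h2
  exact h2

/-- A nonnegative process whose increments are dominated by noise has mean at most one. -/
lemma integral_le_one_of_noise {D Z y : ℕ → Ω → ℝ} {𝓕 : ℕ → MeasurableSpace Ω} {K : ℕ} {R : ℝ}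
    (h𝓕 : ∀ k, 𝓕 k ≤ mΩ) (hD0 : ∀ ω, D 0 ω = 1) (hDm : ∀ k ≤ K, Measurable (D k))
    (hym : ∀ k < K, Measurable (y k)) (hyR : ∀ k < K, ∀ᵐ ω ∂μ, |y k ω| ≤ R)
    (hDb : ∀ k ≤ K, ∃ C, ∀ᵐ ω ∂μ, |D k ω| ≤ C) (hZm : ∀ k < K, Measurable[𝓕 k] (Z k))
    (hZb : ∀ k < K, ∃ C, ∀ᵐ ω ∂μ, |Z k ω| ≤ C) (hy : ∀ k < K, IsNoise μ (𝓕 k) (y k))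
    (hstep : ∀ k < K, ∀ᵐ ω ∂μ, D (k + 1) ω ≤ D k ω + Z k ω * y k ω) {k : ℕ} (hk : k ≤ K) :
    Integrable (D k) μ ∧ ∫ ω, D k ω ∂μ ≤ 1 := by
  have hint : ∀ k ≤ K, Integrable (D k) μ := fun k hk => by
    obtain ⟨C, hC⟩ := hDb k hk
    exact Integrable.of_bound (hDm k hk).aestronglyMeasurable C hC
  refine ⟨hint k hk, ?_⟩
  induction k with
  | zero => simp [hD0]
  | succ k ih =>
    obtain ⟨C, hC⟩ := hZb k hk
    have hZy : Integrable (fun ω => Z k ω * y k ω) μ := by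
      refine Integrable.of_bound
        (((hZm k hk).mono (h𝓕 k) le_rfl).mul (hym k hk)).aestronglyMeasurable (C * R) ?_
      filter_upwards [hC, hyR k hk] with ω h1 h2
      rw [Real.norm_eq_abs, abs_mul]
      exact mul_le_mul h1 h2 (abs_nonneg _) ((abs_nonneg _).trans h1)
    calc ∫ ω, D (k + 1) ω ∂μ ≤ ∫ ω, (D k ω + Z k ω * y k ω) ∂μ :=
          integral_mono_ae (hint _ hk) ((hint k (by omega)).add hZy) (hstep k hk)
      _ = ∫ ω, D k ω ∂μ + 0 := by
        rw [integral_add (hint k (by omega)) hZy, hy k hk (Z k) (hZm k hk) ⟨C, hC⟩]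
      _ ≤ 1 := by rw [add_zero]; exact ih (by omega)

/-- The Azuma-Hoeffding inequality. -/
lemma measure_sum_noise_le {y : ℕ → Ω → ℝ} {𝓕 : ℕ → MeasurableSpace Ω} {K : ℕ} {R δ : ℝ}
    (hK : 0 < K) (hR : 0 < R) (hδ : 0 < δ) (hδ1 : δ < 1) (h𝓕 : ∀ k, 𝓕 k ≤ mΩ)
    (hym : ∀ k < K, Measurable (y k)) (hyR : ∀ k < K, ∀ ω, |y k ω| ≤ R)
    (hy𝓕 : ∀ k < K, ∀ j < k, Measurable[𝓕 k] (y j)) (hy : ∀ k < K, IsNoise μ (𝓕 k) (y k)) :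
    μ {ω | R * √(2 * K * Real.log (1 / δ)) < ∑ k ∈ Finset.range K, y k ω} ≤ ENNReal.ofReal δ := by
  set ℓ := Real.log (1 / δ) with hℓ
  have hℓ0 : 0 < ℓ := Real.log_pos (by rw [lt_div_iff₀ hδ]; linarith)
  have hK' : (0 : ℝ) < K := by exact_mod_cast hK
  -- The optimal Chernoff parameter: at the stated threshold the linear part is 2ℓ and the
  -- correction is ℓ, which leaves ℓ = log (1/δ).
  set b := √(2 * ℓ / K) / R with hb
  have hb0 : 0 < b := by positivity
  have hbR : (b * R) ^ 2 = 2 * ℓ / K := by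
    rw [hb, div_mul_cancel₀ _ hR.ne', Real.sq_sqrt (by positivity)]
  set D : ℕ → Ω → ℝ := fun k ω =>
    Real.exp (b * ∑ j ∈ Finset.range k, y j ω - k * ((b * R) ^ 2 / 2)) with hD
  have hDm : ∀ (m : MeasurableSpace Ω) (k : ℕ), (∀ j < k, Measurable[m] (y j)) →
      Measurable[m] (D k) := fun m k hj => by
    have : Measurable[m] fun ω => ∑ j ∈ Finset.range k, y j ω :=
      Finset.measurable_sum _ fun j hj' => hj j (by simpa using hj')
    exact Real.measurable_exp.comp ((this.const_mul b).sub_const _)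
  have hDb : ∀ k ≤ K, ∀ ω, |D k ω| ≤ Real.exp (b * (k * R)) := fun k hk ω => by
    rw [hD]; simp only [Real.abs_exp]
    rw [Real.exp_le_exp]
    have h1 : ∑ j ∈ Finset.range k, y j ω ≤ k * R := by
      refine (Finset.sum_le_sum fun j hj => (le_abs_self _).trans
        (hyR j ((Finset.mem_range.1 hj).trans_le hk) ω)).trans ?_
      simp
    have h2 : 0 ≤ (k : ℝ) * ((b * R) ^ 2 / 2) := by positivity
    nlinarith
  have main := integral_le_one_of_noise (μ := μ) (D := D) (Z := fun k ω => D k ω * hoeffdingCoeff b R)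
    (y := y) (𝓕 := 𝓕) (K := K) (R := R) h𝓕 (fun ω => by simp [hD])
    (fun k hk => hDm _ k fun j hj => hym j (by omega)) hym
    (fun k hk => Filter.Eventually.of_forall (hyR k hk))
    (fun k hk => ⟨_, Filter.Eventually.of_forall (hDb k hk)⟩)
    (fun k hk => (hDm _ k fun j hj => hy𝓕 k hk j hj).mul_const _)
    (fun k hk => ⟨Real.exp (b * (k * R)) * |hoeffdingCoeff b R|, Filter.Eventually.of_forall fun ω => by
      rw [abs_mul]; exact mul_le_mul_of_nonneg_right (hDb k hk.le ω) (abs_nonneg _)⟩) hy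
    (fun k hk => Filter.Eventually.of_forall fun ω => by
      have h1 := exp_sub_le_one_add (b := b) hR (hyR k hk ω)
      have h2 : D (k + 1) ω = D k ω * Real.exp (b * y k ω - (b * R) ^ 2 / 2) := by
        simp only [hD]; rw [← Real.exp_add, Finset.sum_range_succ]; push_cast; ring_nf
      rw [h2]
      have := mul_le_mul_of_nonneg_left h1 (Real.exp_pos _ : 0 < D k ω).le
      linarith) (k := K) le_rfl
  refine (measure_mono fun ω hω => ?_).trans
    (measure_le_of_integral_le_one (fun ω => (Real.exp_pos _).le) main.1 main.2 hδ)
  change 1 / δ ≤ D K ω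
  change R * √(2 * K * ℓ) < ∑ k ∈ Finset.range K, y k ω at hω
  rw [← Real.exp_log (show 0 < 1 / δ by positivity), ← hℓ]
  simp only [hD]
  rw [Real.exp_le_exp, hbR]
  have h3 : b * (R * √(2 * K * ℓ)) = 2 * ℓ := by
    have : √(2 * ℓ / K) * √(2 * K * ℓ) = 2 * ℓ := by
      rw [← Real.sqrt_mul (by positivity)]
      rw [show 2 * ℓ / K * (2 * K * ℓ) = (2 * ℓ) ^ 2 by field_simp]
      exact Real.sqrt_sq (by positivity)
    have e : ∀ p q : ℝ, p / R * (R * q) = p * q := fun p q => by field_simp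
    rw [hb, e, this]
  have h4 := mul_le_mul_of_nonneg_left hω.le hb0.le
  have h5 : (K : ℝ) * (2 * ℓ / K / 2) = ℓ := by field_simp
  rw [h5]; linarith

variable {n : Type*} [Fintype n] [DecidableEq n]

/-- The self-normalized concentration inequality. -/
lemma measure_selfNorm_le {lam R δ : ℝ} (hlam : 0 < lam) (hR : 0 < R) (hδ : 0 < δ)
    {φ : ℕ → Ω → n → ℝ} {ε : ℕ → Ω → ℝ} {𝓕 : ℕ → MeasurableSpace Ω} {K : ℕ}
    (h𝓕 : ∀ k, 𝓕 k ≤ mΩ) (hεm : ∀ k < K, Measurable (ε k))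
    (hεR : ∀ k < K, ∀ᵐ ω ∂μ, |ε k ω| ≤ R)
    (hφ𝓕 : ∀ k < K, ∀ j ≤ k, ∀ i, Measurable[𝓕 k] fun ω => φ j ω i)
    (hε𝓕 : ∀ k < K, ∀ j < k, Measurable[𝓕 k] (ε j)) (hε : ∀ k < K, IsNoise μ (𝓕 k) (ε k))
    {k : ℕ} (hk : k ≤ K) :
    μ {ω | R ^ 2 * (Real.log ((gram lam (φ · ω) k).det / (gram lam (φ · ω) 0).det) +
        2 * Real.log (1 / δ)) <
      invForm (gram lam (φ · ω) k) (∑ τ ∈ Finset.range k, ε τ ω • φ τ ω)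
        (∑ τ ∈ Finset.range k, ε τ ω • φ τ ω)} ≤ ENNReal.ofReal δ := by
  have hφm : ∀ j < K, ∀ i, Measurable fun ω => φ j ω i := fun j hj i =>
    (hφ𝓕 j hj j le_rfl i).mono (h𝓕 j) le_rfl
  have hall : ∀ᵐ ω ∂μ, ∀ j < K, |ε j ω| ≤ R := by
    rw [ae_all_iff]; intro j
    by_cases hj : j < K
    · filter_upwards [hεR j hj] with ω h _ using h
    · exact Filter.Eventually.of_forall fun ω h => absurd h hj
  have hDb : ∀ k ≤ K, ∀ᵐ ω ∂μ, |selfNorm lam R (φ · ω) (ε · ω) k| ≤ 2 ^ k := fun k hk => by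
    filter_upwards [hall] with ω hω
    rw [abs_of_nonneg (selfNorm_nonneg k)]
    exact selfNorm_le_two_pow hlam hR k fun j hj => hω j (by omega)
  have main := integral_le_one_of_noise (μ := μ)
    (D := fun k ω => selfNorm lam R (φ · ω) (ε · ω) k)
    (Z := fun k ω => selfNormSlope lam R (φ · ω) (ε · ω) k) (y := ε) (𝓕 := 𝓕) (K := K) (R := R)
    h𝓕 (fun ω => selfNorm_zero hlam)
    (fun k hk => measurable_selfNorm (fun j hj => hφm j (by omega)) fun j hj => hεm j (by omega))
    hεm hεR (fun k hk => ⟨_, hDb k hk⟩)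
    (fun k hk => @measurable_selfNormSlope n _ _ Ω (𝓕 k) lam R φ ε k
      (fun j hj => hφ𝓕 k hk j (by omega)) fun j hj => hε𝓕 k hk j hj)
    (fun k hk => ⟨2 ^ k / R, by
      filter_upwards [hDb k hk.le] with ω hω
      refine (abs_selfNormSlope_le hlam hR k).trans ?_
      gcongr
      exact (le_abs_self _).trans hω⟩) hε
    (fun k hk => by
      filter_upwards [hall] with ω hω
      exact selfNorm_succ_le hlam hR (hω k hk)) hk
  refine (measure_mono fun ω hω => ?_).trans
    (measure_le_of_integral_le_one (fun ω => selfNorm_nonneg k) main.1 main.2 hδ)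
  by_contra hcon
  exact absurd (invForm_le_of_selfNorm_lt hlam hR (not_le.1 hcon)) (not_le.2 hω)

/-- Expectations over a finitely valued random variable with known conditional law. -/
lemma integral_eq_of_condLaw {ι : Type*} [Fintype ι] [MeasurableSpace ι]
    [MeasurableSingletonClass ι] {m : MeasurableSpace Ω} (hm : m ≤ mΩ) {T : Ω → ι}
    (hT : Measurable[mΩ] T) {q : Ω → ι → ℝ} (hq : ∀ i, μ⟦T ⁻¹' {i} | m⟧ =ᵐ[μ] fun ω => q ω i)
    {G : Ω → ι → ℝ} (hG : ∀ i, Measurable[m] fun ω => G ω i)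
    (hGb : ∀ i, ∃ C, ∀ᵐ ω ∂μ, |G ω i| ≤ C) :
    Integrable (fun ω => G ω (T ω)) μ ∧ Integrable (fun ω => ∑ i, q ω i * G ω i) μ ∧
      ∫ ω, G ω (T ω) ∂μ = ∫ ω, ∑ i, q ω i * G ω i ∂μ := by
  classical
  have hone : ∀ i, Integrable ((T ⁻¹' {i}).indicator fun _ => (1 : ℝ)) μ := fun i =>
    (integrable_const 1).indicator (hT (measurableSet_singleton i))
  have hsum : ∀ ω, G ω (T ω) = ∑ i, G ω i * (T ⁻¹' {i}).indicator (fun _ => (1 : ℝ)) ω := by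
    intro ω
    rw [Finset.sum_eq_single (T ω)]
    · simp
    · intro b _ hb
      have : ω ∉ T ⁻¹' {b} := fun h => hb (by simpa using h.symm)
      simp [Set.indicator_of_notMem this]
    · simp
  have hGi : ∀ i, Integrable (fun ω => G ω i * (T ⁻¹' {i}).indicator (fun _ => (1 : ℝ)) ω) μ := by
    intro i
    obtain ⟨C, hC⟩ := hGb i
    exact (hone i).bdd_mul ((hG i).mono hm le_rfl).aestronglyMeasurable hC
  have hqi : ∀ i, Integrable (fun ω => q ω i * G ω i) μ := by
    intro i
    obtain ⟨C, hC⟩ := hGb i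
    have : Integrable (fun ω => q ω i) μ := integrable_condExp.congr (hq i)
    simpa [mul_comm] using this.bdd_mul ((hG i).mono hm le_rfl).aestronglyMeasurable hC
  refine ⟨?_, integrable_finsetSum _ fun i _ => hqi i, ?_⟩
  · simp_rw [hsum]; exact integrable_finsetSum _ fun i _ => hGi i
  simp_rw [hsum]
  rw [integral_finsetSum _ fun i _ => hGi i, integral_finsetSum _ fun i _ => hqi i]
  refine Finset.sum_congr rfl fun i _ => ?_
  rw [← integral_condExp hm]
  refine integral_congr_ae ?_
  -- The weight of the i-th outcome is known beforehand, so it comes out of the conditional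
  -- expectation of the indicator.
  have h := condExp_mul_of_stronglyMeasurable_left (m := m) (μ := μ) (f := fun ω => G ω i)
    (g := (T ⁻¹' {i}).indicator fun _ => (1 : ℝ)) (hG i).stronglyMeasurable (hGi i) (hone i)
  refine h.trans ?_
  filter_upwards [hq i] with ω hω
  simp only [Pi.mul_apply]
  rw [hω, mul_comm]

end Concentration

/-! ### Backward induction for kernels -/

section Eval

variable {X A : Type*} [Fintype X] [Fintype A] [DecidableEq X] [DecidableEq A] {H : ℕ}

/-- The backup operator of a transition kernel. -/
def kernelBackup (P : Fin H → X → A → X → ℝ) (h : Fin H) (V : X → ℝ) (q : X × A) : ℝ :=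
  ∑ x', P h q.1 q.2 x' * V x'

/-- Rows are nonnegative with sum at most one. -/
def IsSubKernel (P : Fin H → X → A → X → ℝ) : Prop :=
  ∀ h x a, (∀ x', 0 ≤ P h x a x') ∧ ∑ x', P h x a x' ≤ 1

lemma MDP.isSubKernel (M : MDP X A H) : IsSubKernel M.P :=
  fun h x a => ⟨(M.P_mem h x a).1, (M.P_mem h x a).2.le⟩

lemma feat_dotProduct (x : X) (a : A) (w : X × A → ℝ) : feat x a ⬝ᵥ w = w (x, a) := by
  simp [feat]

variable (θ θ' : (X × A) × Fin H → ℝ) (ψ : Fin H → (X → ℝ) → X × A → ℝ)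
  (π : Fin H → X → A → ℝ)

lemma evalV_last (x : X) : evalV θ ψ π (Fin.last H) x = 0 := by
  simp [evalV]

lemma evalQ_eq (h : Fin H) (x : X) (a : A) :
    evalQ θ ψ π h x a = θ ((x, a), h) + ψ h (evalV θ ψ π h.succ) (x, a) := by
  simp [evalQ, backup, feat_dotProduct]

lemma evalV_castSucc (h : Fin H) (x : X) :
    evalV θ ψ π h.castSucc x = ∑ a, π h x a * evalQ θ ψ π h x a := by
  rw [evalV, Fin.reverseInduction_castSucc]; rfl

variable {θ θ' ψ π} {P : Fin H → X → A → X → ℝ}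

/-- The Bellman recursion with zero terminal value determines the function. Linearity, the value
difference identities and the shift of the horizon are all obtained by checking this recursion. -/
lemma evalV_unique {W : Fin (H + 1) → X → ℝ} (h0 : ∀ x, W (Fin.last H) x = 0)
    (h1 : ∀ (h : Fin H) x, W h.castSucc x =
      ∑ a, π h x a * (θ ((x, a), h) + kernelBackup P h (W h.succ) (x, a))) :
    W = evalV θ (kernelBackup P) π := by
  funext h
  induction h using Fin.reverseInduction with
  | last => funext x; rw [h0, evalV_last]
  | cast h ih => funext x; rw [h1, evalV_castSucc, ih]; simp only [evalQ_eq]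

lemma evalV_kernel_castSucc (h : Fin H) (x : X) :
    evalV θ (kernelBackup P) π h.castSucc x = ∑ a, π h x a * (θ ((x, a), h) +
      kernelBackup P h (evalV θ (kernelBackup P) π h.succ) (x, a)) := by
  rw [evalV_castSucc]; simp only [evalQ_eq]

lemma kernelBackup_add (h : Fin H) (V W : X → ℝ) (q : X × A) :
    kernelBackup P h (V + W) q = kernelBackup P h V q + kernelBackup P h W q := by
  simp [kernelBackup, mul_add, Finset.sum_add_distrib]

lemma kernelBackup_smul (h : Fin H) (c : ℝ) (V : X → ℝ) (q : X × A) :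
    kernelBackup P h (c • V) q = c * kernelBackup P h V q := by
  simp only [kernelBackup, Finset.mul_sum, Pi.smul_apply, smul_eq_mul]
  exact Finset.sum_congr rfl fun _ _ => by ring

/-- The value at a given state and step as a linear function of the rewards. -/
def evalVLin (P : Fin H → X → A → X → ℝ) (π : Fin H → X → A → ℝ) (h : Fin (H + 1)) (x : X) :
    ((X × A) × Fin H → ℝ) →ₗ[ℝ] ℝ where
  toFun θ := evalV θ (kernelBackup P) π h x
  map_add' θ θ' := by
    have := evalV_unique (θ := θ + θ') (π := π) (P := P)
      (W := fun h => evalV θ (kernelBackup P) π h + evalV θ' (kernelBackup P) π h)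
      (fun x => by simp [evalV_last]) (fun h x => by
        simp only [Pi.add_apply, evalV_kernel_castSucc, kernelBackup_add, ← Finset.sum_add_distrib]
        exact Finset.sum_congr rfl fun _ _ => by ring)
    rw [← this]; rfl
  map_smul' c θ := by
    have := evalV_unique (θ := c • θ) (π := π) (P := P)
      (W := fun h => c • evalV θ (kernelBackup P) π h)
      (fun x => by simp [evalV_last]) (fun h x => by
        simp only [Pi.smul_apply, evalV_kernel_castSucc, kernelBackup_smul, smul_eq_mul,
          Finset.mul_sum]
        exact Finset.sum_congr rfl fun _ _ => by ring)
    rw [← this]; rfl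

/-- The (sub-)occupancy measure, which represents `evalVLin`. -/
def occ (P : Fin H → X → A → X → ℝ) (π : Fin H → X → A → ℝ) (h : Fin (H + 1)) (x : X) :
    (X × A) × Fin H → ℝ :=
  fun j => evalVLin P π h x (Pi.single j 1)

lemma evalV_eq_occ_dotProduct (h : Fin (H + 1)) (x : X) :
    evalV θ (kernelBackup P) π h x = occ P π h x ⬝ᵥ θ := by
  change evalVLin P π h x θ = _
  rw [LinearMap.pi_apply_eq_sum_univ]
  simp [dotProduct, occ, mul_comm, ← Pi.single_apply, Pi.single_comm]

lemma kernelBackup_mono (hP : IsSubKernel P) (h : Fin H) {V W : X → ℝ} (hVW : ∀ x, V x ≤ W x)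
    (q : X × A) : kernelBackup P h V q ≤ kernelBackup P h W q :=
  Finset.sum_le_sum fun x' _ => mul_le_mul_of_nonneg_left (hVW x') ((hP h q.1 q.2).1 x')

lemma kernelBackup_le (hP : IsSubKernel P) (h : Fin H) {V : X → ℝ} {c : ℝ} (hc : 0 ≤ c)
    (hV : ∀ x, V x ≤ c) (q : X × A) : kernelBackup P h V q ≤ c := by
  calc kernelBackup P h V q ≤ ∑ x', P h q.1 q.2 x' * c :=
        Finset.sum_le_sum fun x' _ => mul_le_mul_of_nonneg_left (hV x') ((hP h q.1 q.2).1 x')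
    _ ≤ c := by rw [← Finset.sum_mul]; exact mul_le_of_le_one_left hc (hP h q.1 q.2).2

lemma policy_sum_le (hπ : IsPolicy π) (h : Fin H) (x : X) {f : A → ℝ} {c : ℝ}
    (hf : ∀ a, f a ≤ c) : ∑ a, π h x a * f a ≤ c := by
  calc ∑ a, π h x a * f a ≤ ∑ a, π h x a * c :=
        Finset.sum_le_sum fun a _ => mul_le_mul_of_nonneg_left (hf a) ((hπ h x).1 a)
    _ = c := by rw [← Finset.sum_mul, (hπ h x).2, one_mul]

lemma evalV_mono (hP : IsSubKernel P) (hπ : IsPolicy π) (hθ : ∀ j, θ j ≤ θ' j)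
    (h : Fin (H + 1)) (x : X) :
    evalV θ (kernelBackup P) π h x ≤ evalV θ' (kernelBackup P) π h x := by
  induction h using Fin.reverseInduction generalizing x with
  | last => simp [evalV_last]
  | cast h ih =>
    rw [evalV_kernel_castSucc, evalV_kernel_castSucc]
    refine Finset.sum_le_sum fun a _ => mul_le_mul_of_nonneg_left ?_ ((hπ h x).1 a)
    exact add_le_add (hθ _) (kernelBackup_mono hP h ih _)

lemma occ_nonneg (hP : IsSubKernel P) (hπ : IsPolicy π) (h : Fin (H + 1)) (x : X)
    (j : (X × A) × Fin H) : 0 ≤ occ P π h x j := by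
  have h1 : evalVLin P π h x 0 ≤ evalVLin P π h x (Pi.single j 1) :=
    evalV_mono hP hπ (fun i => by
      by_cases hij : i = j
      · subst hij; simp
      · simp [hij]) h x
  rwa [map_zero] at h1

/-- Reward one at step `h'` alone is collected at most once, and not at all after that step. This
value is the mass of the occupancy measure at `h'`. -/
lemma evalV_step_indicator_le (hP : IsSubKernel P) (hπ : IsPolicy π) (h' : Fin H)
    (h : Fin (H + 1)) (x : X) :
    evalV (fun j => if j.2 = h' then 1 else 0) (kernelBackup P) π h x ≤
      if h ≤ h'.castSucc then 1 else 0 := by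
  induction h using Fin.reverseInduction generalizing x with
  | last =>
    rw [evalV_last]; split_ifs <;> norm_num
  | cast h ih =>
    rw [evalV_kernel_castSucc]
    refine policy_sum_le hπ h x fun a => ?_
    by_cases hh : h = h'
    · subst hh
      have : ¬ h.succ ≤ h.castSucc := by simp [Fin.le_def]
      simp only [this, if_false] at ih
      have := kernelBackup_le hP h le_rfl ih (x, a)
      simp; linarith
    · have e : (h.castSucc ≤ h'.castSucc) ↔ (h.succ ≤ h'.castSucc) := by
        simp only [Fin.le_def, Fin.val_castSucc, Fin.val_succ]
        have : (h : ℕ) ≠ h' := fun e => hh (Fin.ext e)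
        omega
      simp only [hh, if_false, e, zero_add]
      exact kernelBackup_le hP h (by split_ifs <;> norm_num) ih (x, a)

lemma sum_occ_le_one (hP : IsSubKernel P) (hπ : IsPolicy π) (h : Fin (H + 1)) (x : X)
    (h' : Fin H) : ∑ q : X × A, occ P π h x (q, h') ≤ 1 := by
  have h1 := evalV_step_indicator_le hP hπ h' h x
  rw [evalV_eq_occ_dotProduct] at h1
  have e : occ P π h x ⬝ᵥ (fun j => if j.2 = h' then 1 else 0) =
      ∑ q : X × A, occ P π h x (q, h') := by
    simp only [dotProduct, Fintype.sum_prod_type, mul_ite, mul_one, mul_zero, Finset.sum_ite_eq',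
      Finset.mem_univ, if_true]
  rw [← e]
  exact h1.trans (by split_ifs <;> norm_num)

/-- Entries in [0, 1] have squares below themselves. Summed over the steps this gives squared norm
at most H, which matches λ_r = H. -/
lemma sum_occ_sq_le_one (hP : IsSubKernel P) (hπ : IsPolicy π) (h : Fin (H + 1)) (x : X)
    (h' : Fin H) : ∑ q : X × A, occ P π h x (q, h') ^ 2 ≤ 1 := by
  have h1 := sum_occ_le_one hP hπ h x h'
  refine le_trans (Finset.sum_le_sum fun q _ => ?_) h1
  have h0 := occ_nonneg hP hπ h x (q, h')
  have : occ P π h x (q, h') ≤ 1 := le_trans (Finset.single_le_sum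
    (f := fun q => occ P π h x (q, h')) (fun q _ => occ_nonneg hP hπ h x (q, h'))
    (Finset.mem_univ q)) h1
  nlinarith

lemma evalV_le_of_le (hP : IsSubKernel P) (hπ : IsPolicy π) {c : ℝ} (hc : 0 ≤ c)
    (hθ : ∀ j, θ j ≤ c) (h : Fin (H + 1)) (x : X) :
    evalV θ (kernelBackup P) π h x ≤ H * c := by
  rw [evalV_eq_occ_dotProduct]
  calc occ P π h x ⬝ᵥ θ ≤ ∑ j, occ P π h x j * c :=
        Finset.sum_le_sum fun j _ => mul_le_mul_of_nonneg_left (hθ j) (occ_nonneg hP hπ h x j)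
    _ = ∑ h', (∑ q : X × A, occ P π h x (q, h')) * c := by
        rw [Fintype.sum_prod_type_right]; simp only [Finset.sum_mul]
    _ ≤ ∑ _h' : Fin H, c := Finset.sum_le_sum fun h' _ =>
        mul_le_of_le_one_left hc (sum_occ_le_one hP hπ h x h')
    _ = H * c := by simp

lemma le_evalV_of_le (hP : IsSubKernel P) (hπ : IsPolicy π) {c : ℝ} (hc : 0 ≤ c)
    (hθ : ∀ j, -c ≤ θ j) (h : Fin (H + 1)) (x : X) :
    -(H * c) ≤ evalV θ (kernelBackup P) π h x := by
  have h1 := evalV_le_of_le (θ := -θ) hP hπ hc (fun j => by have := hθ j; simp; linarith) h x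
  have h2 : evalV (-θ) (kernelBackup P) π h x = - evalV θ (kernelBackup P) π h x :=
    map_neg (evalVLin P π h x) θ
  linarith

lemma evalV_congr_policy {π' : Fin H → X → A → ℝ} (h : Fin (H + 1))
    (hπ : ∀ h' : Fin H, h ≤ h'.castSucc → π h' = π' h') :
    evalV θ (kernelBackup P) π h = evalV θ (kernelBackup P) π' h := by
  induction h using Fin.reverseInduction with
  | last => funext x; simp [evalV_last]
  | cast h ih =>
    funext x
    rw [evalV_kernel_castSucc, evalV_kernel_castSucc, hπ h le_rfl, ih]
    intro h' hh'
    exact hπ h' (le_trans (Fin.castSucc_lt_succ).le hh')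

/-- `Q`-values are values of a modified policy. -/
lemma exists_evalQ_eq_evalV (hπ : IsPolicy π) (h : Fin H) (x : X) (a : A) :
    ∃ π' : Fin H → X → A → ℝ, IsPolicy π' ∧ ∀ θ : (X × A) × Fin H → ℝ,
      evalQ θ (kernelBackup P) π h x a = evalV θ (kernelBackup P) π' h.castSucc x := by
  classical
  -- The witness plays `a` in every state at step `h`; the value after `h` sees only the later,
  -- unchanged steps.
  refine ⟨Function.update π h fun _ => Pi.single a 1, ?_, fun θ => ?_⟩
  · intro h' x'
    by_cases hh : h' = h
    · subst hh; simpa using single_mem_stdSimplex ℝ a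
    · simpa [Function.update_of_ne hh] using hπ h' x'
  · rw [evalV_castSucc]
    simp only [Function.update_self, Pi.single_apply, ite_mul, one_mul, zero_mul,
      Finset.sum_ite_eq', Finset.mem_univ, if_true]
    rw [evalQ_eq, evalQ_eq, evalV_congr_policy]
    intro h' hh'
    have : h' ≠ h := by
      rintro rfl
      simp [Fin.le_def] at hh'
    simp [Function.update_of_ne this]

variable {P' : Fin H → X → A → X → ℝ} {π' : Fin H → X → A → ℝ}

/-- The value difference lemma along the first kernel and the second policy. -/
lemma evalV_sub_evalV_of_policy (hπ' : IsPolicy π') (h : Fin (H + 1)) (x : X) :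
    evalV θ (kernelBackup P) π h x - evalV θ' (kernelBackup P') π' h x =
      evalV (fun j => (θ j - θ' j) +
        (kernelBackup P j.2 (evalV θ' (kernelBackup P') π' j.2.succ) j.1 -
          kernelBackup P' j.2 (evalV θ' (kernelBackup P') π' j.2.succ) j.1) +
        (∑ b, π j.2 j.1.1 b * evalQ θ (kernelBackup P) π j.2 j.1.1 b -
          evalQ θ (kernelBackup P) π j.2 j.1.1 j.1.2)) (kernelBackup P) π' h x := by
  refine congrFun (congrFun (evalV_unique (W := fun h x =>
    evalV θ (kernelBackup P) π h x - evalV θ' (kernelBackup P') π' h x)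
    (fun x => by simp [evalV_last]) fun h x => ?_) h) x
  have hW : ∀ q, kernelBackup P h (fun x => evalV θ (kernelBackup P) π h.succ x -
      evalV θ' (kernelBackup P') π' h.succ x) q =
      kernelBackup P h (evalV θ (kernelBackup P) π h.succ) q -
        kernelBackup P h (evalV θ' (kernelBackup P') π' h.succ) q := fun q => by
    simp [kernelBackup, mul_sub]
  rw [evalV_castSucc θ, evalV_castSucc θ']
  set c := ∑ b, π h x b * evalQ θ (kernelBackup P) π h x b with hc
  -- The mean of Q under the first policy does not depend on the action, so it may be averaged under
  -- the second policy; the mismatch becomes the advantage term.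
  have hcs : c = ∑ a, π' h x a * c := by rw [← Finset.sum_mul, (hπ' h x).2, one_mul]
  rw [hcs, ← Finset.sum_sub_distrib]
  refine Finset.sum_congr rfl fun a _ => ?_
  rw [hW]
  simp only [← hc]
  simp only [evalQ_eq]
  ring

/-- The value difference lemma along the second kernel, for one policy. -/
lemma evalV_sub_evalV_of_kernel (h : Fin (H + 1)) (x : X) :
    evalV θ (kernelBackup P) π h x - evalV θ' (kernelBackup P') π h x =
      evalV (fun j => (θ j - θ' j) +
        (kernelBackup P j.2 (evalV θ (kernelBackup P) π j.2.succ) j.1 -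
          kernelBackup P' j.2 (evalV θ (kernelBackup P) π j.2.succ) j.1))
        (kernelBackup P') π h x := by
  refine congrFun (congrFun (evalV_unique (W := fun h x =>
    evalV θ (kernelBackup P) π h x - evalV θ' (kernelBackup P') π h x)
    (fun x => by simp [evalV_last]) fun h x => ?_) h) x
  have hW : ∀ q, kernelBackup P' h (fun x => evalV θ (kernelBackup P) π h.succ x -
      evalV θ' (kernelBackup P') π h.succ x) q =
      kernelBackup P' h (evalV θ (kernelBackup P) π h.succ) q -
        kernelBackup P' h (evalV θ' (kernelBackup P') π h.succ) q := fun q => by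
    simp [kernelBackup, mul_sub]
  rw [evalV_castSucc θ, evalV_castSucc θ', ← Finset.sum_sub_distrib]
  refine Finset.sum_congr rfl fun a _ => ?_
  rw [hW]
  simp only [evalQ_eq]
  ring

end Eval

/-! ### The law of a trajectory -/

section Path

variable {X A : Type*} [Fintype X] [Fintype A] [DecidableEq X] [DecidableEq A] {H : ℕ}

/-- The MDP after the first step, started at `x`. -/
def MDP.tail (M : MDP X A (H + 1)) (x : X) : MDP X A H where
  init := x
  r h := M.r h.succ
  P h := M.P h.succ
  r_mem h := M.r_mem h.succ
  P_mem h := M.P_mem h.succ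

/-- Add a first step to a trajectory. -/
def Trajectory.cons (x : X) (a : A) (τ : Trajectory X A H) : Trajectory X A (H + 1) :=
  ⟨Fin.cons x τ.states, Fin.cons a τ.actions⟩

/-- Split off the first step of a trajectory. -/
def Trajectory.consEquiv : X × A × Trajectory X A H ≃ Trajectory X A (H + 1) where
  toFun q := .cons q.1 q.2.1 q.2.2
  invFun τ := (τ.states 0, τ.actions 0, ⟨Fin.tail τ.states, Fin.tail τ.actions⟩)
  left_inv q := by simp [Trajectory.cons]
  right_inv τ := by simp [Trajectory.cons]

lemma trajProb_cons (M : MDP X A (H + 1)) (π : Fin (H + 1) → X → A → ℝ) (x : X) (a : A)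
    (τ : Trajectory X A H) :
    trajProb M π (.cons x a τ) = (if x = M.init then 1 else 0) *
      ∑ x', π 0 x a * M.P 0 x a x' * trajProb (M.tail x') (fun h => π h.succ) τ := by
  simp only [trajProb, MDP.tail]
  rw [Finset.sum_eq_single (τ.states 0)]
  · rw [Fin.prod_univ_succ]
    simp only [Trajectory.cons, Trajectory.state, Trajectory.next, Trajectory.action,
      Fin.castSucc_zero, Fin.cons_zero, Fin.cons_succ, ← Fin.succ_castSucc, if_true]
    ring
  · intro b _ hb; simp [hb.symm]
  · simp

lemma sum_trajProb_mul_succ (M : MDP X A (H + 1)) (π : Fin (H + 1) → X → A → ℝ)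
    (Φ : Trajectory X A (H + 1) → ℝ) :
    ∑ τ, trajProb M π τ * Φ τ = ∑ a, π 0 M.init a * ∑ x', M.P 0 M.init a x' *
      ∑ τ, trajProb (M.tail x') (fun h => π h.succ) τ * Φ (.cons M.init a τ) := by
  rw [← (Trajectory.consEquiv (X := X) (A := A) (H := H)).sum_comp]
  rw [Fintype.sum_prod_type, Finset.sum_eq_single M.init]
  · rw [Fintype.sum_prod_type]
    refine Finset.sum_congr rfl fun a _ => ?_
    simp only [Trajectory.consEquiv, Equiv.coe_fn_mk, trajProb_cons, if_true, one_mul,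
      Finset.mul_sum, Finset.sum_mul]
    rw [Finset.sum_comm]
    exact Finset.sum_congr rfl fun _ _ => Finset.sum_congr rfl fun _ _ => by ring
  · intro b _ hb
    simp [Trajectory.consEquiv, trajProb_cons, hb]
  · simp

variable {M : MDP X A H} {π : Fin H → X → A → ℝ}

lemma trajProb_nonneg (hπ : IsPolicy π) (τ : Trajectory X A H) : 0 ≤ trajProb M π τ := by
  unfold trajProb
  refine mul_nonneg (by split_ifs <;> norm_num) (Finset.prod_nonneg fun h _ => mul_nonneg
    ((hπ h _).1 _) ((M.P_mem h _ _).1 _))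

lemma sum_trajProb (hπ : IsPolicy π) : ∑ τ, trajProb M π τ = 1 := by
  induction H with
  | zero =>
    rw [← (Trajectory.equivProd X A 0).sum_comp, Fintype.sum_prod_type,
      ← (Equiv.funUnique (Fin 1) X).symm.sum_comp]
    simp [trajProb, Trajectory.equivProd]
  | succ H ih =>
    have := sum_trajProb_mul_succ M π fun _ => 1
    simp only [mul_one] at this
    rw [this]
    have h1 : ∀ x', ∑ τ, trajProb (M.tail x') (fun h => π h.succ) τ = 1 := fun x' =>
      ih fun h => hπ h.succ
    simp only [h1, mul_one, (M.P_mem _ _ _).2, (hπ _ _).2]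

/-- Given the state and action at step `h`, the next state has law `M.P h`, so a function centred
under that law has mean zero. Splitting off first steps moves `h` to the front. -/
lemma sum_trajProb_mul_eq_zero (hπ : IsPolicy π) (h : Fin H) {f : X → A → X → ℝ}
    (hf : ∀ x a, ∑ x', M.P h x a x' * f x a x' = 0) :
    ∑ τ, trajProb M π τ * f (τ.state h) (τ.action h) (τ.next h) = 0 := by
  induction H with
  | zero => exact h.elim0
  | succ H ih =>
    rw [sum_trajProb_mul_succ]
    refine Finset.sum_eq_zero fun a _ => ?_
    cases h using Fin.cases with
    | zero =>
      have h1 : ∀ x', ∑ τ, trajProb (M.tail x') (fun h => π h.succ) τ *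
          f ((Trajectory.cons M.init a τ).state 0) ((Trajectory.cons M.init a τ).action 0)
            ((Trajectory.cons M.init a τ).next 0) = f M.init a x' := by
        intro x'
        rw [← one_mul (f M.init a x'), ← sum_trajProb (M := M.tail x') (π := fun h => π h.succ)
          (fun h => hπ h.succ), Finset.sum_mul]
        refine Finset.sum_congr rfl fun τ _ => ?_
        -- The MDP after the first step starts at `x'`; trajectories starting elsewhere have
        -- probability zero.
        by_cases hτ : τ.states 0 = x'
        · have : (Trajectory.cons M.init a τ).next 0 = x' := by
            rw [← hτ]; simp [Trajectory.cons, Trajectory.next]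
          rw [this]; simp [Trajectory.cons, Trajectory.state, Trajectory.action]
        · simp [trajProb, MDP.tail, hτ]
      simp only [h1, hf, mul_zero]
    | succ h =>
      have h1 : ∀ x', ∑ τ, trajProb (M.tail x') (fun h => π h.succ) τ *
          f ((Trajectory.cons M.init a τ).state h.succ)
            ((Trajectory.cons M.init a τ).action h.succ)
            ((Trajectory.cons M.init a τ).next h.succ) = 0 := by
        intro x'
        exact ih (M := M.tail x') (fun h => hπ h.succ) h hf
      simp only [h1, mul_zero, Finset.sum_const_zero]

lemma evalV_succ_eq (θ : (X × A) × Fin (H + 1) → ℝ) (P : Fin (H + 1) → X → A → X → ℝ)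
    (π : Fin (H + 1) → X → A → ℝ) (h : Fin (H + 1)) :
    evalV θ (kernelBackup P) π h.succ = evalV (fun j : (X × A) × Fin H => θ (j.1, j.2.succ))
      (kernelBackup fun h => P h.succ) (fun h => π h.succ) h := by
  refine congrFun (evalV_unique (W := fun h => evalV θ (kernelBackup P) π h.succ) (fun x => ?_)
    fun h x => ?_) h
  · exact evalV_last θ _ π x
  · exact evalV_kernel_castSucc (h := h.succ) x

/-- The expected cumulative reward along a trajectory is computed by backward induction. -/
lemma sum_trajProb_mul_sum (hπ : IsPolicy π) (g : (X × A) × Fin H → ℝ) :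
    ∑ τ, trajProb M π τ * ∑ h, g ((τ.state h, τ.action h), h) =
      evalV g (kernelBackup M.P) π 0 M.init := by
  induction H with
  | zero =>
    simp only [Finset.univ_eq_empty, Finset.sum_empty, mul_zero, Finset.sum_const_zero]
    exact (evalV_last g _ π _).symm
  | succ H ih =>
    rw [sum_trajProb_mul_succ]
    have h0 := evalV_kernel_castSucc (θ := g) (P := M.P) (π := π) (0 : Fin (H + 1)) M.init
    rw [Fin.castSucc_zero] at h0
    rw [h0]
    refine Finset.sum_congr rfl fun a _ => ?_
    have h1 : ∀ x', ∑ τ, trajProb (M.tail x') (fun h => π h.succ) τ *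
        ∑ h, g (((Trajectory.cons M.init a τ).state h, (Trajectory.cons M.init a τ).action h), h) =
        g ((M.init, a), 0) + evalV g (kernelBackup M.P) π (Fin.succ 0) x' := by
      intro x'
      have h2 := ih (M := M.tail x') (π := fun h => π h.succ) (fun h => hπ h.succ)
        fun j => g (j.1, j.2.succ)
      rw [evalV_succ_eq]
      refine Eq.trans ?_ (congrArg (g ((M.init, a), 0) + ·) h2)
      simp only [Fin.sum_univ_succ (n := H), mul_add, Finset.sum_add_distrib]
      congr 1
      have : ∀ τ : Trajectory X A H, g (((Trajectory.cons M.init a τ).state 0,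
        (Trajectory.cons M.init a τ).action 0), 0) = g ((M.init, a), 0) := fun τ => by
        simp [Trajectory.cons, Trajectory.state, Trajectory.action]
      simp only [this]
      rw [← Finset.sum_mul, sum_trajProb fun h => hπ h.succ, one_mul]
    simp only [h1, mul_add, Finset.sum_add_distrib]
    rw [← Finset.sum_mul, (M.P_mem _ _ _).2, one_mul]
    rfl

lemma value_eq (hπ : IsPolicy π) :
    value M π = evalV (fun j => M.r j.2 j.1.1 j.1.2) (kernelBackup M.P) π 0 M.init :=
  sum_trajProb_mul_sum hπ fun j => M.r j.2 j.1.1 j.1.2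

end Path

/-! ### Covariances, counts and epochs -/

section Counts

variable {X A : Type*} [Fintype X] [Fintype A] [DecidableEq X] [DecidableEq A] {H : ℕ}

/-- The state-action pair at step `h`. -/
def Trajectory.pair (τ : Trajectory X A H) (h : Fin H) : X × A := (τ.state h, τ.action h)

/-- The number of visits of `q` at step `h` in the episodes before `k`. -/
def visits (traj : ℕ → Trajectory X A H) (k : ℕ) (h : Fin H) (q : X × A) : ℝ :=
  ∑ τ ∈ Finset.range k, if (traj τ).pair h = q then 1 else 0

/-- The regularized empirical transition kernel of the episodes before `k`. -/
def empKernel (traj : ℕ → Trajectory X A H) (k : ℕ) (h : Fin H) (x : X) (a : A) (x' : X) : ℝ :=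
  (∑ τ ∈ Finset.range k, if (traj τ).pair h = (x, a) ∧ (traj τ).next h = x' then 1 else 0) /
    (1 + visits traj k h (x, a))

variable {p : Params} {traj : ℕ → Trajectory X A H}

lemma Trajectory.feat_eq (τ : Trajectory X A H) (h : Fin H) :
    τ.feat h = Pi.single (τ.pair h) 1 := rfl

lemma Trajectory.feat_apply (τ : Trajectory X A H) (h : Fin H) (q : X × A) :
    τ.feat h q = if τ.pair h = q then 1 else 0 := by
  simp [Trajectory.feat_eq, Pi.single_apply, eq_comm]

lemma Trajectory.featAll_dotProduct (τ : Trajectory X A H) (w : (X × A) × Fin H → ℝ) :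
    τ.featAll ⬝ᵥ w = ∑ h, w (τ.pair h, h) := by
  simp [dotProduct, Trajectory.featAll, Trajectory.feat_apply, Fintype.sum_prod_type_right]

lemma Trajectory.featAll_apply_pair (τ : Trajectory X A H) (h : Fin H) :
    τ.featAll (τ.pair h, h) = 1 := by
  simp [Trajectory.featAll, Trajectory.feat_apply]

lemma Trajectory.featAll_dotProduct_self (τ : Trajectory X A H) :
    τ.featAll ⬝ᵥ τ.featAll = H := by
  rw [Trajectory.featAll_dotProduct]; simp [Trajectory.featAll_apply_pair]

lemma Trajectory.feat_dotProduct_self (τ : Trajectory X A H) (h : Fin H) :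
    τ.feat h ⬝ᵥ τ.feat h = 1 := by
  simp [Trajectory.feat_eq]

lemma covAll_eq_gram (k : ℕ) :
    covAll p traj k = gram p.lamR (fun τ => (traj τ).featAll) k := rfl

lemma covStep_eq_gram (k : ℕ) (h : Fin H) :
    covStep p traj k h = gram p.lamP (fun τ => (traj τ).feat h) k := rfl

lemma visits_nonneg (k : ℕ) (h : Fin H) (q : X × A) : 0 ≤ visits traj k h q :=
  Finset.sum_nonneg fun _ _ => by split_ifs <;> norm_num

/-- One-hot features are orthogonal or equal. Hence inverses of stepwise covariances are reciprocals
of regularized counts. -/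
lemma gram_feat_eq_diagonal (lam : ℝ) (k : ℕ) (h : Fin H) :
    gram lam (fun τ => (traj τ).feat h) k = diagonal fun q => lam + visits traj k h q := by
  ext q q'
  simp only [gram, Matrix.add_apply, Matrix.smul_apply, one_apply, Matrix.sum_apply,
    vecMulVec_apply, Trajectory.feat_apply, diagonal_apply, visits, smul_eq_mul]
  by_cases hq : q = q'
  · subst hq
    simp only [if_true, mul_one]
    congr 1
    exact Finset.sum_congr rfl fun τ _ => by split_ifs <;> norm_num
  · rw [if_neg hq, if_neg hq, mul_zero, zero_add]
    refine Finset.sum_eq_zero fun τ _ => ?_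
    split_ifs with h1 h2
    · exact absurd (h1.symm.trans h2) hq
    all_goals simp

lemma inv_diagonal_of_pos {n : Type*} [Fintype n] [DecidableEq n] {v : n → ℝ}
    (hv : ∀ i, 0 < v i) : (diagonal v)⁻¹ = diagonal fun i => (v i)⁻¹ := by
  apply inv_eq_right_inv
  rw [diagonal_mul_diagonal, ← diagonal_one]
  congr 1
  funext i
  exact mul_inv_cancel₀ (hv i).ne'

lemma invForm_gram_feat (k : ℕ) (h : Fin H) (x y : X × A → ℝ) :
    invForm (gram 1 (fun τ => (traj τ).feat h) k) x y =
      ∑ q, x q * y q / (1 + visits traj k h q) := by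
  rw [gram_feat_eq_diagonal, invForm, inv_diagonal_of_pos fun q => by
    have := visits_nonneg (traj := traj) k h q; linarith]
  simp only [dotProduct, mulVec_diagonal]
  exact Finset.sum_congr rfl fun q _ => by rw [div_eq_mul_inv]; ring

lemma kernelBackup_empKernel (k : ℕ) (h : Fin H) (V : X → ℝ) (q : X × A) :
    kernelBackup (empKernel traj k) h V q =
      (∑ τ ∈ Finset.range k, if (traj τ).pair h = q then V ((traj τ).next h) else 0) /
        (1 + visits traj k h q) := by
  simp only [kernelBackup, empKernel, div_mul_eq_mul_div, ← Finset.sum_div]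
  congr 1
  simp only [Finset.sum_mul]
  rw [Finset.sum_comm]
  refine Finset.sum_congr rfl fun τ _ => ?_
  by_cases hq : (traj τ).pair h = q <;> simp [hq]

/-- The key simplification of the tabular case: the regression is backward induction with an actual
kernel. -/
lemma psiHat_eq (hp : p.lamP = 1) (k : ℕ) :
    psiHat p traj k = kernelBackup (empKernel traj k) := by
  funext h V q
  rw [psiHat, covStep_eq_gram, hp, gram_feat_eq_diagonal, inv_diagonal_of_pos fun q => by
    have := visits_nonneg (traj := traj) k h q; linarith, mulVec_diagonal, kernelBackup_empKernel,
    div_eq_inv_mul]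
  simp [Trajectory.feat_apply]

/-- A row sums to n/(1 + n) for n visits; the missing mass is the effect of the regularization. -/
lemma isSubKernel_empKernel (k : ℕ) : IsSubKernel (empKernel traj k) := by
  intro h x a
  have h0 := visits_nonneg (traj := traj) k h (x, a)
  refine ⟨fun x' => div_nonneg (Finset.sum_nonneg fun _ _ => by split_ifs <;> norm_num)
    (by linarith), ?_⟩
  have h1 := kernelBackup_empKernel (traj := traj) k h (fun _ => 1) (x, a)
  simp only [kernelBackup, mul_one] at h1
  rw [h1, div_le_one (by linarith)]
  simp only [visits]; linarith

lemma covNoise_quadForm (hp : p.lamP = 1) (k : ℕ) (x : (X × A) × Fin H → ℝ) :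
    x ⬝ᵥ covNoise p traj k *ᵥ x = 2 * p.betaR ^ 2 * invForm (covAll p traj k) x x +
      2 * H * p.betaP ^ 2 * ∑ j, x j ^ 2 / (1 + visits traj k j.2 j.1) := by
  have h1 : covStep p traj k = fun h => diagonal fun q => 1 + visits traj k h q := by
    funext h; rw [covStep_eq_gram, hp, gram_feat_eq_diagonal]
  rw [covNoise, h1, blockDiagonal_diagonal, inv_diagonal_of_pos fun q => by
    have := visits_nonneg (traj := traj) k q.2 q.1; linarith]
  rw [add_mulVec, dotProduct_add, smul_mulVec, smul_mulVec, dotProduct_smul, dotProduct_smul]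
  simp only [invForm, smul_eq_mul, mulVec_diagonal, dotProduct]
  congr 2
  exact Finset.sum_congr rfl fun j _ => by rw [div_eq_mul_inv]; ring

lemma posSemidef_covNoise (hp : p.lamP = 1) (hr : 0 < p.lamR) (k : ℕ) :
    (covNoise p traj k).PosSemidef := by
  have h1 : covStep p traj k = fun h => diagonal fun q => 1 + visits traj k h q := by
    funext h; rw [covStep_eq_gram, hp, gram_feat_eq_diagonal]
  rw [covNoise, h1, blockDiagonal_diagonal, inv_diagonal_of_pos fun q => by
    have := visits_nonneg (traj := traj) k q.2 q.1; linarith]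
  refine ((posDef_gram hr k).inv.posSemidef.smul (by positivity)).add
    (PosSemidef.smul (PosSemidef.diagonal fun q => ?_) (by positivity))
  have := visits_nonneg (traj := traj) k q.2 q.1
  simp only [Pi.zero_apply]; positivity

/-- Splits the error of ridge regression into the self-normalized noise and the regularization bias.
-/
lemma thetaHat_error (hr : 0 < p.lamR) (v : ℕ → ℝ) (θ : (X × A) × Fin H → ℝ) (k : ℕ)
    (x : (X × A) × Fin H → ℝ) :
    x ⬝ᵥ (thetaHat p traj v k - θ) = invForm (covAll p traj k) x
      (∑ τ ∈ Finset.range k, (v τ - (traj τ).featAll ⬝ᵥ θ) • (traj τ).featAll) -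
        p.lamR * invForm (covAll p traj k) x θ := by
  set Λ := covAll p traj k with hΛ
  have hu : IsUnit Λ.det := isUnit_det_of_posDef (posDef_gram hr k)
  have h1 : Λ *ᵥ θ = p.lamR • θ +
      ∑ τ ∈ Finset.range k, ((traj τ).featAll ⬝ᵥ θ) • (traj τ).featAll := by
    rw [hΛ, covAll, add_mulVec, smul_mulVec, one_mulVec, Matrix.sum_mulVec]
    simp [vecMulVec_mulVec]
  have h2 : θ = Λ⁻¹ *ᵥ (Λ *ᵥ θ) := by
    rw [mulVec_mulVec, nonsing_inv_mul _ hu, one_mulVec]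
  have h3 : thetaHat p traj v k - θ = Λ⁻¹ *ᵥ ((∑ τ ∈ Finset.range k,
      (v τ - (traj τ).featAll ⬝ᵥ θ) • (traj τ).featAll) - p.lamR • θ) := by
    conv_lhs => rw [h2]
    rw [thetaHat, ← hΛ, ← mulVec_sub, h1]
    congr 1
    simp only [sub_smul, Finset.sum_sub_distrib]
    abel
  rw [h3, mulVec_sub, dotProduct_sub, mulVec_smul, dotProduct_smul]
  rfl

lemma epochStart_le (k : ℕ) : epochStart p traj k ≤ k := by
  induction k with
  | zero => simp [epochStart]
  | succ k ih => rw [epochStart]; split_ifs <;> omega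

lemma epochStart_succ_cases (k : ℕ) :
    epochStart p traj (k + 1) = k + 1 ∨ epochStart p traj (k + 1) = epochStart p traj k := by
  rw [epochStart]; split_ifs <;> simp

lemma epochStart_succ_of_ne {k : ℕ} (h : epochStart p traj (k + 1) ≠ k + 1) :
    epochStart p traj (k + 1) = epochStart p traj k :=
  (epochStart_succ_cases k).resolve_left h

lemma epochStart_idem (k : ℕ) :
    epochStart p traj (epochStart p traj k) = epochStart p traj k := by
  induction k with
  | zero => rfl
  | succ k ih =>
    rcases epochStart_succ_cases (p := p) (traj := traj) k with h | h
    · rw [h, h]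
    · rw [h, ih]

/-- Either an epoch starts at `k` and the determinants coincide, or the doubling test has just
failed. -/
lemma det_le_two_mul_epochStart (hp : p.lamP = 1) (hr : 0 < p.lamR) (k : ℕ) :
    (∀ h, (covStep p traj k h).det ≤ 2 * (covStep p traj (epochStart p traj k) h).det) ∧
      (covAll p traj k).det ≤ 2 * (covAll p traj (epochStart p traj k)).det := by
  have hs : ∀ k h, 0 < (covStep p traj k h).det := fun k h => det_gram_pos (by rw [hp]; norm_num) k
  have ha : ∀ k, 0 < (covAll p traj k).det := fun k => det_gram_pos hr k
  have hself : (∀ h, (covStep p traj k h).det ≤ 2 * (covStep p traj k h).det) ∧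
      (covAll p traj k).det ≤ 2 * (covAll p traj k).det :=
    ⟨fun h => by linarith [hs k h], by linarith [ha k]⟩
  cases k with
  | zero => simpa [epochStart] using hself
  | succ k =>
    rw [epochStart]
    split_ifs with hc
    · exact hself
    · push Not at hc
      exact ⟨fun h => (hc.1 h).le, hc.2.le⟩

/-- The price of a covariance frozen at the epoch start: the ratio of the inverse forms is at most
the ratio of the determinants. -/
lemma invForm_covAll_epochStart_le (hp : p.lamP = 1) (hr : 0 < p.lamR) (k : ℕ)
    (x : (X × A) × Fin H → ℝ) :
    invForm (covAll p traj (epochStart p traj k)) x x ≤ 2 * invForm (covAll p traj k) x x := by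
  have h1 := invForm_gram_mul_det_le (φ := fun τ => (traj τ).featAll) hr x
    (epochStart_le (p := p) (traj := traj) k)
  have h2 := (det_le_two_mul_epochStart (traj := traj) hp hr k).2
  have h3 := invForm_self_nonneg (posDef_gram (φ := fun τ => (traj τ).featAll) hr k) x
  have h4 := det_gram_pos (φ := fun τ => (traj τ).featAll) hr (epochStart p traj k)
  rw [← covAll_eq_gram] at h1 h3 h4
  rw [← covAll_eq_gram] at h1
  nlinarith

/-- The same comparison in the direction of a basis vector, where the inverse form is the reciprocal
of the regularized count. -/
lemma one_add_visits_le (hp : p.lamP = 1) (hr : 0 < p.lamR) (k : ℕ) (h : Fin H) (q : X × A) :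
    1 + visits traj k h q ≤ 2 * (1 + visits traj (epochStart p traj k) h q) := by
  have h1 := invForm_gram_mul_det_le (φ := fun τ => (traj τ).feat h) (lam := 1) one_pos
    (Pi.single q 1) (epochStart_le (p := p) (traj := traj) k)
  have h2 := (det_le_two_mul_epochStart (traj := traj) hp hr k).1 h
  have h4 := det_gram_pos (φ := fun τ => (traj τ).feat h) (lam := 1) one_pos (epochStart p traj k)
  rw [covStep_eq_gram, covStep_eq_gram, hp] at h2
  rw [invForm_gram_feat, invForm_gram_feat] at h1
  have e : ∀ j, ∑ q', (Pi.single q 1 : X × A → ℝ) q' * (Pi.single q 1 : X × A → ℝ) q' /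
      (1 + visits traj j h q') = 1 / (1 + visits traj j h q) := fun j => by
    rw [Finset.sum_eq_single q]
    · simp
    · intro b _ hb; simp [hb]
    · simp
  rw [e, e] at h1
  have v1 : 0 < 1 + visits traj k h q := by linarith [visits_nonneg (traj := traj) k h q]
  have v2 : 0 < 1 + visits traj (epochStart p traj k) h q := by
    linarith [visits_nonneg (traj := traj) (epochStart p traj k) h q]
  set d := (gram 1 (fun τ => (traj τ).feat h) (epochStart p traj k)).det
  rw [div_mul_eq_mul_div, div_mul_eq_mul_div, div_le_div_iff₀ v2 v1, one_mul, one_mul] at h1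
  have h5 : d * (1 + visits traj k h q) ≤
      d * (2 * (1 + visits traj (epochStart p traj k) h q)) := by nlinarith
  exact le_of_mul_le_mul_left h5 h4

/-- The number of epochs that start in the episodes `0, …, K`. -/
def epochCount (p : Params) (traj : ℕ → Trajectory X A H) (K : ℕ) : ℝ :=
  1 + ∑ k ∈ Finset.range K, if epochStart p traj (k + 1) = k + 1 then 1 else 0

/-- The sum of all log-determinants never decreases and gains at least log 2 whenever an epoch
starts. The H stepwise matrices and the aggregate matrix each contribute growth at most dH log (1 +
K), whence the factor 2. -/
lemma epochCount_mul_log_two_le (hp : p.lamP = 1) (hr : p.lamR = H) (hH : 0 < H) (K : ℕ) :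
    (epochCount p traj K - 1) * Real.log 2 ≤
      2 * (Fintype.card X * Fintype.card A * H) * Real.log (1 + K) := by
  have hp0 : 0 < p.lamP := by rw [hp]; norm_num
  have hr0 : 0 < p.lamR := by rw [hr]; exact_mod_cast hH
  set Φ : ℕ → ℝ := fun k => ∑ h, Real.log (covStep p traj k h).det +
    Real.log (covAll p traj k).det with hΦ
  have hs : ∀ k h, 0 < (covStep p traj k h).det := fun k h => det_gram_pos hp0 k
  have ha : ∀ k, 0 < (covAll p traj k).det := fun k => det_gram_pos hr0 k
  have hsm : ∀ h, Monotone fun k => (covStep p traj k h).det := fun h => det_gram_mono hp0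
  have ham : Monotone fun k => (covAll p traj k).det := det_gram_mono hr0
  have hmono : Monotone Φ := fun j k hjk => by
    refine add_le_add (Finset.sum_le_sum fun h _ => Real.log_le_log (hs j h) (hsm h hjk))
      (Real.log_le_log (ha j) (ham hjk))
  have hjump : ∀ k, epochStart p traj (k + 1) = k + 1 →
      Φ (epochStart p traj k) + Real.log 2 ≤ Φ (k + 1) := by
    intro k hk
    have hle : epochStart p traj k ≤ k + 1 := (epochStart_le k).trans (Nat.le_succ k)
    have hcond : (∃ h, (covStep p traj (k + 1) h).det ≥
            2 * (covStep p traj (epochStart p traj k) h).det) ∨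
        (covAll p traj (k + 1)).det ≥ 2 * (covAll p traj (epochStart p traj k)).det := by
      by_contra hcon
      rw [epochStart, if_neg hcon] at hk
      have := epochStart_le (p := p) (traj := traj) k
      omega
    rcases hcond with ⟨h, hh⟩ | hh
    · have h1 := Real.log_le_log (by linarith [hs (epochStart p traj k) h]) hh
      rw [Real.log_mul two_ne_zero (hs _ _).ne'] at h1
      have h2 : ∑ h', Real.log (covStep p traj (epochStart p traj k) h').det + Real.log 2 ≤
          ∑ h', Real.log (covStep p traj (k + 1) h').det := by
        rw [← Finset.add_sum_erase _ _ (Finset.mem_univ h),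
          ← Finset.add_sum_erase (a := h) _ (fun h' => Real.log (covStep p traj (k + 1) h').det)
          (Finset.mem_univ h)]
        have := Finset.sum_le_sum (s := Finset.univ.erase h) fun h' _ =>
          Real.log_le_log (hs (epochStart p traj k) h') (hsm h' hle)
        linarith
      have h3 := Real.log_le_log (ha _) (ham hle)
      simp only [hΦ] at h3 ⊢
      linarith
    · have h1 := Real.log_le_log (by linarith [ha (epochStart p traj k)]) hh
      rw [Real.log_mul two_ne_zero (ha _).ne'] at h1
      have := Finset.sum_le_sum (s := Finset.univ) fun h' _ =>
          Real.log_le_log (hs (epochStart p traj k) h') (hsm h' hle)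
      simp only [hΦ] at this ⊢
      linarith
  have hcount : ∀ k, (epochCount p traj k - 1) * Real.log 2 ≤ Φ (epochStart p traj k) - Φ 0 := by
    intro k
    induction k with
    | zero => simp [epochCount, epochStart]
    | succ k ih =>
      have e : epochCount p traj (k + 1) - 1 = (epochCount p traj k - 1) +
          if epochStart p traj (k + 1) = k + 1 then 1 else 0 := by
        rw [epochCount, epochCount, Finset.sum_range_succ]; ring
      rw [e]
      split_ifs with hk
      · have := hjump k hk
        rw [hk]; linarith
      · rw [epochStart_succ_of_ne hk]; linarith
  refine (hcount K).trans ((sub_le_sub_right (hmono (epochStart_le K)) _).trans ?_)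
  have hH' : (0 : ℝ) < H := by exact_mod_cast hH
  have hcardS : ∀ h, Real.log (covStep p traj K h).det ≤
      Fintype.card X * Fintype.card A * Real.log (1 + K) := fun h => by
    have h1 := det_gram_le (φ := fun τ => (traj τ).feat h) hp0
      (fun τ => (Trajectory.feat_dotProduct_self (traj τ) h).le) K
    rw [← covStep_eq_gram, hp, mul_one] at h1
    have h2 := Real.log_le_log (hs K h) h1
    rw [Real.log_pow] at h2
    simpa using h2
  have hcardA : Real.log (covAll p traj K).det ≤
      Fintype.card X * Fintype.card A * H * (Real.log H + Real.log (1 + K)) := by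
    have h1 := det_gram_le (φ := fun τ => (traj τ).featAll) hr0
      (fun τ => (Trajectory.featAll_dotProduct_self (traj τ)).le) K
    rw [← covAll_eq_gram, hr, show (H : ℝ) + K * H = H * (1 + K) by ring] at h1
    have h2 := Real.log_le_log (ha K) h1
    rw [Real.log_pow, Real.log_mul hH'.ne' (by positivity)] at h2
    simpa using h2
  -- The initial aggregate determinant cancels the log H in its upper bound, so no extra logarithm
  -- appears.
  have h0 : Φ 0 = Fintype.card X * Fintype.card A * H * Real.log H := by
    have h1 : ∀ h, (covStep p traj 0 h).det = 1 := fun h => by simp [covStep, hp]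
    have h2 : (covAll p traj 0).det = (H : ℝ) ^ (Fintype.card X * Fintype.card A * H) := by
      simp [covAll, hr]
    simp only [hΦ, h1, h2, Real.log_one, Finset.sum_const_zero, zero_add, Real.log_pow]
    push_cast; ring
  have hS : ∑ h, Real.log (covStep p traj K h).det ≤
      H * (Fintype.card X * Fintype.card A * Real.log (1 + K)) := by
    refine (Finset.sum_le_sum fun h _ => hcardS h).trans ?_
    simp
  rw [h0]; simp only [hΦ]
  linarith

lemma log_det_covAll_div_le (hr : p.lamR = H) (hH : 0 < H) (K : ℕ) :
    Real.log ((covAll p traj K).det / (covAll p traj 0).det) ≤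
      Fintype.card X * Fintype.card A * H * Real.log (1 + K) := by
  have hr0 : 0 < p.lamR := by rw [hr]; exact_mod_cast hH
  have hH' : (0 : ℝ) < H := by exact_mod_cast hH
  have h1 := det_gram_le (φ := fun τ => (traj τ).featAll) hr0
    (fun τ => (Trajectory.featAll_dotProduct_self (traj τ)).le) K
  rw [← covAll_eq_gram, hr, show (H : ℝ) + K * H = H * (1 + K) by ring, mul_pow] at h1
  have h2 : (covAll p traj 0).det = (H : ℝ) ^ Fintype.card ((X × A) × Fin H) := by
    simp [covAll, hr]
  have h3 : (covAll p traj K).det / (covAll p traj 0).det ≤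
      (1 + K : ℝ) ^ Fintype.card ((X × A) × Fin H) := by
    rw [h2, div_le_iff₀ (by positivity), mul_comm]; exact h1
  have h4 := Real.log_le_log (div_pos (det_gram_pos hr0 K) (det_gram_pos hr0 0)) h3
  rw [Real.log_pow] at h4
  simpa [covAll_eq_gram] using h4

/-- The pigeonhole bound for one-hot features. -/
lemma sum_inv_sqrt_visits_le (h : Fin H) (K : ℕ) :
    ∑ k ∈ Finset.range K, 1 / √(1 + visits traj k h ((traj k).pair h)) ≤
      2 * √(Fintype.card X * Fintype.card A * K) := by
  have h1 : ∀ K, ∑ k ∈ Finset.range K, 1 / √(1 + visits traj k h ((traj k).pair h)) ≤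
      ∑ q : X × A, 2 * √(visits traj K h q) := by
    intro K
    induction K with
    | zero => simp [visits]
    | succ K ih =>
      rw [Finset.sum_range_succ]
      have e : ∀ q, visits traj (K + 1) h q = visits traj K h q +
          if (traj K).pair h = q then 1 else 0 := fun q => by
        rw [visits, Finset.sum_range_succ]; rfl
      set q₀ := (traj K).pair h with hq₀
      rw [← Finset.add_sum_erase _ _ (Finset.mem_univ q₀)]
      rw [← Finset.add_sum_erase _ _ (Finset.mem_univ q₀)] at ih
      have h2 : ∑ q ∈ Finset.univ.erase q₀, 2 * √(visits traj (K + 1) h q) =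
          ∑ q ∈ Finset.univ.erase q₀, 2 * √(visits traj K h q) := by
        refine Finset.sum_congr rfl fun q hq => ?_
        rw [e q, if_neg (Finset.ne_of_mem_erase hq).symm, add_zero]
      rw [h2, e q₀, if_pos rfl]
      set N := visits traj K h q₀
      have hN : 0 ≤ N := visits_nonneg K h q₀
      -- The comparison of the sum of 1/√n with an integral, started one step later because the
      -- counts are regularized by 1.
      have h3 : 2 * √N + 1 / √(1 + N) ≤ 2 * √(N + 1) := by
        rw [add_comm N 1]
        have hs : 0 < √(1 + N) := Real.sqrt_pos.2 (by linarith)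
        have h4 : √N * √N = N := Real.mul_self_sqrt hN
        have h5 : √(1 + N) * √(1 + N) = 1 + N := Real.mul_self_sqrt (by linarith)
        have h6 : √N ≤ √(1 + N) := Real.sqrt_le_sqrt (by linarith)
        rw [← le_sub_iff_add_le', div_le_iff₀ hs]
        nlinarith [Real.sqrt_nonneg N]
      linarith
  have hsum : ∑ q : X × A, visits traj K h q = K := by
    simp only [visits]
    rw [Finset.sum_comm]; simp
  refine (h1 K).trans ?_
  rw [← Finset.mul_sum]
  gcongr
  apply Real.le_sqrt_of_sq_le
  have := Finset.sum_mul_sq_le_sq_mul_sq Finset.univ (fun _ : X × A => (1 : ℝ))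
    fun q => √(visits traj K h q)
  simp only [one_mul, one_pow, Real.sq_sqrt (visits_nonneg (traj := traj) K h _), hsum] at this
  simpa using this

/-- The elliptical potential bound for the aggregate features. -/
lemma sum_sqrt_invForm_le (hr : p.lamR = H) (hH : 0 < H) (K : ℕ) :
    ∑ k ∈ Finset.range K, √(invForm (covAll p traj k) (traj k).featAll (traj k).featAll) ≤
      √(K * (2 * (Fintype.card X * Fintype.card A * H * Real.log (1 + K)))) := by
  have hr0 : 0 < p.lamR := by rw [hr]; exact_mod_cast hH
  have hH' : (0 : ℝ) < H := by exact_mod_cast hH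
  set w : ℕ → ℝ := fun k => invForm (covAll p traj k) (traj k).featAll (traj k).featAll with hw
  have hw0 : ∀ k, 0 ≤ w k := fun k => invForm_self_nonneg (posDef_gram hr0 k) _
  -- Feature norms and regularization balance, both being H; for w ≤ 1 one has w ≤ 2 log (1 + w).
  have hw1 : ∀ k, w k ≤ 1 := fun k => by
    refine (invForm_gram_le hr0 _ k).trans ?_
    rw [Trajectory.featAll_dotProduct_self, hr, div_self hH'.ne']
  have hlog : ∀ k, w k ≤ 2 * Real.log (1 + w k) := fun k => by
    have h1 := Real.one_sub_inv_le_log_of_pos (show 0 < 1 + w k by linarith [hw0 k])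
    have h2 : w k / 2 ≤ 1 - (1 + w k)⁻¹ := by
      rw [show 1 - (1 + w k)⁻¹ = w k / (1 + w k) by
        have : 1 + w k ≠ 0 := by linarith [hw0 k]
        field_simp; ring]
      apply div_le_div_of_nonneg_left (hw0 k) <;> linarith [hw0 k, hw1 k]
    linarith
  apply Real.le_sqrt_of_sq_le
  have h1 := Finset.sum_mul_sq_le_sq_mul_sq (Finset.range K) (fun _ => (1 : ℝ)) fun k => √(w k)
  simp only [one_mul, one_pow, Real.sq_sqrt (hw0 _), Finset.sum_const, Finset.card_range,
    nsmul_eq_mul, mul_one] at h1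
  refine h1.trans (mul_le_mul_of_nonneg_left ?_ (Nat.cast_nonneg K))
  calc ∑ k ∈ Finset.range K, w k ≤ ∑ k ∈ Finset.range K, 2 * Real.log (1 + w k) :=
        Finset.sum_le_sum fun k _ => hlog k
    _ = 2 * Real.log ((covAll p traj K).det / (covAll p traj 0).det) := by
        rw [← Finset.mul_sum, covAll_eq_gram, covAll_eq_gram,
          Real.log_div (det_gram_pos hr0 K).ne' (det_gram_pos hr0 0).ne']
        congr 1
        exact sum_log_one_add_invForm (φ := fun τ => (traj τ).featAll) hr0 K
    _ ≤ _ := by gcongr; exact log_det_covAll_div_le hr hH K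

end Counts

/-! ### Multiplicative weights -/

section Hedge

variable {ι : Type*} [Fintype ι] {η : ℝ} {w u : ι → ℝ}

lemma expUpdate_denom_pos (hw : ∀ a, 0 < w a) (hs : ∑ a, w a = 1) :
    0 < ∑ b, w b * Real.exp (η * u b) := by
  have : Nonempty ι := by
    by_contra h
    rw [not_nonempty_iff] at h
    simp at hs
  exact Finset.sum_pos (fun b _ => mul_pos (hw b) (Real.exp_pos _)) Finset.univ_nonempty

lemma expUpdate_pos (hw : ∀ a, 0 < w a) (hs : ∑ a, w a = 1) (a : ι) :
    0 < expUpdate η w u a :=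
  div_pos (mul_pos (hw a) (Real.exp_pos _)) (expUpdate_denom_pos hw hs)

lemma sum_expUpdate (hw : ∀ a, 0 < w a) (hs : ∑ a, w a = 1) : ∑ a, expUpdate η w u a = 1 := by
  simp only [expUpdate]
  rw [← Finset.sum_div, div_self (expUpdate_denom_pos hw hs).ne']

lemma le_one_of_sum_eq_one (hw : ∀ a, 0 < w a) (hs : ∑ a, w a = 1) (a : ι) : w a ≤ 1 := by
  rw [← hs]
  exact Finset.single_le_sum (f := w) (fun b _ => (hw b).le) (Finset.mem_univ a)

/-- One step of the multiplicative weights update. -/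
lemma expUpdate_gap_le (hw : ∀ a, 0 < w a) (hs : ∑ a, w a = 1) {B : ℝ} (hB : 0 < B)
    (hu : ∀ a, |u a| ≤ B) (a : ι) :
    η * (u a - ∑ b, w b * u b) ≤
      Real.log (expUpdate η w u a) - Real.log (w a) + 2 * η ^ 2 * B ^ 2 := by
  set c := ∑ b, w b * u b with hc
  have hcB : |c| ≤ B := by
    refine (Finset.abs_sum_le_sum_abs _ _).trans ?_
    calc ∑ b, |w b * u b| ≤ ∑ b, w b * B := Finset.sum_le_sum fun b _ => by
          rw [abs_mul, abs_of_pos (hw b)]; exact mul_le_mul_of_nonneg_left (hu b) (hw b).le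
      _ = B := by rw [← Finset.sum_mul, hs, one_mul]
  -- Hoeffding's lemma: centred utilities lie in [-2B, 2B], so the linear term of the chord bound
  -- vanishes on average and cosh (2ηB) remains.
  have h1 : ∑ b, w b * Real.exp (η * (u b - c)) ≤ Real.exp (2 * η ^ 2 * B ^ 2) := by
    have hy : ∀ b, |u b - c| ≤ 2 * B := fun b => by
      rw [abs_le] at *
      have := abs_le.1 (hu b)
      constructor <;> linarith
    calc ∑ b, w b * Real.exp (η * (u b - c)) ≤ ∑ b, w b * (Real.cosh (η * (2 * B)) +
          (u b - c) / (2 * B) * Real.sinh (η * (2 * B))) := Finset.sum_le_sum fun b _ =>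
            mul_le_mul_of_nonneg_left (exp_mul_le_cosh_add (by linarith) (hy b)) (hw b).le
      _ = (∑ b, w b) * Real.cosh (η * (2 * B)) + (∑ b, w b * u b - (∑ b, w b) * c) *
          (Real.sinh (η * (2 * B)) / (2 * B)) := by
        rw [Finset.sum_mul, Finset.sum_mul, ← Finset.sum_sub_distrib, Finset.sum_mul,
          ← Finset.sum_add_distrib]
        exact Finset.sum_congr rfl fun b _ => by ring
      _ = Real.cosh (η * (2 * B)) := by rw [hs, ← hc]; ring
      _ ≤ Real.exp ((η * (2 * B)) ^ 2 / 2) := Real.cosh_le_exp_half_sq _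
      _ = Real.exp (2 * η ^ 2 * B ^ 2) := by ring_nf
  have hden := expUpdate_denom_pos (η := η) (u := u) hw hs
  have h2 : ∑ b, w b * Real.exp (η * u b) =
      Real.exp (η * c) * ∑ b, w b * Real.exp (η * (u b - c)) := by
    rw [Finset.mul_sum]
    refine Finset.sum_congr rfl fun b _ => ?_
    rw [mul_left_comm, ← Real.exp_add]; ring_nf
  have h3 : Real.log (∑ b, w b * Real.exp (η * u b)) ≤ η * c + 2 * η ^ 2 * B ^ 2 := by
    rw [← Real.log_exp (η * c + 2 * η ^ 2 * B ^ 2), Real.exp_add]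
    apply Real.log_le_log hden
    rw [h2]; gcongr
  rw [expUpdate, Real.log_div (mul_pos (hw a) (Real.exp_pos _)).ne' hden.ne',
    Real.log_mul (hw a).ne' (Real.exp_ne_zero _), Real.log_exp]
  linarith

end Hedge

/-! ### Pathwise analysis: the updates, the favourable event, boundedness and optimism of the
estimates. -/

section Deterministic

variable {X A : Type*} [Fintype X] [Fintype A] [DecidableEq X] [DecidableEq A] {H : ℕ}
  {p : Params} {traj : ℕ → Trajectory X A H} {v : ℕ → ℝ} {ζ : ℕ → Fin p.m → Noise X A H}

lemma policy_of_start {k : ℕ} (hk : epochStart p traj k = k) (i : Fin p.m) (h : Fin H) (x : X) :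
    policy p traj v ζ k i h x = fun _ => 1 / (Fintype.card A : ℝ) := by
  cases k with
  | zero => rfl
  | succ k => simp only [policy, hk, if_true]

lemma policy_succ_of_ne {k : ℕ} (hk : epochStart p traj (k + 1) ≠ k + 1) (i : Fin p.m)
    (h : Fin H) (x : X) :
    policy p traj v ζ (k + 1) i h x = expUpdate p.etaO (policy p traj v ζ k i h x)
      (evalQ (rewardHat p traj v ζ k i) (psiHat p traj (epochStart p traj k))
        (policy p traj v ζ k i) h x) := by
  simp only [policy, hk, if_false]

lemma weights_of_start {x₁ : X} {k : ℕ} (hk : epochStart p traj k = k) :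
    weights p x₁ traj v ζ k = fun _ => 1 / (p.m : ℝ) := by
  cases k with
  | zero => rfl
  | succ k => simp only [weights, hk, if_true]

lemma weights_succ_of_ne {x₁ : X} {k : ℕ} (hk : epochStart p traj (k + 1) ≠ k + 1) :
    weights p x₁ traj v ζ (k + 1) =
      expUpdate p.etaX (weights p x₁ traj v ζ k) (initValueHat p x₁ traj v ζ k) := by
  simp only [weights, hk, if_false]

lemma policy_pos_and_sum [Nonempty A] (k : ℕ) (i : Fin p.m) (h : Fin H) (x : X) :
    (∀ a, 0 < policy p traj v ζ k i h x a) ∧ ∑ a, policy p traj v ζ k i h x a = 1 := by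
  have hA : (0 : ℝ) < Fintype.card A := by exact_mod_cast Fintype.card_pos
  have hst : ∀ k, epochStart p traj k = k → (∀ a, 0 < policy p traj v ζ k i h x a) ∧
      ∑ a, policy p traj v ζ k i h x a = 1 := fun k hk => by
    rw [policy_of_start hk]
    exact ⟨fun a => by positivity, by simp⟩
  induction k with
  | zero => exact hst 0 rfl
  | succ k ih =>
    by_cases hk : epochStart p traj (k + 1) = k + 1
    · exact hst _ hk
    · rw [policy_succ_of_ne hk]
      exact ⟨expUpdate_pos ih.1 ih.2, sum_expUpdate ih.1 ih.2⟩

lemma isPolicy_policy [Nonempty A] (k : ℕ) (i : Fin p.m) : IsPolicy (policy p traj v ζ k i) :=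
  fun h x => ⟨fun a => ((policy_pos_and_sum k i h x).1 a).le, (policy_pos_and_sum k i h x).2⟩

lemma weights_pos_and_sum {x₁ : X} (hm : 0 < p.m) (k : ℕ) :
    (∀ i, 0 < weights p x₁ traj v ζ k i) ∧ ∑ i, weights p x₁ traj v ζ k i = 1 := by
  have hm' : (0 : ℝ) < p.m := by exact_mod_cast hm
  have hst : ∀ k, epochStart p traj k = k → (∀ i, 0 < weights p x₁ traj v ζ k i) ∧
      ∑ i, weights p x₁ traj v ζ k i = 1 := fun k hk => by
    rw [weights_of_start hk]
    exact ⟨fun a => by positivity, by simp [hm'.ne']⟩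
  induction k with
  | zero => exact hst 0 rfl
  | succ k ih =>
    by_cases hk : epochStart p traj (k + 1) = k + 1
    · exact hst _ hk
    · rw [weights_succ_of_ne hk]
      exact ⟨expUpdate_pos ih.1 ih.2, sum_expUpdate ih.1 ih.2⟩

/-- Telescoping of a potential that is reset at the start of every epoch. -/
lemma sum_le_of_reset {K : ℕ} {a Φ Ψ : ℕ → ℝ} {C c : ℝ} (hstep : ∀ k < K, a k ≤ Ψ k - Φ k + c)
    (hstart : ∀ k, epochStart p traj (k + 1) = k + 1 → Ψ k ≤ 0)
    (hcont : ∀ k, epochStart p traj (k + 1) ≠ k + 1 → Ψ k = Φ (k + 1))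
    (hlow : ∀ k, epochStart p traj k = k → -C ≤ Φ k) (hup : Φ K ≤ 0) :
    ∑ k ∈ Finset.range K, a k ≤ C * epochCount p traj K + c * K := by
  -- At a reset the outgoing potential is nonpositive and the new one is at least `-C`, so each
  -- epoch costs `C`; inside an epoch the terms telescope.
  have key : ∀ j ≤ K, ∑ k ∈ Finset.range j, a k ≤ Φ j + C * epochCount p traj j + c * j := by
    intro j
    induction j with
    | zero =>
      intro _
      have := hlow 0 rfl
      simp [epochCount]; linarith
    | succ j ih =>
      intro hj
      have h1 := ih (by omega)
      have h2 := hstep j (by omega)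
      rw [Finset.sum_range_succ]
      have e : epochCount p traj (j + 1) = epochCount p traj j +
          if epochStart p traj (j + 1) = j + 1 then 1 else 0 := by
        rw [epochCount, epochCount, Finset.sum_range_succ]; ring
      rw [e]; push_cast
      split_ifs with hs
      · have := hstart j hs
        have := hlow _ hs
        linarith
      · have := hcont j hs
        linarith
  have := key K le_rfl
  linarith

/-- The mean rewards as a vector. -/
def MDP.rewardVec (M : MDP X A H) : (X × A) × Fin H → ℝ := fun j => M.r j.2 j.1.1 j.1.2

/-- The value functions of a policy. -/
def MDP.valueFun (M : MDP X A H) (π : Fin H → X → A → ℝ) : Fin (H + 1) → X → ℝ :=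
  evalV M.rewardVec (kernelBackup M.P) π

/-- The value estimates for a policy, with the kernel and the perturbations of the epoch. -/
def valueHat (p : Params) (traj : ℕ → Trajectory X A H) (v : ℕ → ℝ)
    (ζ : ℕ → Fin p.m → Noise X A H) (k : ℕ) (i : Fin p.m) (π : Fin H → X → A → ℝ) :
    Fin (H + 1) → X → ℝ :=
  evalV (rewardHat p traj v ζ k i) (kernelBackup (empKernel traj (epochStart p traj k))) π

/-- The favourable event: concentration of the estimates and of the perturbations, and
optimism of one member of the ensemble in every epoch. -/
structure IsGood (M : MDP X A H) (p : Params) (K : ℕ) (πstar : Fin H → X → A → ℝ)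
    (traj : ℕ → Trajectory X A H) (v : ℕ → ℝ) (ζ : ℕ → Fin p.m → Noise X A H)
    (βZ cT : ℝ) : Prop where
  reward : ∀ k < K, ∀ x, |x ⬝ᵥ (thetaHat p traj v k - M.rewardVec)| ≤
    p.betaR * √(invForm (covAll p traj k) x x)
  fixedValue : ∀ k < K, ∀ h, ∑ q, (1 + visits traj k h q) *
    (kernelBackup (empKernel traj k) h (M.valueFun πstar h.succ) q -
      kernelBackup M.P h (M.valueFun πstar h.succ) q) ^ 2 ≤ p.betaP ^ 2
  kernel : ∀ k < K, ∀ h q (V : X → ℝ) (B : ℝ), (∀ x, |V x| ≤ B) →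
    |kernelBackup (empKernel traj k) h V q - kernelBackup M.P h V q| ≤
      B * cT * (1 / √(1 + visits traj k h q))
  noise : ∀ k < K, epochStart p traj k = k → ∀ i (x : (X × A) × Fin H → ℝ),
    |x ⬝ᵥ (ζ k i)| ≤ βZ * √(x ⬝ᵥ covNoise p traj k *ᵥ x)
  optimism : ∀ k < K, epochStart p traj k = k → ∃ i,
    √(occ (empKernel traj k) πstar 0 M.init ⬝ᵥ
      covNoise p traj k *ᵥ occ (empKernel traj k) πstar 0 M.init) ≤
      occ (empKernel traj k) πstar 0 M.init ⬝ᵥ (ζ k i)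

variable {M : MDP X A H} {K : ℕ} {πstar : Fin H → X → A → ℝ} {βZ cT : ℝ}

lemma rewardHat_eq (k : ℕ) (i : Fin p.m) : rewardHat p traj v ζ k i =
    (thetaHat p traj v k - M.rewardVec) + M.rewardVec + ⇑(ζ (epochStart p traj k) i) := by
  funext j; simp [rewardHat]

lemma valueFun_bounds {π : Fin H → X → A → ℝ} (hπ : IsPolicy π) (h : Fin (H + 1)) (x : X) :
    |M.valueFun π h x| ≤ H := by
  have h1 := evalV_le_of_le (θ := M.rewardVec) M.isSubKernel hπ zero_le_one
    (fun j => (M.r_mem _ _ _).2) h x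
  have h2 := evalV_mono (θ := 0) (θ' := M.rewardVec) M.isSubKernel hπ
    (fun j => (M.r_mem _ _ _).1) h x
  have h3 : evalV (0 : (X × A) × Fin H → ℝ) (kernelBackup M.P) π h x = 0 :=
    map_zero (evalVLin M.P π h x)
  rw [mul_one] at h1
  rw [MDP.valueFun, abs_of_nonneg (by linarith)]
  exact h1

/-- The crude bound of the value estimates. -/
lemma abs_valueHat_le (hg : IsGood M p K πstar traj v ζ βZ cT) (hp : p.lamP = 1)
    (hr : p.lamR = H) (hH : 0 < H) (hbR : 0 ≤ p.betaR) (hbZ : 0 ≤ βZ) {k : ℕ} (hk : k < K)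
    (i : Fin p.m) {π : Fin H → X → A → ℝ} (hπ : IsPolicy π) (h : Fin (H + 1)) (x : X) :
    |valueHat p traj v ζ k i π h x| ≤
      H + p.betaR + βZ * √(2 * p.betaR ^ 2 + 2 * H ^ 2 * p.betaP ^ 2) := by
  have hH' : (0 : ℝ) < H := by exact_mod_cast hH
  have hr0 : 0 < p.lamR := by rw [hr]; exact hH'
  set e := epochStart p traj k with he
  have heK : e < K := (epochStart_le k).trans_lt hk
  set P := empKernel traj e with hP
  have hPs : IsSubKernel P := isSubKernel_empKernel e
  set o := occ P π h x with ho
  have hoo : o ⬝ᵥ o ≤ H := by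
    have : o ⬝ᵥ o = ∑ h', ∑ q : X × A, o (q, h') ^ 2 := by
      simp only [dotProduct, sq]; rw [Fintype.sum_prod_type_right]
    rw [this]
    refine (Finset.sum_le_sum fun h' _ => sum_occ_sq_le_one hPs hπ h x h').trans ?_
    simp
  -- The reason for λ_r = H: occupancy measures have inverse form at most one, whatever the data.
  have hinv : ∀ j, invForm (covAll p traj j) o o ≤ 1 := fun j => by
    refine (invForm_gram_le hr0 o j).trans ?_
    rw [hr, div_le_one hH']; exact hoo
  have h1 : |o ⬝ᵥ (thetaHat p traj v k - M.rewardVec)| ≤ p.betaR := by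
    refine (hg.reward k hk o).trans (mul_le_of_le_one_right hbR ?_)
    exact Real.sqrt_le_one.2 (hinv k)
  have h2 : |o ⬝ᵥ M.rewardVec| ≤ H := by
    rw [← evalV_eq_occ_dotProduct]
    have h1 := evalV_le_of_le (θ := M.rewardVec) hPs hπ zero_le_one
      (fun j => (M.r_mem _ _ _).2) h x
    have h2 := le_evalV_of_le (θ := M.rewardVec) hPs hπ zero_le_one
      (fun j => by
        have : 0 ≤ M.rewardVec j := (M.r_mem j.2 j.1.1 j.1.2).1
        linarith) h x
    rw [mul_one] at h1 h2
    exact abs_le.2 ⟨h2, h1⟩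
  have h3 : |o ⬝ᵥ ⇑(ζ e i)| ≤ βZ * √(2 * p.betaR ^ 2 + 2 * H ^ 2 * p.betaP ^ 2) := by
    refine (hg.noise e heK (epochStart_idem k) i o).trans ?_
    gcongr
    rw [covNoise_quadForm hp]
    have h4 : ∑ j, o j ^ 2 / (1 + visits traj e j.2 j.1) ≤ (H : ℝ) := by
      refine le_trans (Finset.sum_le_sum fun j _ => ?_) hoo
      rw [← sq]
      exact div_le_self (sq_nonneg _) (by linarith [visits_nonneg (traj := traj) e j.2 j.1])
    have h5 := hinv e
    have h6 : 2 * p.betaR ^ 2 * invForm (covAll p traj e) o o ≤ 2 * p.betaR ^ 2 * 1 := by gcongr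
    have h7 : 2 * H * p.betaP ^ 2 * ∑ j, o j ^ 2 / (1 + visits traj e j.2 j.1) ≤
        2 * H * p.betaP ^ 2 * H := by gcongr
    linarith
  rw [valueHat, evalV_eq_occ_dotProduct, rewardHat_eq (M := M), dotProduct_add, dotProduct_add]
  refine (abs_add_le _ _).trans ?_
  have := abs_add_le (o ⬝ᵥ (thetaHat p traj v k - M.rewardVec)) (o ⬝ᵥ M.rewardVec)
  linarith

/-- Optimism: the value of the comparator exceeds the estimate by at most the advantage term. -/
lemma value_sub_valueHat_le (hg : IsGood M p K πstar traj v ζ βZ cT) (hp : p.lamP = 1)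
    (hr : p.lamR = H) (hH : 0 < H) (hbR : 0 ≤ p.betaR) (hbP : 0 ≤ p.betaP)
    (hπs : IsPolicy πstar) {k : ℕ} (hk : k < K) (i : Fin p.m) (π : Fin H → X → A → ℝ)
    (hi : √(occ (empKernel traj (epochStart p traj k)) πstar 0 M.init ⬝ᵥ
      covNoise p traj (epochStart p traj k) *ᵥ
        occ (empKernel traj (epochStart p traj k)) πstar 0 M.init) ≤
      occ (empKernel traj (epochStart p traj k)) πstar 0 M.init ⬝ᵥ
        (ζ (epochStart p traj k) i)) :
    M.valueFun πstar 0 M.init - valueHat p traj v ζ k i π 0 M.init ≤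
      evalV (fun j => evalQ (rewardHat p traj v ζ k i)
          (kernelBackup (empKernel traj (epochStart p traj k))) π j.2 j.1.1 j.1.2 -
        ∑ b, π j.2 j.1.1 b * evalQ (rewardHat p traj v ζ k i)
          (kernelBackup (empKernel traj (epochStart p traj k))) π j.2 j.1.1 b)
        (kernelBackup (empKernel traj (epochStart p traj k))) πstar 0 M.init := by
  have hH' : (0 : ℝ) < H := by exact_mod_cast hH
  have hr0 : 0 < p.lamR := by rw [hr]; exact hH'
  set e := epochStart p traj k with he
  have heK : e < K := (epochStart_le k).trans_lt hk
  set P := empKernel traj e with hP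
  have hPs : IsSubKernel P := isSubKernel_empKernel e
  set o := occ P πstar 0 M.init with ho
  set adv : (X × A) × Fin H → ℝ := fun j => evalQ (rewardHat p traj v ζ k i)
    (kernelBackup P) π j.2 j.1.1 j.1.2 - ∑ b, π j.2 j.1.1 b *
      evalQ (rewardHat p traj v ζ k i) (kernelBackup P) π j.2 j.1.1 b with hadv
  set err : (X × A) × Fin H → ℝ := fun j =>
    kernelBackup P j.2 (M.valueFun πstar j.2.succ) j.1 -
      kernelBackup M.P j.2 (M.valueFun πstar j.2.succ) j.1 with herr
  -- Expanding along the empirical kernel makes the kernel error act on the comparator's true value,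
  -- a fixed function, and makes all errors linear in the one vector `o`.
  have hdiff := evalV_sub_evalV_of_policy (θ := rewardHat p traj v ζ k i) (θ' := M.rewardVec)
    (P := P) (P' := M.P) (π := π) hπs 0 M.init
  have hG : (fun j : (X × A) × Fin H => (rewardHat p traj v ζ k i j - M.rewardVec j) +
        (kernelBackup P j.2 (evalV M.rewardVec (kernelBackup M.P) πstar j.2.succ) j.1 -
          kernelBackup M.P j.2 (evalV M.rewardVec (kernelBackup M.P) πstar j.2.succ) j.1) +
        (∑ b, π j.2 j.1.1 b * evalQ (rewardHat p traj v ζ k i) (kernelBackup P) π j.2 j.1.1 b -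
          evalQ (rewardHat p traj v ζ k i) (kernelBackup P) π j.2 j.1.1 j.1.2)) =
      (thetaHat p traj v k - M.rewardVec) + ⇑(ζ e i) + err - adv := by
    funext j
    simp only [Pi.add_apply, Pi.sub_apply, hadv, herr, rewardHat, MDP.valueFun]
    ring
  rw [hG, evalV_eq_occ_dotProduct (θ := _ - adv), dotProduct_sub, dotProduct_add, dotProduct_add,
    ← ho] at hdiff
  rw [evalV_eq_occ_dotProduct (θ := adv), ← ho]
  set a := √(invForm (covAll p traj e) o o) with ha
  set b := √(∑ j, o j ^ 2 / (1 + visits traj e j.2 j.1)) with hb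
  have hb0 : 0 ≤ ∑ j, o j ^ 2 / (1 + visits traj e j.2 j.1) :=
    Finset.sum_nonneg fun j _ => div_nonneg (sq_nonneg _)
      (by linarith [visits_nonneg (traj := traj) e j.2 j.1])
  have h1 : -(p.betaR * a) ≤ o ⬝ᵥ (thetaHat p traj v k - M.rewardVec) := by
    have h2 := (abs_le.1 (hg.reward k hk o)).1
    -- The reward estimate uses all episodes before `k`, the perturbation only those before the
    -- epoch; more data shrink the form, so the older width dominates.
    have h3 : √(invForm (covAll p traj k) o o) ≤ a :=
      Real.sqrt_le_sqrt (invForm_gram_antitone (φ := fun τ => (traj τ).featAll) hr0 o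
        (epochStart_le k))
    have := mul_le_mul_of_nonneg_left h3 hbR
    linarith
  have h2 : -(√H * p.betaP * b) ≤ o ⬝ᵥ err := by
    -- Cauchy-Schwarz weighted by the regularized counts. The confidence bound holds at each step
    -- separately, so the sum over the steps contributes √H.
    have hcs : (∑ j, (o j / √(1 + visits traj e j.2 j.1)) *
        (√(1 + visits traj e j.2 j.1) * err j)) ^ 2 ≤ _ :=
      Finset.sum_mul_sq_le_sq_mul_sq Finset.univ _ _
    have e1 : ∑ j, (o j / √(1 + visits traj e j.2 j.1)) *
        (√(1 + visits traj e j.2 j.1) * err j) = o ⬝ᵥ err := by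
      refine Finset.sum_congr rfl fun j _ => ?_
      have : √(1 + visits traj e j.2 j.1) ≠ 0 :=
        (Real.sqrt_pos.2 (by linarith [visits_nonneg (traj := traj) e j.2 j.1])).ne'
      field_simp
    have e2 : ∑ j, (o j / √(1 + visits traj e j.2 j.1)) ^ 2 = b ^ 2 := by
      rw [hb, Real.sq_sqrt hb0]
      refine Finset.sum_congr rfl fun j _ => ?_
      rw [div_pow, Real.sq_sqrt (by linarith [visits_nonneg (traj := traj) e j.2 j.1])]
    have e3 : ∑ j, (√(1 + visits traj e j.2 j.1) * err j) ^ 2 ≤ H * p.betaP ^ 2 := by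
      rw [Fintype.sum_prod_type_right]
      calc _ ≤ ∑ _h : Fin H, p.betaP ^ 2 := Finset.sum_le_sum fun h _ => by
            refine le_trans (le_of_eq ?_) (hg.fixedValue e heK h)
            refine Finset.sum_congr rfl fun q _ => ?_
            rw [mul_pow, Real.sq_sqrt (by linarith [visits_nonneg (traj := traj) e h q])]
        _ = H * p.betaP ^ 2 := by simp
    rw [e1, e2] at hcs
    have hfin : (o ⬝ᵥ err) ^ 2 ≤ (√H * p.betaP * b) ^ 2 := by
      refine hcs.trans ?_
      rw [mul_pow, mul_pow, Real.sq_sqrt hH'.le, mul_comm]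
      exact mul_le_mul_of_nonneg_right e3 (sq_nonneg _)
    exact (abs_le.1 (abs_le_of_sq_le_sq hfin (by positivity))).1
  -- The factors 2 in the noise covariance come from (u + v)² ≤ 2u² + 2v²: one standard deviation
  -- covers the sum of both widths.
  have h3 : p.betaR * a + √H * p.betaP * b ≤ o ⬝ᵥ ⇑(ζ e i) := by
    refine le_trans (Real.le_sqrt_of_sq_le ?_) hi
    rw [covNoise_quadForm hp]
    have ea : a ^ 2 = invForm (covAll p traj e) o o :=
      Real.sq_sqrt (invForm_self_nonneg (posDef_gram hr0 e) o)
    have eb : b ^ 2 = ∑ j, o j ^ 2 / (1 + visits traj e j.2 j.1) := Real.sq_sqrt hb0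
    rw [← ea, ← eb]
    have es : √(H : ℝ) ^ 2 = H := Real.sq_sqrt hH'.le
    calc (p.betaR * a + √H * p.betaP * b) ^ 2 ≤
        2 * (p.betaR * a) ^ 2 + 2 * (√H * p.betaP * b) ^ 2 := by
          nlinarith [sq_nonneg (p.betaR * a - √H * p.betaP * b)]
      _ = 2 * p.betaR ^ 2 * a ^ 2 + 2 * (√(H : ℝ) ^ 2) * p.betaP ^ 2 * b ^ 2 := by ring
      _ = _ := by rw [es]
  change valueHat p traj v ζ k i π 0 M.init - M.valueFun πstar 0 M.init = _ at hdiff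
  linarith

end Deterministic

/-! ### Regret on the favourable event: exponential weights, bonuses and their sum. -/

section Regret

variable {X A : Type*} [Fintype X] [Fintype A] [DecidableEq X] [DecidableEq A] {H : ℕ}
  {p : Params} {traj : ℕ → Trajectory X A H} {v : ℕ → ℝ} {ζ : ℕ → Fin p.m → Noise X A H}
  {M : MDP X A H} {K : ℕ} {πstar : Fin H → X → A → ℝ} {βZ cT B : ℝ}

lemma initValueHat_eq (hp : p.lamP = 1) (x₁ : X) (k : ℕ) (i : Fin p.m) :
    initValueHat p x₁ traj v ζ k i =
      valueHat p traj v ζ k i (policy p traj v ζ k i) 0 x₁ := by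
  rw [initValueHat, psiHat_eq hp]; rfl

/-- The regret of the weights over the ensemble, against one member per epoch. -/
lemma sum_ensemble_gap_le (hm : 0 < p.m) (hB : 0 < B) (x₁ : X)
    (hV : ∀ k < K, ∀ i, |initValueHat p x₁ traj v ζ k i| ≤ B) (I : ℕ → Fin p.m) :
    p.etaX * ∑ k ∈ Finset.range K, (initValueHat p x₁ traj v ζ k (I (epochStart p traj k)) -
      ∑ j, weights p x₁ traj v ζ k j * initValueHat p x₁ traj v ζ k j) ≤
      Real.log p.m * epochCount p traj K + 2 * p.etaX ^ 2 * B ^ 2 * K := by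
  have hw := fun k => weights_pos_and_sum (x₁ := x₁) (traj := traj) (v := v) (ζ := ζ) hm k
  rw [Finset.mul_sum]
  refine sum_le_of_reset (p := p) (traj := traj)
    (Φ := fun k => Real.log (weights p x₁ traj v ζ k (I (epochStart p traj k))))
    (Ψ := fun k => Real.log (expUpdate p.etaX (weights p x₁ traj v ζ k)
      (initValueHat p x₁ traj v ζ k) (I (epochStart p traj k))))
    (fun k hk => expUpdate_gap_le (hw k).1 (hw k).2 hB (hV k hk) _)
    (fun k _ => Real.log_nonpos (expUpdate_pos (hw k).1 (hw k).2 _).le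
      (le_one_of_sum_eq_one (expUpdate_pos (hw k).1 (hw k).2) (sum_expUpdate (hw k).1 (hw k).2) _))
    (fun k hk => ?_) (fun k hk => ?_)
    (Real.log_nonpos ((hw K).1 _).le (le_one_of_sum_eq_one (hw K).1 (hw K).2 _))
  · simp only [weights_succ_of_ne hk, epochStart_succ_of_ne hk]
  · simp only [weights_of_start hk, one_div, Real.log_inv, le_refl]

/-- The advantage functional that bounds the suboptimality of the estimates. -/
def advantage (p : Params) (traj : ℕ → Trajectory X A H) (v : ℕ → ℝ)
    (ζ : ℕ → Fin p.m → Noise X A H) (k : ℕ) (i : Fin p.m) : (X × A) × Fin H → ℝ := fun j =>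
  evalQ (rewardHat p traj v ζ k i) (kernelBackup (empKernel traj (epochStart p traj k)))
      (policy p traj v ζ k i) j.2 j.1.1 j.1.2 -
    ∑ b, policy p traj v ζ k i j.2 j.1.1 b * evalQ (rewardHat p traj v ζ k i)
      (kernelBackup (empKernel traj (epochStart p traj k))) (policy p traj v ζ k i) j.2 j.1.1 b

/-- With a single action the tuned learning rate is zero and one cannot divide by it; there is also
nothing to learn. -/
lemma advantage_eq_zero (hA : Fintype.card A = 1) (k : ℕ) (i : Fin p.m) :
    advantage p traj v ζ k i = 0 := by
  obtain ⟨a₀, ha⟩ := Fintype.card_eq_one_iff.1 hA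
  have : Nonempty A := ⟨a₀⟩
  funext j
  have h1 := fun h x => (policy_pos_and_sum (p := p) (traj := traj) (v := v) (ζ := ζ) k i h x).2
  have hu : (Finset.univ : Finset A) = {a₀} := by ext a; simp [ha a]
  have h2 : policy p traj v ζ k i j.2 j.1.1 a₀ = 1 := by
    have := h1 j.2 j.1.1; rwa [hu, Finset.sum_singleton] at this
  simp only [advantage, hu, Finset.sum_singleton, h2, ha j.1.2, Pi.zero_apply]
  ring

/-- The regret of the policies of one member per epoch against the comparator. -/
lemma sum_advantage_le [Nonempty A] (hp : p.lamP = 1) (hB : 0 < B)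
    (hπs : IsPolicy πstar) (x₁ : X)
    (hQ : ∀ k < K, ∀ i h x a, |evalQ (rewardHat p traj v ζ k i)
      (kernelBackup (empKernel traj (epochStart p traj k))) (policy p traj v ζ k i) h x a| ≤ B)
    (I : ℕ → Fin p.m) :
    p.etaO * ∑ k ∈ Finset.range K, evalV (advantage p traj v ζ k (I (epochStart p traj k)))
      (kernelBackup (empKernel traj (epochStart p traj k))) πstar 0 x₁ ≤
      H * Real.log (Fintype.card A) * epochCount p traj K + H * (2 * p.etaO ^ 2 * B ^ 2) * K := by
  have hw := fun k i h x => policy_pos_and_sum (p := p) (traj := traj) (v := v) (ζ := ζ) k i h x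
  have hA1 : (1 : ℝ) ≤ Fintype.card A := by exact_mod_cast Fintype.card_pos
  have hsub := fun k => isSubKernel_empKernel (traj := traj) k
  set e := epochStart p traj with he
  -- The potential is the log-policy integrated against the comparator's occupancy measure under the
  -- kernel of the epoch. That measure is constant within an epoch, which lets the integrated
  -- increments telescope.
  set L : ℕ → (X × A) × Fin H → ℝ := fun k j =>
    Real.log (policy p traj v ζ k (I (e k)) j.2 j.1.1 j.1.2) with hL
  set L' : ℕ → (X × A) × Fin H → ℝ := fun k j =>
    Real.log (expUpdate p.etaO (policy p traj v ζ k (I (e k)) j.2 j.1.1)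
      (evalQ (rewardHat p traj v ζ k (I (e k))) (kernelBackup (empKernel traj (e k)))
        (policy p traj v ζ k (I (e k))) j.2 j.1.1) j.1.2) with hL'
  have hnonpos : ∀ k {θ : (X × A) × Fin H → ℝ}, (∀ j, θ j ≤ 0) →
      evalV θ (kernelBackup (empKernel traj (e k))) πstar 0 x₁ ≤ 0 := fun k θ hθ => by
    simpa using evalV_le_of_le (hsub (e k)) hπs le_rfl hθ 0 x₁
  rw [Finset.mul_sum]
  refine sum_le_of_reset (p := p) (traj := traj)
    (Φ := fun k => evalV (L k) (kernelBackup (empKernel traj (e k))) πstar 0 x₁)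
    (Ψ := fun k => evalV (L' k) (kernelBackup (empKernel traj (e k))) πstar 0 x₁)
    (fun k hk => ?_) (fun k _ => hnonpos k fun j => ?_)
    (fun k hk => ?_) (fun k hk => ?_) (hnonpos K fun j => ?_)
  · set Lin := evalVLin (empKernel traj (e k)) πstar 0 x₁ with hLin
    have h1 : Lin (p.etaO • advantage p traj v ζ k (I (e k)) - (L' k - L k)) ≤
        H * (2 * p.etaO ^ 2 * B ^ 2) := by
      refine evalV_le_of_le (hsub (e k)) hπs (by positivity) (fun j => ?_) 0 x₁
      have := expUpdate_gap_le (η := p.etaO) (hw k (I (e k)) j.2 j.1.1).1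
        (hw k (I (e k)) j.2 j.1.1).2 hB (fun a => hQ k hk (I (e k)) j.2 j.1.1 a) j.1.2
      simp only [Pi.sub_apply, Pi.smul_apply, smul_eq_mul, hL, hL', advantage]
      linarith
    rw [map_sub, map_sub, map_smul, smul_eq_mul] at h1
    change p.etaO * Lin (advantage p traj v ζ k (I (e k))) ≤ Lin (L' k) - Lin (L k) + _
    linarith
  · exact Real.log_nonpos (expUpdate_pos (hw _ _ _ _).1 (hw _ _ _ _).2 _).le
      (le_one_of_sum_eq_one (expUpdate_pos (hw _ _ _ _).1 (hw _ _ _ _).2)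
        (sum_expUpdate (hw _ _ _ _).1 (hw _ _ _ _).2) _)
  · have h1 : e (k + 1) = e k := epochStart_succ_of_ne hk
    have h2 : L' k = L (k + 1) := by
      funext j
      simp only [hL, hL', h1]
      rw [policy_succ_of_ne hk, psiHat_eq hp]
    simp only [h1, h2]
  · have h1 : ∀ j, -Real.log (Fintype.card A) ≤ L k j := fun j => by
      simp only [hL]
      rw [policy_of_start hk]
      simp
    exact le_evalV_of_le (hsub (e k)) hπs (Real.log_nonneg hA1) h1 0 x₁
  · exact Real.log_nonpos ((hw _ _ _ _).1 _).le (le_one_of_sum_eq_one (hw _ _ _ _).1 (hw _ _ _ _).2 _)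

/-- The exploration bonus of a trajectory in episode `k`. -/
def bonus (p : Params) (traj : ℕ → Trajectory X A H) (βZ c : ℝ) (k : ℕ)
    (τ : Trajectory X A H) : ℝ :=
  p.betaR * √(invForm (covAll p traj k) τ.featAll τ.featAll) +
    βZ * √(τ.featAll ⬝ᵥ covNoise p traj (epochStart p traj k) *ᵥ τ.featAll) +
    c * ∑ h, 1 / √(1 + visits traj (epochStart p traj k) h (τ.pair h))

/-- The bias of the value estimates is at most the expected bonus. -/
lemma valueHat_sub_value_le (hg : IsGood M p K πstar traj v ζ βZ cT)
    {k : ℕ} (hk : k < K) (i : Fin p.m)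
    {π : Fin H → X → A → ℝ} (hπ : IsPolicy π)
    (hV : ∀ h x, |valueHat p traj v ζ k i π h x| ≤ B) :
    valueHat p traj v ζ k i π 0 M.init - value M π ≤
      ∑ τ, trajProb M π τ * bonus p traj βZ (B * cT) k τ := by
  set e := epochStart p traj k with he
  have heK : e < K := (epochStart_le k).trans_lt hk
  set P := empKernel traj e with hP
  rw [value_eq hπ]
  have hdiff := evalV_sub_evalV_of_kernel (θ := rewardHat p traj v ζ k i) (θ' := M.rewardVec)
    (P := P) (P' := M.P) (π := π) 0 M.init
  rw [← sum_trajProb_mul_sum hπ (M := M) (g := fun j => _ + _)] at hdiff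
  change valueHat p traj v ζ k i π 0 M.init - evalV M.rewardVec _ _ _ _ = _ at hdiff
  change valueHat p traj v ζ k i π 0 M.init - evalV M.rewardVec _ _ _ _ ≤ _
  rw [hdiff]
  refine Finset.sum_le_sum fun τ _ => mul_le_mul_of_nonneg_left ?_ (trajProb_nonneg hπ τ)
  rw [Finset.sum_add_distrib]
  have h1 : ∑ h, (rewardHat p traj v ζ k i ((τ.state h, τ.action h), h) -
      M.rewardVec ((τ.state h, τ.action h), h)) =
      τ.featAll ⬝ᵥ (thetaHat p traj v k - M.rewardVec) + τ.featAll ⬝ᵥ ⇑(ζ e i) := by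
    rw [← dotProduct_add, Trajectory.featAll_dotProduct]
    refine Finset.sum_congr rfl fun h _ => ?_
    simp only [rewardHat, Pi.add_apply, Pi.sub_apply, Trajectory.pair]
    ring
  have h2 := (le_abs_self _).trans (hg.reward k hk τ.featAll)
  have h3 := (le_abs_self _).trans (hg.noise e heK (epochStart_idem k) i τ.featAll)
  have h4 : ∑ h, (kernelBackup P h (evalV (rewardHat p traj v ζ k i) (kernelBackup P) π h.succ)
        (τ.state h, τ.action h) - kernelBackup M.P h
        (evalV (rewardHat p traj v ζ k i) (kernelBackup P) π h.succ) (τ.state h, τ.action h)) ≤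
      B * cT * ∑ h, 1 / √(1 + visits traj e h (τ.pair h)) := by
    rw [Finset.mul_sum]
    exact Finset.sum_le_sum fun h _ => (le_abs_self _).trans
      (hg.kernel e heK h (τ.pair h) _ B fun x => hV h.succ x)
  simp only [h1, bonus]
  linarith

/-- The sum of the realized bonuses. -/
lemma sum_bonus_le (hp : p.lamP = 1) (hr : p.lamR = H) (hH : 0 < H) (hbR : 0 ≤ p.betaR)
    (hbP : 0 ≤ p.betaP) (hbZ : 0 ≤ βZ) {c : ℝ} (hc : 0 ≤ c) :
    ∑ k ∈ Finset.range K, bonus p traj βZ c k (traj k) ≤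
      (p.betaR + 2 * βZ * p.betaR) *
        √(K * (2 * (Fintype.card X * Fintype.card A * H * Real.log (1 + K)))) +
      (c + βZ * √(2 * H) * p.betaP) *
        (2 * √2 * H * √(Fintype.card X * Fintype.card A * K)) := by
  have hH' : (0 : ℝ) < H := by exact_mod_cast hH
  have hr0 : 0 < p.lamR := by rw [hr]; exact hH'
  set w : ℕ → ℝ := fun k => √(invForm (covAll p traj k) (traj k).featAll (traj k).featAll) with hw
  set N : ℕ → ℝ := fun k =>
    ∑ h, 1 / √(1 + visits traj (epochStart p traj k) h ((traj k).pair h)) with hN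
  have hv : ∀ k h q, 0 < 1 + visits traj k h q := fun k h q => by
    linarith [visits_nonneg (traj := traj) k h q]
  have hN0 : ∀ k, 0 ≤ N k := fun k => Finset.sum_nonneg fun h _ => by positivity
  have hb : ∀ k, bonus p traj βZ c k (traj k) ≤ (p.betaR + 2 * βZ * p.betaR) * w k +
      (c + βZ * √(2 * H) * p.betaP) * N k := by
    intro k
    set e := epochStart p traj k with he
    have h1 : ∑ j, (traj k).featAll j ^ 2 / (1 + visits traj e j.2 j.1) =
        ∑ h, 1 / (1 + visits traj e h ((traj k).pair h)) := by
      rw [← Trajectory.featAll_dotProduct (traj k) fun j => 1 / (1 + visits traj e j.2 j.1)]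
      refine Finset.sum_congr rfl fun j _ => ?_
      have : (traj k).featAll j ^ 2 = (traj k).featAll j := by
        simp only [Trajectory.featAll, Trajectory.feat_apply]; split_ifs <;> norm_num
      rw [this, mul_one_div]
    -- Passing from squares to the square of the sum lets the noise width share the visit sum of the
    -- transition bonus.
    have h2 : ∑ h, 1 / (1 + visits traj e h ((traj k).pair h)) ≤ N k ^ 2 := by
      calc _ = ∑ h, (1 / √(1 + visits traj e h ((traj k).pair h))) ^ 2 :=
            Finset.sum_congr rfl fun h _ => by
              rw [div_pow, one_pow, Real.sq_sqrt (hv _ _ _).le]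
        _ ≤ N k ^ 2 := Finset.sum_sq_le_sq_sum_of_nonneg fun h _ => by positivity
    have h3 : invForm (covAll p traj e) (traj k).featAll (traj k).featAll ≤ 2 * w k ^ 2 := by
      have hw2 : w k ^ 2 = invForm (covAll p traj k) (traj k).featAll (traj k).featAll :=
        Real.sq_sqrt (invForm_self_nonneg (posDef_gram hr0 k) _)
      rw [hw2]
      exact invForm_covAll_epochStart_le hp hr0 k _
    have h4 : √((traj k).featAll ⬝ᵥ covNoise p traj e *ᵥ (traj k).featAll) ≤
        2 * p.betaR * w k + √(2 * H) * p.betaP * N k := by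
      have hw0 : 0 ≤ w k := Real.sqrt_nonneg _
      have hN0' := hN0 k
      apply Real.sqrt_le_iff.2 ⟨by positivity, ?_⟩
      rw [covNoise_quadForm hp, h1]
      have es : √(2 * (H : ℝ)) ^ 2 = 2 * H := Real.sq_sqrt (by positivity)
      have h5 : 2 * p.betaR ^ 2 * invForm (covAll p traj e) (traj k).featAll (traj k).featAll ≤
          2 * p.betaR ^ 2 * (2 * w k ^ 2) := by gcongr
      have h6 : 2 * H * p.betaP ^ 2 * ∑ h, 1 / (1 + visits traj e h ((traj k).pair h)) ≤
          2 * H * p.betaP ^ 2 * N k ^ 2 := by gcongr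
      have h7 : 0 ≤ 2 * p.betaR * w k * (√(2 * H) * p.betaP * N k) := by positivity
      calc _ ≤ 2 * p.betaR ^ 2 * (2 * w k ^ 2) + 2 * H * p.betaP ^ 2 * N k ^ 2 := add_le_add h5 h6
        _ = (2 * p.betaR * w k) ^ 2 + √(2 * (H : ℝ)) ^ 2 * p.betaP ^ 2 * N k ^ 2 := by rw [es]; ring
        _ ≤ (2 * p.betaR * w k + √(2 * H) * p.betaP * N k) ^ 2 := by nlinarith
    have h8 := mul_le_mul_of_nonneg_left h4 hbZ
    simp only [bonus, ← he]
    have h9 : p.betaR * √(invForm (covAll p traj k) (traj k).featAll (traj k).featAll) =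
      p.betaR * w k := rfl
    have h10 : c * ∑ h, 1 / √(1 + visits traj e h ((traj k).pair h)) = c * N k := rfl
    rw [h9, h10]
    linarith
  have hNsum : ∑ k ∈ Finset.range K, N k ≤
      2 * √2 * H * √(Fintype.card X * Fintype.card A * K) := by
    calc ∑ k ∈ Finset.range K, N k ≤ ∑ k ∈ Finset.range K,
          ∑ h, √2 * (1 / √(1 + visits traj k h ((traj k).pair h))) := by
          refine Finset.sum_le_sum fun k _ => Finset.sum_le_sum fun h _ => ?_
          have h1 := one_add_visits_le (traj := traj) hp hr0 k h ((traj k).pair h)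
          have h2 := Real.sqrt_le_sqrt h1
          rw [Real.sqrt_mul (by norm_num)] at h2
          have h3 := Real.sqrt_pos.2 (hv k h ((traj k).pair h))
          have h4 := Real.sqrt_pos.2 (hv (epochStart p traj k) h ((traj k).pair h))
          rw [mul_one_div, div_le_div_iff₀ h4 h3, one_mul]
          exact h2
      _ = ∑ h : Fin H, √2 * ∑ k ∈ Finset.range K,
          1 / √(1 + visits traj k h ((traj k).pair h)) := by
          rw [Finset.sum_comm]; simp only [Finset.mul_sum]
      _ ≤ ∑ _h : Fin H, √2 * (2 * √(Fintype.card X * Fintype.card A * K)) := by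
          refine Finset.sum_le_sum fun h _ => ?_
          gcongr
          exact sum_inv_sqrt_visits_le h K
      _ = _ := by simp; ring
  calc ∑ k ∈ Finset.range K, bonus p traj βZ c k (traj k) ≤
      ∑ k ∈ Finset.range K, ((p.betaR + 2 * βZ * p.betaR) * w k +
        (c + βZ * √(2 * H) * p.betaP) * N k) := Finset.sum_le_sum fun k _ => hb k
    _ = (p.betaR + 2 * βZ * p.betaR) * ∑ k ∈ Finset.range K, w k +
        (c + βZ * √(2 * H) * p.betaP) * ∑ k ∈ Finset.range K, N k := by
        rw [Finset.sum_add_distrib, Finset.mul_sum, Finset.mul_sum]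
    _ ≤ _ := by
        gcongr
        exact sum_sqrt_invForm_le hr hH K

lemma bonus_nonneg (hbR : 0 ≤ p.betaR) (hbZ : 0 ≤ βZ) {c : ℝ} (hc : 0 ≤ c) (k : ℕ)
    (τ : Trajectory X A H) : 0 ≤ bonus p traj βZ c k τ := by
  unfold bonus; positivity

lemma bonus_le (hp : p.lamP = 1) (hr : p.lamR = H) (hH : 0 < H) (hbR : 0 ≤ p.betaR)
    (hbZ : 0 ≤ βZ) {c : ℝ} (hc : 0 ≤ c) (k : ℕ) (τ : Trajectory X A H) :
    bonus p traj βZ c k τ ≤ p.betaR +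
      βZ * √(2 * p.betaR ^ 2 + 2 * H ^ 2 * p.betaP ^ 2) + c * H := by
  have hH' : (0 : ℝ) < H := by exact_mod_cast hH
  have hr0 : 0 < p.lamR := by rw [hr]; exact hH'
  have hinv : ∀ j, invForm (covAll p traj j) τ.featAll τ.featAll ≤ 1 := fun j => by
    refine (invForm_gram_le hr0 _ j).trans ?_
    rw [hr, Trajectory.featAll_dotProduct_self, div_self hH'.ne']
  set e := epochStart p traj k with he
  unfold bonus
  have h1 : p.betaR * √(invForm (covAll p traj k) τ.featAll τ.featAll) ≤ p.betaR :=
    mul_le_of_le_one_right hbR (Real.sqrt_le_one.2 (hinv k))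
  have h2 : ∑ h, 1 / √(1 + visits traj e h (τ.pair h)) ≤ H := by
    calc _ ≤ ∑ _h : Fin H, (1 : ℝ) := Finset.sum_le_sum fun h _ => by
          rw [div_le_one (Real.sqrt_pos.2 (by linarith [visits_nonneg (traj := traj) e h (τ.pair h)]))]
          exact Real.one_le_sqrt.2 (by linarith [visits_nonneg (traj := traj) e h (τ.pair h)])
      _ = H := by simp
  have h3 : τ.featAll ⬝ᵥ covNoise p traj e *ᵥ τ.featAll ≤
      2 * p.betaR ^ 2 + 2 * H ^ 2 * p.betaP ^ 2 := by
    rw [covNoise_quadForm hp]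
    have h4 : ∑ j, τ.featAll j ^ 2 / (1 + visits traj e j.2 j.1) ≤ (H : ℝ) := by
      refine le_trans (Finset.sum_le_sum fun j _ => ?_) (Trajectory.featAll_dotProduct_self τ).le
      rw [← sq]
      exact div_le_self (sq_nonneg _) (by linarith [visits_nonneg (traj := traj) e j.2 j.1])
    have h6 : 2 * p.betaR ^ 2 * invForm (covAll p traj e) τ.featAll τ.featAll ≤
        2 * p.betaR ^ 2 * 1 := by gcongr; exact hinv e
    have h7 : 2 * H * p.betaP ^ 2 * ∑ j, τ.featAll j ^ 2 / (1 + visits traj e j.2 j.1) ≤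
        2 * H * p.betaP ^ 2 * H := by gcongr
    linarith
  have h5 := mul_le_mul_of_nonneg_left (Real.sqrt_le_sqrt h3) hbZ
  have h6 := mul_le_mul_of_nonneg_left h2 hc
  linarith

/-- The deterministic regret bound on the favourable event. -/
lemma sum_regret_le [Nonempty A] (hg : IsGood M p K πstar traj v ζ βZ cT) (hp : p.lamP = 1)
    (hr : p.lamR = H) (hH : 0 < H) (hm : 0 < p.m) (hbR : 0 ≤ p.betaR) (hbP : 0 ≤ p.betaP)
    (hbZ : 0 ≤ βZ) (hcT : 0 ≤ cT) (hπs : IsPolicy πstar) (hB : 0 < B)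
    (hBle : H + p.betaR + βZ * √(2 * p.betaR ^ 2 + 2 * H ^ 2 * p.betaP ^ 2) ≤ B)
    (hηx : 0 < p.etaX) (hηo : Fintype.card A ≠ 1 → 0 < p.etaO) (hηo0 : 0 ≤ p.etaO)
    (idx : ℕ → Fin p.m) {C₁ C₂ : ℝ}
    (h1 : ∑ k ∈ Finset.range K, (∑ j, weights p M.init traj v ζ k j *
      max (-B) (min B (initValueHat p M.init traj v ζ k j)) -
        max (-B) (min B (initValueHat p M.init traj v ζ k (idx k)))) ≤ C₁)
    (h2 : ∑ k ∈ Finset.range K, (∑ τ, trajProb M (policy p traj v ζ k (idx k)) τ *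
      bonus p traj βZ (B * cT) k τ - bonus p traj βZ (B * cT) k (traj k)) ≤ C₂) :
    ∑ k ∈ Finset.range K, (value M πstar - value M (policy p traj v ζ k (idx k))) ≤
      H * (Real.log (Fintype.card A) * epochCount p traj K / p.etaO + 2 * p.etaO * B ^ 2 * K) +
      (Real.log p.m * epochCount p traj K / p.etaX + 2 * p.etaX * B ^ 2 * K) + C₁ + C₂ +
      ((p.betaR + 2 * βZ * p.betaR) *
        √(K * (2 * (Fintype.card X * Fintype.card A * H * Real.log (1 + K)))) +
      (B * cT + βZ * √(2 * H) * p.betaP) *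
        (2 * √2 * H * √(Fintype.card X * Fintype.card A * K))) := by
  have hV : ∀ k < K, ∀ i (π : Fin H → X → A → ℝ), IsPolicy π → ∀ h x,
      |valueHat p traj v ζ k i π h x| ≤ B := fun k hk i π hπ h x =>
    (abs_valueHat_le hg hp hr hH hbR hbZ hk i hπ h x).trans hBle
  have hVi : ∀ k < K, ∀ i, |initValueHat p M.init traj v ζ k i| ≤ B := fun k hk i => by
    rw [initValueHat_eq hp]; exact hV k hk i _ (isPolicy_policy k i) _ _
  have hQ : ∀ k < K, ∀ i h x a, |evalQ (rewardHat p traj v ζ k i)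
      (kernelBackup (empKernel traj (epochStart p traj k)))
        (policy p traj v ζ k i) h x a| ≤ B := fun k hk i h x a => by
    obtain ⟨π', hπ', hQ'⟩ := exists_evalQ_eq_evalV
      (P := empKernel traj (epochStart p traj k)) (isPolicy_policy (p := p) (traj := traj) (v := v)
      (ζ := ζ) k i) h x a
    rw [hQ']; exact hV k hk i π' hπ' _ _
  -- The clipping in the index martingale belongs to the analysis only and is void on the favourable
  -- event.
  have hclip : ∀ k < K, ∀ i, max (-B) (min B (initValueHat p M.init traj v ζ k i)) =
      initValueHat p M.init traj v ζ k i := fun k hk i => by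
    have := abs_le.1 (hVi k hk i)
    rw [min_eq_right this.2, max_eq_right this.1]
  have h1' : ∑ k ∈ Finset.range K, (∑ j, weights p M.init traj v ζ k j *
      initValueHat p M.init traj v ζ k j - initValueHat p M.init traj v ζ k (idx k)) ≤ C₁ := by
    refine le_trans (le_of_eq (Finset.sum_congr rfl fun k hk => ?_)) h1
    have hk' := Finset.mem_range.1 hk
    simp only [hclip k hk']
  have : ∃ I : ℕ → Fin p.m, ∀ k < K, epochStart p traj k = k →
      √(occ (empKernel traj k) πstar 0 M.init ⬝ᵥ
      covNoise p traj k *ᵥ occ (empKernel traj k) πstar 0 M.init) ≤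
      occ (empKernel traj k) πstar 0 M.init ⬝ᵥ (ζ k (I k)) := by
    have : ∀ k, ∃ i : Fin p.m, k < K → epochStart p traj k = k →
        √(occ (empKernel traj k) πstar 0 M.init ⬝ᵥ
        covNoise p traj k *ᵥ occ (empKernel traj k) πstar 0 M.init) ≤
        occ (empKernel traj k) πstar 0 M.init ⬝ᵥ (ζ k i) := fun k => by
      by_cases hk : k < K ∧ epochStart p traj k = k
      · obtain ⟨i, hi⟩ := hg.optimism k hk.1 hk.2
        exact ⟨i, fun _ _ => hi⟩
      · exact ⟨⟨0, hm⟩, fun h1 h2 => absurd ⟨h1, h2⟩ hk⟩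
    choose I hI using this
    exact ⟨I, hI⟩
  obtain ⟨I, hI⟩ := this
  have hopt : ∀ k < K, value M πstar - initValueHat p M.init traj v ζ k (I (epochStart p traj k)) ≤
      evalV (advantage p traj v ζ k (I (epochStart p traj k)))
        (kernelBackup (empKernel traj (epochStart p traj k))) πstar 0 M.init := fun k hk => by
    rw [value_eq hπs, initValueHat_eq hp]
    exact value_sub_valueHat_le hg hp hr hH hbR hbP hπs hk _ _
      (hI _ ((epochStart_le k).trans_lt hk) (epochStart_idem k))
  have hbias : ∀ k < K, initValueHat p M.init traj v ζ k (idx k) -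
      value M (policy p traj v ζ k (idx k)) ≤
      ∑ τ, trajProb M (policy p traj v ζ k (idx k)) τ * bonus p traj βZ (B * cT) k τ :=
    fun k hk => by
    rw [initValueHat_eq hp]
    exact valueHat_sub_value_le hg hk _ (isPolicy_policy k _)
      fun h x => hV k hk _ _ (isPolicy_policy k _) h x
  have hadv : ∑ k ∈ Finset.range K, evalV (advantage p traj v ζ k (I (epochStart p traj k)))
      (kernelBackup (empKernel traj (epochStart p traj k))) πstar 0 M.init ≤
      H * (Real.log (Fintype.card A) * epochCount p traj K / p.etaO +
        2 * p.etaO * B ^ 2 * K) := by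
    -- For one action both sides of the division have logarithm zero, and the advantage vanishes
    -- identically.
    by_cases hA : Fintype.card A = 1
    · have h0 : ∀ k, evalV (advantage p traj v ζ k (I (epochStart p traj k)))
          (kernelBackup (empKernel traj (epochStart p traj k))) πstar 0 M.init = 0 := fun k => by
        rw [advantage_eq_zero hA]
        exact map_zero (evalVLin (empKernel traj (epochStart p traj k)) πstar 0 M.init)
      simp only [h0, Finset.sum_const_zero, hA, Nat.cast_one, Real.log_one, zero_mul, zero_div]
      positivity
    · have hη := hηo hA
      have := sum_advantage_le (K := K) hp hB hπs M.init hQ I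
      rw [← le_div_iff₀' hη] at this
      refine this.trans (le_of_eq ?_)
      field_simp
  have hens : ∑ k ∈ Finset.range K,
      (initValueHat p M.init traj v ζ k (I (epochStart p traj k)) -
      ∑ j, weights p M.init traj v ζ k j * initValueHat p M.init traj v ζ k j) ≤
      Real.log p.m * epochCount p traj K / p.etaX + 2 * p.etaX * B ^ 2 * K := by
    have := sum_ensemble_gap_le hm hB M.init hVi I
    rw [← le_div_iff₀' hηx] at this
    refine this.trans (le_of_eq ?_)
    field_simp
  have hbon := sum_bonus_le (K := K) (traj := traj) hp hr hH hbR hbP hbZ (mul_nonneg hB.le hcT)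
  have hsplit : ∑ k ∈ Finset.range K, (value M πstar - value M (policy p traj v ζ k (idx k))) ≤
      ∑ k ∈ Finset.range K, (evalV (advantage p traj v ζ k (I (epochStart p traj k)))
        (kernelBackup (empKernel traj (epochStart p traj k))) πstar 0 M.init +
      (initValueHat p M.init traj v ζ k (I (epochStart p traj k)) -
      ∑ j, weights p M.init traj v ζ k j * initValueHat p M.init traj v ζ k j) +
      (∑ j, weights p M.init traj v ζ k j *
      initValueHat p M.init traj v ζ k j - initValueHat p M.init traj v ζ k (idx k)) +
      (∑ τ, trajProb M (policy p traj v ζ k (idx k)) τ *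
      bonus p traj βZ (B * cT) k τ - bonus p traj βZ (B * cT) k (traj k)) +
      bonus p traj βZ (B * cT) k (traj k)) := by
    refine Finset.sum_le_sum fun k hk => ?_
    have hk' := Finset.mem_range.1 hk
    have := hopt k hk'
    have := hbias k hk'
    linarith
  simp only [Finset.sum_add_distrib] at hsplit
  linarith

end Regret

/-! ### Gaussian perturbations -/

section Gaussian

lemma gaussianReal_le_of_pdf_le {a b c : ℝ} (ha : 0 ≤ a) (hab : a ≤ b)
    (hc : (√(2 * Real.pi))⁻¹ * Real.exp (-a ^ 2 / 2) ≤ c) :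
    (gaussianReal 0 1).real (Set.Ico a b) ≤ c * (b - a) := by
  have h1 : gaussianReal 0 1 (Set.Ico a b) ≤ ENNReal.ofReal c * ENNReal.ofReal (b - a) := by
    rw [gaussianReal_apply _ one_ne_zero, ← Real.volume_Ico, ← setLIntegral_const]
    refine setLIntegral_mono measurable_const fun x hx => ?_
    rw [gaussianPDF]
    apply ENNReal.ofReal_le_ofReal
    refine le_trans ?_ hc
    simp only [gaussianPDFReal, NNReal.coe_one, mul_one, sub_zero]
    gcongr
    exact hx.1
  have hc0 : 0 ≤ c := le_trans (by positivity) hc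
  rw [Measure.real, ← ENNReal.toReal_ofReal (mul_nonneg hc0 (sub_nonneg.2 hab)),
    ENNReal.ofReal_mul hc0]
  exact ENNReal.toReal_mono (ENNReal.mul_ne_top ENNReal.ofReal_ne_top ENNReal.ofReal_ne_top) h1

/-- The half line [0, ∞) has mass at least 1/2; bounding the density on [0, 1/2) and [1/2, 1) by its
left endpoint values removes at most 0.2 and 8/45. -/
lemma one_ninth_le_gaussianReal : 1 / 9 ≤ (gaussianReal 0 1).real (Set.Ici 1) := by
  set γ := gaussianReal 0 1 with hγ
  have hneg : γ.real (Set.Iio 0) = γ.real (Set.Ioi 0) := by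
    have h := gaussianReal_map_neg (μ := 0) (v := 1)
    rw [neg_zero] at h
    conv_lhs => rw [hγ, ← h, map_measureReal_apply measurable_neg measurableSet_Iio]
    congr 1
    ext x; simp
  have htot : γ.real (Set.Iio 0) + γ.real (Set.Ici 0) = 1 := by
    have hd : Disjoint (Set.Iio (0 : ℝ)) (Set.Ici 0) := Set.Iio_disjoint_Ici le_rfl
    rw [← measureReal_union hd measurableSet_Ici,
      Set.Iio_union_Ici, probReal_univ]
  have hle : γ.real (Set.Ioi 0) ≤ γ.real (Set.Ici 0) := measureReal_mono Set.Ioi_subset_Ici_self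
  have hsplit : γ.real (Set.Ici 0) ≤
      γ.real (Set.Ico 0 (1 / 2)) + γ.real (Set.Ico (1 / 2) 1) + γ.real (Set.Ici 1) := by
    refine le_trans (measureReal_mono (s₂ := (Set.Ico 0 (1 / 2) ∪ Set.Ico (1 / 2) 1) ∪ Set.Ici 1) ?_)
      ((measureReal_union_le _ _).trans (add_le_add_left (measureReal_union_le _ _) _))
    intro x hx
    simp only [Set.mem_union, Set.mem_Ico, Set.mem_Ici] at hx ⊢
    by_cases h1 : x < 1 / 2
    · exact Or.inl (Or.inl ⟨hx, h1⟩)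
    · by_cases h2 : x < 1
      · exact Or.inl (Or.inr ⟨not_lt.1 h1, h2⟩)
      · exact Or.inr (not_lt.1 h2)
  have hs : (2.5 : ℝ) ≤ √(2 * Real.pi) := by
    apply Real.le_sqrt_of_sq_le
    nlinarith [Real.pi_gt_d2]
  have hs' : (√(2 * Real.pi))⁻¹ ≤ 0.4 := by
    rw [inv_le_comm₀ (by positivity) (by norm_num)]
    exact (by norm_num : (0.4 : ℝ)⁻¹ ≤ 2.5).trans hs
  have he : Real.exp (-(1 / 2 : ℝ) ^ 2 / 2) ≤ 8 / 9 := by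
    have h1 := Real.add_one_le_exp (1 / 8 : ℝ)
    rw [show -(1 / 2 : ℝ) ^ 2 / 2 = -(1 / 8) by norm_num, Real.exp_neg,
      inv_le_comm₀ (Real.exp_pos _) (by norm_num)]
    linarith
  have h1 : γ.real (Set.Ico 0 (1 / 2)) ≤ 0.4 * (1 / 2 - 0) :=
    gaussianReal_le_of_pdf_le le_rfl (by norm_num) (by simpa using hs')
  have h2 : γ.real (Set.Ico (1 / 2) 1) ≤ (0.4 * (8 / 9)) * (1 - 1 / 2) :=
    gaussianReal_le_of_pdf_le (by norm_num) (by norm_num)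
      (mul_le_mul hs' he (Real.exp_pos _).le (by norm_num))
  linarith

lemma one_ninth_le_gaussianReal_sqrt (v : NNReal) :
    1 / 9 ≤ (gaussianReal 0 v).real (Set.Ici √(v : ℝ)) := by
  have h := gaussianReal_map_const_mul (μ := 0) (v := 1) √(v : ℝ)
  have hv : (NNReal.mk (√(v : ℝ) ^ 2) (sq_nonneg _) * 1 : NNReal) = v := by
    rw [mul_one]; ext; exact Real.sq_sqrt v.2
  rw [mul_zero, hv] at h
  rw [← h, map_measureReal_apply (measurable_const_mul _) measurableSet_Ici]
  refine one_ninth_le_gaussianReal.trans (measureReal_mono fun x hx => ?_)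
  simp only [Set.mem_preimage, Set.mem_Ici] at hx ⊢
  exact le_mul_of_one_le_right (Real.sqrt_nonneg _) hx

variable {ι : Type*} [Fintype ι] [DecidableEq ι]

/-- The exponential moment used in the Chernoff bound for the squared norm; the exponent 1/4 keeps
the integral finite and makes it √2. -/
lemma integral_exp_sq_div_four :
    ∫ x, Real.exp (x ^ 2 / 4) ∂(gaussianReal 0 1) = √2 := by
  rw [integral_gaussianReal_eq_integral_smul one_ne_zero]
  have h : ∀ x : ℝ, gaussianPDFReal 0 1 x • Real.exp (x ^ 2 / 4) =
      (√(2 * Real.pi))⁻¹ * Real.exp (-(1 / 4) * x ^ 2) := fun x => by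
    simp only [gaussianPDFReal, NNReal.coe_one, mul_one, sub_zero, smul_eq_mul]
    rw [mul_assoc, ← Real.exp_add]; ring_nf
  simp only [h]
  rw [integral_const_mul, integral_gaussian, ← Real.sqrt_inv, ← Real.sqrt_mul (by positivity)]
  congr 1
  field_simp
  norm_num

lemma integrable_exp_sq_div_four :
    Integrable (fun x => Real.exp (x ^ 2 / 4)) (gaussianReal 0 1) := by
  by_contra h
  have := integral_undef h
  rw [integral_exp_sq_div_four] at this
  exact absurd this (by positivity)

lemma stdGaussian_norm_tail (t : ℝ) :
    (stdGaussian (EuclideanSpace ℝ ι)) {g | t ≤ ‖g‖ ^ 2} ≤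
      ENNReal.ofReal (√2 ^ Fintype.card ι * Real.exp (-(t / 4))) := by
  have hmeas : MeasurableSet {g : EuclideanSpace ℝ ι | t ≤ ‖g‖ ^ 2} :=
    measurableSet_le measurable_const (by fun_prop)
  rw [← map_pi_eq_stdGaussian, Measure.map_apply (by fun_prop) hmeas]
  have hF : Integrable (fun x : ι → ℝ => ∏ i, Real.exp (x i ^ 2 / 4))
      (Measure.pi fun _ => gaussianReal 0 1) :=
    Integrable.fintype_prod fun _ => integrable_exp_sq_div_four
  have hI : ∫ x : ι → ℝ, ∏ i, Real.exp (x i ^ 2 / 4) ∂(Measure.pi fun _ => gaussianReal 0 1) =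
      √2 ^ Fintype.card ι := by
    rw [integral_fintype_prod_eq_prod (f := fun _ x => Real.exp (x ^ 2 / 4))]
    simp [integral_exp_sq_div_four]
  have hM := mul_meas_ge_le_integral_of_nonneg (Filter.Eventually.of_forall fun x =>
    Finset.prod_nonneg fun i _ => (Real.exp_pos _).le) hF (Real.exp (t / 4))
  rw [hI] at hM
  rw [← ENNReal.ofReal_toReal (measure_ne_top _ (WithLp.toLp 2 ⁻¹' _))]
  apply ENNReal.ofReal_le_ofReal
  rw [Real.exp_neg, ← div_eq_mul_inv, le_div_iff₀' (Real.exp_pos _)]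
  refine le_trans (mul_le_mul_of_nonneg_left ?_ (Real.exp_pos _).le) hM
  refine ENNReal.toReal_mono (measure_ne_top _ _) (measure_mono fun x hx => ?_)
  change t ≤ ‖(WithLp.toLp 2 x : EuclideanSpace ℝ ι)‖ ^ 2 at hx
  change Real.exp (t / 4) ≤ ∏ i, Real.exp (x i ^ 2 / 4)
  rw [EuclideanSpace.real_norm_sq_eq] at hx
  rw [← Real.exp_sum, ← Finset.sum_div]
  exact Real.exp_le_exp.2 (by simpa using div_le_div_of_nonneg_right hx (by norm_num : (0:ℝ) ≤ 4))

open scoped MatrixOrder in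
-- Cauchy-Schwarz after moving the symmetric square root onto `x`: one bound on the norm of the
-- standard Gaussian controls all directions at once.
lemma dotProduct_sqrt_sq_le {S : Matrix ι ι ℝ} (hS : S.PosSemidef) (x : ι → ℝ)
    (g : EuclideanSpace ℝ ι) :
    (x ⬝ᵥ ⇑(toEuclideanCLM (𝕜 := ℝ) (CFC.sqrt S) g)) ^ 2 ≤ (x ⬝ᵥ S *ᵥ x) * ‖g‖ ^ 2 := by
  set R := CFC.sqrt S with hR
  have hRs : R * R = S := CFC.sqrt_mul_sqrt_self S hS.nonneg
  have hRh : R.IsHermitian := (CFC.sqrt_nonneg S).isSelfAdjoint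
  have h1 : x ⬝ᵥ ⇑(toEuclideanCLM (𝕜 := ℝ) R g) = (R *ᵥ x) ⬝ᵥ ⇑g := by
    have : ⇑(toEuclideanCLM (𝕜 := ℝ) R g) = R *ᵥ ⇑g := rfl
    rw [this, dotProduct_mulVec_comm_of_isHermitian hRh, dotProduct_comm]
  have h2 : (R *ᵥ x) ⬝ᵥ (R *ᵥ x) = x ⬝ᵥ S *ᵥ x := by
    rw [dotProduct_mulVec_comm_of_isHermitian hRh, ← hRs, ← mulVec_mulVec]
  have h3 : ⇑g ⬝ᵥ ⇑g = ‖g‖ ^ 2 := by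
    rw [EuclideanSpace.real_norm_sq_eq]; simp [dotProduct, sq]
  rw [h1, ← h2, ← h3]
  exact dotProduct_sq_le _ _

/-- The set of perturbations that are bounded in the dual norm of `S`. -/
def boundedNoise (S : Matrix ι ι ℝ) (b : ℝ) : Set (EuclideanSpace ℝ ι) :=
  {z | ∀ x : ι → ℝ, |x ⬝ᵥ ⇑z| ≤ b * √(x ⬝ᵥ S *ᵥ x)}

lemma measurableSet_boundedNoise (S : Matrix ι ι ℝ) (b : ℝ) :
    MeasurableSet (boundedNoise S b) := by
  have : boundedNoise S b = ⋂ x : ι → ℝ, {z : EuclideanSpace ℝ ι | |x ⬝ᵥ ⇑z| ≤ b * √(x ⬝ᵥ S *ᵥ x)} := by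
    ext z; simp [boundedNoise]
  rw [this]
  refine (isClosed_iInter fun x => isClosed_le ?_ continuous_const).measurableSet
  simp only [dotProduct]
  fun_prop

open scoped MatrixOrder in
lemma multivariateGaussian_boundedNoise_compl {S : Matrix ι ι ℝ} (hS : S.PosSemidef) {b : ℝ}
    (hb : 0 ≤ b) :
    multivariateGaussian 0 S (boundedNoise S b)ᶜ ≤
      ENNReal.ofReal (√2 ^ Fintype.card ι * Real.exp (-(b ^ 2 / 4))) := by
  rw [multivariateGaussian, Measure.map_apply (by fun_prop) (measurableSet_boundedNoise S b).compl]
  refine (measure_mono fun g hg => ?_).trans (stdGaussian_norm_tail (b ^ 2))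
  by_contra hlt
  refine hg fun x => ?_
  simp only [zero_add]
  have h1 := dotProduct_sqrt_sq_le hS x g
  have h0 : 0 ≤ x ⬝ᵥ S *ᵥ x := by simpa using hS.dotProduct_mulVec_nonneg x
  have hlt' : ‖g‖ ^ 2 < b ^ 2 := not_le.1 hlt
  apply abs_le_of_sq_le_sq _ (by positivity)
  rw [mul_pow, Real.sq_sqrt h0]
  exact h1.trans (by nlinarith)

/-- The pairing with `x` is a centred real Gaussian of variance x·Sx. A degenerate variance is
harmless because the failure event is a strict inequality. -/
lemma one_ninth_le_multivariateGaussian {S : Matrix ι ι ℝ} (hS : S.PosSemidef) (x : ι → ℝ) :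
    multivariateGaussian 0 S {z | x ⬝ᵥ ⇑z < √(x ⬝ᵥ S *ᵥ x)} ≤ ENNReal.ofReal (8 / 9) := by
  set ν := multivariateGaussian 0 S with hν
  set Lx : StrongDual ℝ (EuclideanSpace ℝ ι) := innerSL ℝ (WithLp.toLp 2 x) with hLx
  have hL : ∀ z, Lx z = x ⬝ᵥ ⇑z := fun z => by
    simp [hLx, PiLp.inner_apply, dotProduct, mul_comm]
  have h0 : 0 ≤ x ⬝ᵥ S *ᵥ x := by simpa using hS.dotProduct_mulVec_nonneg x
  have hvar : Var[Lx; ν] = x ⬝ᵥ S *ᵥ x := by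
    rw [← covariance_self Lx.continuous.measurable.aemeasurable]
    have := covarianceBilin_apply_eq_cov (μ := ν) IsGaussian.memLp_two_id
      (WithLp.toLp 2 x) (WithLp.toLp 2 x)
    rw [covarianceBilin_multivariateGaussian hS] at this
    exact this.symm
  have hmap : ν.map Lx = gaussianReal 0 (x ⬝ᵥ S *ᵥ x).toNNReal := by
    rw [IsGaussian.map_eq_gaussianReal, hvar,
      Lx.integral_comp_id_comm IsGaussian.integrable_id,
      integral_id_multivariateGaussian, map_zero]
  have h1 := one_ninth_le_gaussianReal_sqrt (x ⬝ᵥ S *ᵥ x).toNNReal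
  rw [← hmap, map_measureReal_apply Lx.continuous.measurable measurableSet_Ici,
    Real.coe_toNNReal _ h0] at h1
  have h2 : {z : EuclideanSpace ℝ ι | x ⬝ᵥ ⇑z < √(x ⬝ᵥ S *ᵥ x)} =
      (Lx ⁻¹' Set.Ici √(x ⬝ᵥ S *ᵥ x))ᶜ := by
    ext z
    change x ⬝ᵥ ⇑z < _ ↔ ¬ (√(x ⬝ᵥ S *ᵥ x) ≤ Lx z)
    rw [hL, not_le]
  rw [h2, ← ENNReal.ofReal_toReal (measure_ne_top ν _)]
  apply ENNReal.ofReal_le_ofReal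
  have h3 := probReal_compl_eq_one_sub (μ := ν)
    (Lx.continuous.measurable (measurableSet_Ici (a := √(x ⬝ᵥ S *ᵥ x))))
  change ν.real _ ≤ _
  rw [h3]; linarith

variable {m : ℕ}

lemma pi_multivariateGaussian_boundedNoise {S : Matrix ι ι ℝ} (hS : S.PosSemidef) {b : ℝ}
    (hb : 0 ≤ b) :
    (Measure.pi fun _ : Fin m => multivariateGaussian 0 S) {z | ∃ i, z i ∉ boundedNoise S b} ≤
      m * ENNReal.ofReal (√2 ^ Fintype.card ι * Real.exp (-(b ^ 2 / 4))) := by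
  have h : {z : Fin m → EuclideanSpace ℝ ι | ∃ i, z i ∉ boundedNoise S b} =
      ⋃ i, Function.eval i ⁻¹' (boundedNoise S b)ᶜ := by
    ext z; simp
  rw [h]
  refine (measure_iUnion_fintype_le _ _).trans ?_
  refine (Finset.sum_le_sum fun i _ => ?_).trans (by simp : ∑ _i : Fin m,
    ENNReal.ofReal (√2 ^ Fintype.card ι * Real.exp (-(b ^ 2 / 4))) ≤ _)
  rw [(measurePreserving_eval (fun _ : Fin m => multivariateGaussian 0 S) i).measure_preimage
    (measurableSet_boundedNoise S b).compl.nullMeasurableSet]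
  exact multivariateGaussian_boundedNoise_compl hS hb

lemma pi_multivariateGaussian_optimism {S : Matrix ι ι ℝ} (hS : S.PosSemidef) (x : ι → ℝ) :
    (Measure.pi fun _ : Fin m => multivariateGaussian 0 S)
      {z | ∀ i, x ⬝ᵥ ⇑(z i) < √(x ⬝ᵥ S *ᵥ x)} ≤ ENNReal.ofReal ((8 / 9) ^ m) := by
  have h : {z : Fin m → EuclideanSpace ℝ ι | ∀ i, x ⬝ᵥ ⇑(z i) < √(x ⬝ᵥ S *ᵥ x)} =
      Set.pi Set.univ fun _ => {z : EuclideanSpace ℝ ι | x ⬝ᵥ ⇑z < √(x ⬝ᵥ S *ᵥ x)} := by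
    ext z; simp
  rw [h, Measure.pi_pi, Finset.prod_const, Finset.card_univ, Fintype.card_fin,
    ENNReal.ofReal_pow (by norm_num)]
  gcongr
  exact one_ninth_le_multivariateGaussian hS x

end Gaussian

/-! ### Dependence on the past and measurability -/

instance {X A : Type*} {H : ℕ} : MeasurableSingletonClass (Trajectory X A H) := ⟨fun _ => trivial⟩

section Congr

variable {X A : Type*} [Fintype X] [Fintype A] [DecidableEq X] [DecidableEq A] {H : ℕ}
  {p : Params} {t t' : ℕ → Trajectory X A H} {k : ℕ} (ht : ∀ j < k, t j = t' j)
  (v : ℕ → ℝ) (ζ : ℕ → Fin p.m → Noise X A H)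

include ht

/-- This family of facts records which trajectories a quantity can see. As there are finitely many
prefixes, it reduces measurability to fixed trajectories and makes the bad noise sets functions of
the past. -/
lemma covStep_congr : covStep p t k = covStep p t' k := by
  funext h
  rw [covStep, covStep]
  congr 1
  exact Finset.sum_congr rfl fun j hj => by rw [ht j (Finset.mem_range.1 hj)]

lemma covAll_congr : covAll p t k = covAll p t' k := by
  rw [covAll, covAll]
  congr 1
  exact Finset.sum_congr rfl fun j hj => by rw [ht j (Finset.mem_range.1 hj)]

lemma covNoise_congr : covNoise p t k = covNoise p t' k := by
  rw [covNoise, covNoise, covAll_congr ht, covStep_congr ht]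

lemma visits_congr : visits t k = visits t' k := by
  funext h q
  exact Finset.sum_congr rfl fun j hj => by rw [ht j (Finset.mem_range.1 hj)]

lemma empKernel_congr : empKernel t k = empKernel t' k := by
  funext h x a x'
  rw [empKernel, empKernel, visits_congr ht]
  congr 1
  exact Finset.sum_congr rfl fun j hj => by rw [ht j (Finset.mem_range.1 hj)]

lemma psiHat_congr : psiHat p t k = psiHat p t' k := by
  funext h V
  rw [psiHat, psiHat, covStep_congr ht]
  congr 1
  exact Finset.sum_congr rfl fun j hj => by rw [ht j (Finset.mem_range.1 hj)]

lemma thetaHat_congr : thetaHat p t v k = thetaHat p t' v k := by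
  rw [thetaHat, thetaHat, covAll_congr ht]
  congr 1
  exact Finset.sum_congr rfl fun j hj => by rw [ht j (Finset.mem_range.1 hj)]

lemma epochStart_congr : epochStart p t k = epochStart p t' k := by
  induction k with
  | zero => rfl
  | succ k ih =>
    have h1 := ih fun j hj => ht j (by omega)
    have h2 := covStep_congr (p := p) ht
    have h3 := covAll_congr (p := p) ht
    have hle := epochStart_le (p := p) (traj := t) k
    have h4 : covStep p t (epochStart p t k) = covStep p t' (epochStart p t k) :=
      covStep_congr fun j hj => ht j (by omega)
    have h5 : covAll p t (epochStart p t k) = covAll p t' (epochStart p t k) :=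
      covAll_congr fun j hj => ht j (by omega)
    rw [epochStart, epochStart, h2, h3, h4, h5, h1]

lemma psiHat_epochStart_congr :
    psiHat p t (epochStart p t k) = psiHat p t' (epochStart p t' k) := by
  rw [← epochStart_congr ht]
  exact psiHat_congr fun j hj => ht j (hj.trans_le (epochStart_le k))

lemma rewardHat_congr (i : Fin p.m) : rewardHat p t v ζ k i = rewardHat p t' v ζ k i := by
  funext j
  rw [rewardHat, rewardHat, thetaHat_congr ht, epochStart_congr ht]

lemma policy_congr : policy p t v ζ k = policy p t' v ζ k := by
  induction k with
  | zero => rfl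
  | succ k ih =>
    have ht' : ∀ j < k, t j = t' j := fun j hj => ht j (by omega)
    funext i h x
    by_cases hk : epochStart p t (k + 1) = k + 1
    · rw [policy_of_start hk, policy_of_start (by rwa [← epochStart_congr ht])]
    · rw [policy_succ_of_ne hk, policy_succ_of_ne (by rwa [← epochStart_congr ht]), ih ht',
        rewardHat_congr ht', psiHat_epochStart_congr ht']

lemma initValueHat_congr (x₁ : X) : initValueHat p x₁ t v ζ k = initValueHat p x₁ t' v ζ k := by
  funext i
  rw [initValueHat, initValueHat, policy_congr ht, rewardHat_congr ht, psiHat_epochStart_congr ht]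

lemma weights_congr (x₁ : X) : weights p x₁ t v ζ k = weights p x₁ t' v ζ k := by
  induction k with
  | zero => rfl
  | succ k ih =>
    have ht' : ∀ j < k, t j = t' j := fun j hj => ht j (by omega)
    by_cases hk : epochStart p t (k + 1) = k + 1
    · rw [weights_of_start hk, weights_of_start (by rwa [← epochStart_congr ht])]
    · rw [weights_succ_of_ne hk, weights_succ_of_ne (by rwa [← epochStart_congr ht]), ih ht',
        initValueHat_congr ht']

lemma bonus_congr (βZ c : ℝ) : bonus p t βZ c k = bonus p t' βZ c k := by
  have h1 : ∀ j < epochStart p t k, t j = t' j := fun j hj => ht j (hj.trans_le (epochStart_le k))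
  funext τ
  rw [bonus, bonus, covAll_congr ht, ← epochStart_congr ht, covNoise_congr h1, visits_congr h1]

end Congr

section Measurable

variable {Ω : Type*} [MeasurableSpace Ω]

lemma measurable_comp_countable {ι : Type*} [Countable ι] [MeasurableSpace ι]
    [MeasurableSingletonClass ι] {T : Ω → ι} (hT : Measurable T) {f : ι → Ω → ℝ}
    (hf : ∀ i, Measurable (f i)) : Measurable fun ω => f (T ω) ω :=
  (measurable_from_prod_countable_right (f := fun q : ι × Ω => f q.1 q.2) hf).comp
    (hT.prodMk measurable_id)

variable {X A : Type*} [Fintype X] [Fintype A] [DecidableEq X] [DecidableEq A] {H : ℕ} {p : Params}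

/-- Extend finitely many trajectories to a sequence. -/
def extendTraj {k : ℕ} (t₀ : Trajectory X A H) (q : Fin k → Trajectory X A H) (j : ℕ) :
    Trajectory X A H :=
  if h : j < k then q ⟨j, h⟩ else t₀

/-- Functions that depend on finitely many trajectories are measurable. -/
lemma measurable_of_prefix {k : ℕ} {traj : ℕ → Ω → Trajectory X A H}
    (htraj : ∀ j < k, Measurable (traj j)) {F : (ℕ → Trajectory X A H) → Ω → ℝ}
    (hF : ∀ t, Measurable (F t)) (hcongr : ∀ t t', (∀ j < k, t j = t' j) → F t = F t') :
    Measurable fun ω => F (traj · ω) ω := by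
  by_cases hne : Nonempty (Trajectory X A H)
  · obtain ⟨t₀⟩ := hne
    have h1 : Measurable fun ω (j : Fin k) => traj j ω :=
      measurable_pi_lambda _ fun j => htraj j j.2
    have h2 := measurable_comp_countable h1 (f := fun q => F (extendTraj t₀ q)) fun q => hF _
    convert h2 using 2 with ω
    refine congrFun (hcongr _ _ fun j hj => ?_) ω
    simp [extendTraj, hj]
  -- A sample point would supply a trajectory, so without trajectories there are no sample points.
  · have : IsEmpty Ω := ⟨fun ω => hne ⟨traj 0 ω⟩⟩
    exact measurable_of_empty _

lemma measurable_kernelBackup {P : Fin H → X → A → X → ℝ} {V : Ω → X → ℝ}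
    (hV : ∀ x, Measurable fun ω => V ω x) (h : Fin H) (q : X × A) :
    Measurable fun ω => kernelBackup P h (V ω) q := by
  simp only [kernelBackup]
  exact Finset.measurable_sum _ fun x' _ => (hV x').const_mul _

lemma measurable_evalV {θ : Ω → (X × A) × Fin H → ℝ} {π : Ω → Fin H → X → A → ℝ}
    {P : Fin H → X → A → X → ℝ} (hθ : ∀ j, Measurable fun ω => θ ω j)
    (hπ : ∀ h x a, Measurable fun ω => π ω h x a) (h : Fin (H + 1)) (x : X) :
    Measurable fun ω => evalV (θ ω) (kernelBackup P) (π ω) h x := by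
  induction h using Fin.reverseInduction generalizing x with
  | last => simp only [evalV_last]; exact measurable_const
  | cast h ih =>
    simp only [evalV_kernel_castSucc]
    exact Finset.measurable_sum _ fun a _ => (hπ h x a).mul
      ((hθ _).add (measurable_kernelBackup (ih ·) h (x, a)))

lemma measurable_evalQ {θ : Ω → (X × A) × Fin H → ℝ} {π : Ω → Fin H → X → A → ℝ}
    {P : Fin H → X → A → X → ℝ} (hθ : ∀ j, Measurable fun ω => θ ω j)
    (hπ : ∀ h x a, Measurable fun ω => π ω h x a) (h : Fin H) (x : X) (a : A) :
    Measurable fun ω => evalQ (θ ω) (kernelBackup P) (π ω) h x a := by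
  simp only [evalQ_eq]
  exact (hθ _).add (measurable_kernelBackup (measurable_evalV hθ hπ h.succ) h (x, a))

lemma measurable_expUpdate {ι : Type*} [Fintype ι] {η : ℝ} {w u : Ω → ι → ℝ}
    (hw : ∀ a, Measurable fun ω => w ω a) (hu : ∀ a, Measurable fun ω => u ω a) (a : ι) :
    Measurable fun ω => expUpdate η (w ω) (u ω) a := by
  have h : ∀ a, Measurable fun ω => w ω a * Real.exp (η * u ω a) := fun a =>
    (hw a).mul (Real.measurable_exp.comp ((hu a).const_mul η))
  exact (h a).div (Finset.measurable_sum _ fun b _ => h b)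

variable {v : ℕ → Ω → ℝ} {ζ : ℕ → Ω → Fin p.m → Noise X A H} {k : ℕ}

lemma measurable_rewardHat (t : ℕ → Trajectory X A H) (hv : ∀ j < k, Measurable (v j))
    (hζ : ∀ j ≤ k, Measurable (ζ j)) (i : Fin p.m) (j : (X × A) × Fin H) :
    Measurable fun ω => rewardHat p t (v · ω) (ζ · ω) k i j := by
  have h1 : Measurable fun ω => ζ (epochStart p t k) ω i j :=
    (by fun_prop : Measurable fun z : Fin p.m → Noise X A H => z i j).comp
      (hζ _ (epochStart_le k))
  refine Measurable.add ?_ h1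
  simp only [thetaHat, mulVec, dotProduct]
  refine Finset.measurable_sum _ fun j' _ => Measurable.const_mul ?_ _
  simp only [Finset.sum_apply, Pi.smul_apply, smul_eq_mul]
  exact Finset.measurable_sum _ fun τ hτ => (hv τ (Finset.mem_range.1 hτ)).mul_const _

lemma measurable_policy_fixed (hp : p.lamP = 1) (t : ℕ → Trajectory X A H)
    (hv : ∀ j < k, Measurable (v j)) (hζ : ∀ j < k, Measurable (ζ j)) (i : Fin p.m) (h : Fin H)
    (x : X) (a : A) : Measurable fun ω => policy p t (v · ω) (ζ · ω) k i h x a := by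
  induction k generalizing h x a with
  | zero => exact measurable_const
  | succ k ih =>
    by_cases hk : epochStart p t (k + 1) = k + 1
    · simp only [policy_of_start hk]; exact measurable_const
    · simp only [policy_succ_of_ne hk, psiHat_eq hp]
      have h1 := ih (fun j hj => hv j (by omega)) fun j hj => hζ j (by omega)
      exact measurable_expUpdate (h1 h x) (measurable_evalQ (measurable_rewardHat t
        (fun j hj => hv j (by omega)) (fun j hj => hζ j (by omega)) i) h1 h x) a

lemma measurable_initValueHat_fixed (hp : p.lamP = 1) (x₁ : X) (t : ℕ → Trajectory X A H)
    (hv : ∀ j < k, Measurable (v j)) (hζ : ∀ j ≤ k, Measurable (ζ j)) (i : Fin p.m) :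
    Measurable fun ω => initValueHat p x₁ t (v · ω) (ζ · ω) k i := by
  simp only [initValueHat, psiHat_eq hp]
  exact measurable_evalV (measurable_rewardHat t hv hζ i)
    (measurable_policy_fixed hp t hv (fun j hj => hζ j hj.le) i) 0 x₁

lemma measurable_weights_fixed (hp : p.lamP = 1) (x₁ : X) (t : ℕ → Trajectory X A H)
    (hv : ∀ j < k, Measurable (v j)) (hζ : ∀ j < k, Measurable (ζ j)) (i : Fin p.m) :
    Measurable fun ω => weights p x₁ t (v · ω) (ζ · ω) k i := by
  induction k generalizing i with
  | zero => exact measurable_const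
  | succ k ih =>
    by_cases hk : epochStart p t (k + 1) = k + 1
    · simp only [weights_of_start hk]; exact measurable_const
    · simp only [weights_succ_of_ne hk]
      exact measurable_expUpdate (ih (fun j hj => hv j (by omega)) fun j hj => hζ j (by omega))
        (measurable_initValueHat_fixed hp x₁ t (fun j hj => hv j (by omega))
          fun j hj => hζ j (by omega)) i

variable {traj : ℕ → Ω → Trajectory X A H}

lemma measurable_policy (hp : p.lamP = 1) (ht : ∀ j < k, Measurable (traj j))
    (hv : ∀ j < k, Measurable (v j)) (hζ : ∀ j < k, Measurable (ζ j)) (i : Fin p.m) (h : Fin H)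
    (x : X) (a : A) : Measurable fun ω => policy p (traj · ω) (v · ω) (ζ · ω) k i h x a :=
  measurable_of_prefix ht (F := fun t ω => policy p t (v · ω) (ζ · ω) k i h x a)
    (fun t => measurable_policy_fixed hp t hv hζ i h x a)
    fun t t' htt => by funext ω; rw [policy_congr htt]

lemma measurable_initValueHat (hp : p.lamP = 1) (x₁ : X) (ht : ∀ j < k, Measurable (traj j))
    (hv : ∀ j < k, Measurable (v j)) (hζ : ∀ j ≤ k, Measurable (ζ j)) (i : Fin p.m) :
    Measurable fun ω => initValueHat p x₁ (traj · ω) (v · ω) (ζ · ω) k i :=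
  measurable_of_prefix ht (F := fun t ω => initValueHat p x₁ t (v · ω) (ζ · ω) k i)
    (fun t => measurable_initValueHat_fixed hp x₁ t hv hζ i)
    fun t t' htt => by funext ω; rw [initValueHat_congr htt]

lemma measurable_weights (hp : p.lamP = 1) (x₁ : X) (ht : ∀ j < k, Measurable (traj j))
    (hv : ∀ j < k, Measurable (v j)) (hζ : ∀ j < k, Measurable (ζ j)) (i : Fin p.m) :
    Measurable fun ω => weights p x₁ (traj · ω) (v · ω) (ζ · ω) k i :=
  measurable_of_prefix ht (F := fun t ω => weights p x₁ t (v · ω) (ζ · ω) k i)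
    (fun t => measurable_weights_fixed hp x₁ t hv hζ i)
    fun t t' htt => by funext ω; rw [weights_congr htt]

lemma measurable_bonus (ht : ∀ j < k, Measurable (traj j)) (βZ c : ℝ) (τ : Trajectory X A H) :
    Measurable fun ω => bonus p (traj · ω) βZ c k τ :=
  measurable_of_prefix ht (F := fun t _ => bonus p t βZ c k τ) (fun t => measurable_const)
    fun t t' htt => by funext ω; rw [bonus_congr htt]

lemma measurable_trajProb (M : MDP X A H) {π : Ω → Fin H → X → A → ℝ}
    (hπ : ∀ h x a, Measurable fun ω => π ω h x a) (τ : Trajectory X A H) :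
    Measurable fun ω => trajProb M (π ω) τ := by
  simp only [trajProb]
  exact (Finset.measurable_prod _ fun h _ => (hπ _ _ _).mul_const _).const_mul _

end Measurable

/-! ### Noise from conditional laws and conditional means. -/

section Noise

variable {Ω : Type*} [mΩ : MeasurableSpace Ω] {μ : Measure Ω} [IsProbabilityMeasure μ]

/-- A quantity evaluated at the draw, minus its average under the conditional law, is orthogonal to
the past. -/
lemma isNoise_of_condLaw {ι : Type*} [Fintype ι] [MeasurableSpace ι]
    [MeasurableSingletonClass ι] {m : MeasurableSpace Ω} (hm : m ≤ mΩ) {T : Ω → ι}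
    (hT : Measurable[mΩ] T) {q : Ω → ι → ℝ} (hq : ∀ i, μ⟦T ⁻¹' {i} | m⟧ =ᵐ[μ] fun ω => q ω i)
    {c : Ω → ι → ℝ} (hc : ∀ i, Measurable[m] fun ω => c ω i)
    (hcb : ∀ i, ∃ C, ∀ᵐ ω ∂μ, |c ω i| ≤ C) :
    IsNoise μ m fun ω => c ω (T ω) - ∑ i, q ω i * c ω i := by
  rintro Z hZ ⟨C, hC⟩
  obtain ⟨h1, h2, h3⟩ := integral_eq_of_condLaw (mΩ := mΩ) (μ := μ) hm hT hq (G := fun ω i => Z ω * c ω i)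
    (fun i => hZ.mul (hc i)) (fun i => by
      obtain ⟨C', hC'⟩ := hcb i
      refine ⟨C * C', ?_⟩
      filter_upwards [hC, hC'] with ω h1 h2
      rw [abs_mul]
      exact mul_le_mul h1 h2 (abs_nonneg _) ((abs_nonneg _).trans h1))
  have e : ∀ ω, Z ω * (c ω (T ω) - ∑ i, q ω i * c ω i) =
      Z ω * c ω (T ω) - ∑ i, q ω i * (Z ω * c ω i) := fun ω => by
    rw [mul_sub, Finset.mul_sum]
    congr 1
    exact Finset.sum_congr rfl fun _ _ => by ring
  simp only [e]
  rw [integral_sub h1 h2, h3, sub_self]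

lemma isNoise_of_condMean {ι : Type*} [Fintype ι] {m : MeasurableSpace Ω} (hm : m ≤ mΩ)
    {y g : ι → Ω → ℝ} (hy : ∀ i, Integrable (y i) μ) (hg : ∀ i, μ[y i | m] =ᵐ[μ] g i) :
    IsNoise μ m fun ω => ∑ i, (y i ω - g i ω) := by
  rintro Z hZ ⟨C, hC⟩
  have hgi : ∀ i, Integrable (g i) μ := fun i => integrable_condExp.congr (hg i)
  have hZm := (hZ.mono hm le_rfl).aestronglyMeasurable (μ := μ)
  have h1 : ∀ i, Integrable (fun ω => Z ω * y i ω) μ := fun i => (hy i).bdd_mul hZm hC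
  have h2 : ∀ i, Integrable (fun ω => Z ω * g i ω) μ := fun i => (hgi i).bdd_mul hZm hC
  simp only [Finset.mul_sum, mul_sub]
  rw [integral_finsetSum (f := fun i ω => Z ω * y i ω - Z ω * g i ω) _
    fun i _ => (h1 i).sub (h2 i)]
  refine Finset.sum_eq_zero fun i _ => ?_
  rw [integral_sub (h1 i) (h2 i), sub_eq_zero, ← integral_condExp hm]
  refine integral_congr_ae ?_
  refine (condExp_mul_of_stronglyMeasurable_left (m := m) (μ := μ) (f := Z) (g := y i)
    hZ.stronglyMeasurable (h1 i) (hy i)).trans ?_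
  filter_upwards [hg i] with ω hω
  rw [Pi.mul_apply, hω]

end Noise

/-! ### The information available at each stage of an episode. -/

section Run

variable {X A : Type*} [Fintype X] [Fintype A] [DecidableEq X] [DecidableEq A] {H : ℕ}
  {Ω : Type*} [mΩ : MeasurableSpace Ω] {μ : Measure Ω} [IsProbabilityMeasure μ]
  {M : MDP X A H} {p : Params} {K : ℕ} {S : Interaction X A H p.m Ω}

lemma IsRun.measurable_agg (hS : IsRun μ M p K S) (k : ℕ) : Measurable (S.agg k) :=
  Finset.measurable_sum _ fun h _ => hS.meas_rew k h

lemma IsRun.measurable_past (hS : IsRun μ M p K S) (k : ℕ) : Measurable (S.past k) :=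
  measurable_pi_lambda _ fun j => (hS.meas_ζ j).prodMk ((hS.meas_idx j).prodMk
    ((hS.meas_traj j).prodMk (hS.measurable_agg j)))

lemma IsRun.infoIdx_le (hS : IsRun μ M p K S) (k : ℕ) : S.infoIdx k ≤ mΩ :=
  ((hS.measurable_past k).prodMk (hS.meas_ζ k)).comap_le

lemma IsRun.infoTraj_le (hS : IsRun μ M p K S) (k : ℕ) : S.infoTraj k ≤ mΩ :=
  ((hS.measurable_past k).prodMk ((hS.meas_ζ k).prodMk (hS.meas_idx k))).comap_le

lemma IsRun.infoRew_le (hS : IsRun μ M p K S) (k : ℕ) : S.infoRew k ≤ mΩ :=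
  ((hS.measurable_past k).prodMk ((hS.meas_ζ k).prodMk
    ((hS.meas_idx k).prodMk (hS.meas_traj k)))).comap_le

lemma measurable_past_infoIdx (k : ℕ) : Measurable[S.infoIdx k] (S.past k) :=
  measurable_fst.comp (comap_measurable fun ω => (S.past k ω, S.ζ k ω))

lemma measurable_ζ_infoIdx (k : ℕ) : Measurable[S.infoIdx k] (S.ζ k) :=
  measurable_snd.comp (comap_measurable fun ω => (S.past k ω, S.ζ k ω))

lemma infoIdx_le_infoTraj (k : ℕ) : S.infoIdx k ≤ S.infoTraj k := by
  refine Measurable.comap_le (m₁ := S.infoTraj k) ?_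
  have h := comap_measurable (m := inferInstance) fun ω => (S.past k ω, S.ζ k ω, S.idx k ω)
  exact (measurable_fst.comp h).prodMk ((measurable_fst.comp measurable_snd).comp h)

lemma measurable_idx_infoTraj (k : ℕ) : Measurable[S.infoTraj k] (S.idx k) :=
  (measurable_snd.comp measurable_snd).comp
    (comap_measurable fun ω => (S.past k ω, S.ζ k ω, S.idx k ω))

lemma infoTraj_le_infoRew (k : ℕ) : S.infoTraj k ≤ S.infoRew k := by
  refine Measurable.comap_le (m₁ := S.infoRew k) ?_
  have h := comap_measurable (m := inferInstance)
    fun ω => (S.past k ω, S.ζ k ω, S.idx k ω, S.traj k ω)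
  exact (measurable_fst.comp h).prodMk (((measurable_fst.comp measurable_snd).comp h).prodMk
    ((measurable_fst.comp (measurable_snd.comp measurable_snd)).comp h))

lemma measurable_traj_infoRew (k : ℕ) : Measurable[S.infoRew k] (S.traj k) :=
  (measurable_snd.comp (measurable_snd.comp measurable_snd)).comp
    (comap_measurable fun ω => (S.past k ω, S.ζ k ω, S.idx k ω, S.traj k ω))

lemma measurable_past_apply_infoIdx {j k : ℕ} (hj : j < k) :
    Measurable[S.infoIdx k] fun ω => (S.ζ j ω, S.idx j ω, S.traj j ω, S.agg j ω) :=
  (measurable_pi_apply (⟨j, hj⟩ : Fin k)).comp (measurable_past_infoIdx k)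

lemma measurable_traj_infoIdx {j k : ℕ} (hj : j < k) : Measurable[S.infoIdx k] (S.traj j) :=
  (measurable_fst.comp (measurable_snd.comp measurable_snd)).comp (measurable_past_apply_infoIdx hj)

lemma measurable_agg_infoIdx {j k : ℕ} (hj : j < k) : Measurable[S.infoIdx k] (S.agg j) :=
  (measurable_snd.comp (measurable_snd.comp measurable_snd)).comp (measurable_past_apply_infoIdx hj)

lemma measurable_idx_infoIdx {j k : ℕ} (hj : j < k) : Measurable[S.infoIdx k] (S.idx j) :=
  (measurable_fst.comp measurable_snd).comp (measurable_past_apply_infoIdx hj)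

lemma measurable_ζ_past_infoIdx {j k : ℕ} (hj : j ≤ k) : Measurable[S.infoIdx k] (S.ζ j) := by
  rcases hj.lt_or_eq with h | rfl
  · exact measurable_fst.comp (measurable_past_apply_infoIdx h)
  · exact measurable_ζ_infoIdx j

/-- The probability of a bad draw of the perturbations at the start of an epoch. -/
lemma IsRun.measure_noise_event_le (hS : IsRun μ M p K S) {k : ℕ} (hk : k < K)
    {Bad : (ℕ → Trajectory X A H) → Set (Fin p.m → Noise X A H)}
    (hcongr : ∀ t t', (∀ j < k, t j = t' j) → Bad t = Bad t')
    (hmeas : ∀ t, MeasurableSet (Bad t)) {c : ENNReal}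
    (hbound : ∀ t, (Measure.pi fun _ => multivariateGaussian 0 (covNoise p t k)) (Bad t) ≤ c) :
    μ {ω | epochStart p (S.traj · ω) k = k ∧ S.ζ k ω ∈ Bad (S.traj · ω)} ≤ c := by
  have hΩ : Nonempty Ω := μ.nonempty_of_neZero
  obtain ⟨ω₀⟩ := hΩ
  set t₀ := S.traj 0 ω₀
  set ext : (Fin k → (Fin p.m → Noise X A H) × Fin p.m × Trajectory X A H × ℝ) →
    ℕ → Trajectory X A H := fun q => extendTraj t₀ fun j => (q j).2.2.1 with hext
  have hextω : ∀ ω, ∀ j < k, ext (S.past k ω) j = S.traj j ω := fun ω j hj => by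
    simp [hext, extendTraj, hj, Interaction.past]
  -- The event as a set of pairs (past, perturbation). Its probability is the integral over the past
  -- of the conditional law of its fibres: Gaussian when an epoch starts, and empty fibres
  -- otherwise.
  set E : Set ((Fin k → (Fin p.m → Noise X A H) × Fin p.m × Trajectory X A H × ℝ) ×
    (Fin p.m → Noise X A H)) := {q | epochStart p (ext q.1) k = k ∧ q.2 ∈ Bad (ext q.1)} with hE
  have hEm : MeasurableSet E := by
    have : E = ⋃ s ∈ {s : Fin k → Trajectory X A H | epochStart p (extendTraj t₀ s) k = k},
        ((fun q => fun j => (q j).2.2.1) ⁻¹' {s}) ×ˢ Bad (extendTraj t₀ s) := by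
      ext q
      simp [hE, hext]
    rw [this]
    refine MeasurableSet.biUnion (Set.to_countable _) fun s _ => MeasurableSet.prod ?_ (hmeas _)
    have : Measurable fun (q : Fin k → (Fin p.m → Noise X A H) × Fin p.m × Trajectory X A H × ℝ)
        (j : Fin k) => (q j).2.2.1 := by fun_prop
    exact this (measurableSet_singleton s)
  have hset : {ω | epochStart p (S.traj · ω) k = k ∧ S.ζ k ω ∈ Bad (S.traj · ω)} =
      (fun ω => (S.past k ω, S.ζ k ω)) ⁻¹' E := by
    ext ω
    change _ ↔ epochStart p (ext (S.past k ω)) k = k ∧ S.ζ k ω ∈ Bad (ext (S.past k ω))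
    rw [epochStart_congr (hextω ω), hcongr _ _ (hextω ω)]
    rfl
  rw [hset, ← Measure.map_apply ((hS.measurable_past k).prodMk (hS.meas_ζ k)) hEm,
    ← compProd_map_condDistrib (hS.meas_ζ k).aemeasurable,
    Measure.compProd_apply hEm, lintegral_map (Kernel.measurable_kernel_prodMk_left hEm)
      (hS.measurable_past k)]
  refine (lintegral_mono_ae (g := fun _ => c) ?_).trans (by simp)
  filter_upwards [hS.law_ζ k hk] with ω hω
  by_cases hs : epochStart p (S.traj · ω) k = k
  · rw [hω hs]
    refine (measure_mono fun z hz => ?_).trans (hbound (S.traj · ω))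
    have : z ∈ Bad (ext (S.past k ω)) := hz.2
    rwa [hcongr _ _ (hextω ω)] at this
  · have : Prod.mk (S.past k ω) ⁻¹' E = ∅ := by
      ext z
      simp only [Set.mem_preimage, Set.mem_empty_iff_false, iff_false]
      intro hz
      exact hs (by rw [← epochStart_congr (hextω ω)]; exact hz.1)
    rw [this]; simp

end Run

/-! ### Probabilities of the favourable events -/

lemma measure_exists_le {Ω : Type*} [MeasurableSpace Ω] {μ : Measure Ω} {ι : Type*} [Fintype ι]
    {P : ι → Ω → Prop} {ε : ℝ}
    (h : ∀ i, μ {ω | P i ω} ≤ ENNReal.ofReal (ε / Fintype.card ι)) :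
    μ {ω | ∃ i, P i ω} ≤ ENNReal.ofReal ε := by
  rcases isEmpty_or_nonempty ι with hι | hι
  · simp
  have hc : (0 : ℝ) < Fintype.card ι := by exact_mod_cast Fintype.card_pos
  rw [Set.ofPred_exists]
  refine (measure_iUnion_fintype_le _ _).trans ((Finset.sum_le_sum fun i _ => h i).trans ?_)
  rw [Finset.sum_const, Finset.card_univ, nsmul_eq_mul, ← ENNReal.ofReal_natCast,
    ← ENNReal.ofReal_mul hc.le, mul_div_cancel₀ _ hc.ne']

section Run

variable {X A : Type*} [Fintype X] [Fintype A] [DecidableEq X] [DecidableEq A] {H : ℕ}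
  {Ω : Type*} [mΩ : MeasurableSpace Ω] {μ : Measure Ω} [IsProbabilityMeasure μ]
  {M : MDP X A H} {p : Params} {K : ℕ} {S : Interaction X A H p.m Ω}

/-- The noise of the aggregate reward. -/
lemma IsRun.isNoise_agg (hS : IsRun μ M p K S) {k : ℕ} (hk : k < K) :
    IsNoise μ (S.infoRew k) fun ω => S.agg k ω - (S.traj k ω).featAll ⬝ᵥ M.rewardVec := by
  have h := isNoise_of_condMean (hS.infoRew_le k) (y := S.rew k)
    (fun h => Integrable.of_bound (hS.meas_rew k h).aestronglyMeasurable 1 (by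
      filter_upwards [hS.rew_mem k hk h] with ω hω
      rw [Real.norm_eq_abs, abs_le]
      exact ⟨by linarith [hω.1], hω.2⟩)) (hS.mean_rew k hk)
  convert h using 2 with ω
  rw [Trajectory.featAll_dotProduct, Interaction.agg, ← Finset.sum_sub_distrib]
  rfl

lemma IsRun.abs_agg_sub_le (hS : IsRun μ M p K S) {k : ℕ} (hk : k < K) :
    ∀ᵐ ω ∂μ, |S.agg k ω - (S.traj k ω).featAll ⬝ᵥ M.rewardVec| ≤ H := by
  filter_upwards [ae_all_iff.2 (hS.rew_mem k hk)] with ω hω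
  rw [Trajectory.featAll_dotProduct, Interaction.agg, ← Finset.sum_sub_distrib]
  refine (Finset.abs_sum_le_sum_abs _ _).trans
    ((Finset.sum_le_sum fun h _ => ?_).trans (by simp : ∑ _h : Fin H, (1 : ℝ) ≤ H))
  have h1 := M.r_mem h ((S.traj k ω).state h) ((S.traj k ω).action h)
  rw [abs_le]
  change -1 ≤ _ - M.r h ((S.traj k ω).state h) ((S.traj k ω).action h) ∧
    _ - M.r h ((S.traj k ω).state h) ((S.traj k ω).action h) ≤ 1
  exact ⟨by linarith [(hω h).1, h1.2], by linarith [(hω h).2, h1.1]⟩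

/-- The confidence ellipsoid of the aggregate reward estimate. -/
lemma IsRun.measure_reward_le (hS : IsRun μ M p K S) (hr : p.lamR = H) (hH : 0 < H) {ε : ℝ}
    (hε : 0 < ε) (hb : H * √(Fintype.card X * Fintype.card A * H * Real.log (1 + K) +
      2 * Real.log (K / ε)) + H * √(Fintype.card X * Fintype.card A) ≤ p.betaR) :
    μ {ω | ∃ k : Fin K, ¬ ∀ x, |x ⬝ᵥ (thetaHat p (S.traj · ω) (S.agg · ω) k - M.rewardVec)| ≤
      p.betaR * √(invForm (covAll p (S.traj · ω) k) x x)} ≤ ENNReal.ofReal ε := by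
  refine measure_exists_le fun k => ?_
  have hH' : (0 : ℝ) < H := by exact_mod_cast hH
  have hr0 : 0 < p.lamR := by rw [hr]; exact hH'
  have hK : (0 : ℝ) < K := by exact_mod_cast k.pos
  rw [Fintype.card_fin]
  have hm : ∀ j, Measurable fun ω => (S.traj j ω).featAll ⬝ᵥ M.rewardVec := fun j =>
    (measurable_from_top (f := fun τ : Trajectory X A H => τ.featAll ⬝ᵥ M.rewardVec)).comp
      (hS.meas_traj j)
  refine (measure_mono fun ω hω => ?_).trans (measure_selfNorm_le (μ := μ) hr0 hH'
    (δ := ε / K) (by positivity) (φ := fun j ω => (S.traj j ω).featAll)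
    (ε := fun j ω => S.agg j ω - (S.traj j ω).featAll ⬝ᵥ M.rewardVec) (𝓕 := S.infoRew)
    hS.infoRew_le (fun j _ => (hS.measurable_agg j).sub (hm j))
    (fun j hj => hS.abs_agg_sub_le hj) (fun k _ j hj i => ?_) (fun k _ j hj => ?_)
    (fun j hj => hS.isNoise_agg hj) k.2.le)
  · by_contra hcon
    refine hω fun x => ?_
    simp only [Set.mem_ofPred_eq, not_lt] at hcon
    rw [thetaHat_error hr0]
    set t := (S.traj · ω) with ht
    set s := ∑ τ ∈ Finset.range k, (S.agg τ ω - (t τ).featAll ⬝ᵥ M.rewardVec) • (t τ).featAll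
      with hs
    set Λ := covAll p t k with hΛ
    have hpd : Λ.PosDef := posDef_gram hr0 k
    have hlog : Real.log ((covAll p t k).det / (covAll p t 0).det) ≤
        Fintype.card X * Fintype.card A * H * Real.log (1 + K) :=
      (log_det_covAll_div_le (p := p) (traj := t) hr hH k).trans (by
        have : (k : ℝ) ≤ K := by exact_mod_cast k.2.le
        gcongr)
    have h1 : invForm Λ s s ≤ (H * √(Fintype.card X * Fintype.card A * H * Real.log (1 + K) +
        2 * Real.log (K / ε))) ^ 2 := by
      have h0 := invForm_self_nonneg hpd s
      have h1 : invForm Λ s s ≤ (H : ℝ) ^ 2 * (Fintype.card X * Fintype.card A * H *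
          Real.log (1 + K) + 2 * Real.log (K / ε)) := by
        refine hcon.trans ?_
        rw [one_div_div]
        exact mul_le_mul_of_nonneg_left (add_le_add hlog le_rfl) (by positivity)
      rw [mul_pow, Real.sq_sqrt]
      · exact h1
      -- No sign is assumed for the radicand; a negative one would contradict the nonnegativity of
      -- the form.
      · by_contra hneg
        have : (H : ℝ) ^ 2 * (Fintype.card X * Fintype.card A * H *
          Real.log (1 + K) + 2 * Real.log (K / ε)) < 0 :=
          mul_neg_of_pos_of_neg (by positivity) (not_le.1 hneg)
        linarith
    have h2 : invForm Λ M.rewardVec M.rewardVec ≤ (√(Fintype.card X * Fintype.card A)) ^ 2 := by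
      rw [Real.sq_sqrt (by positivity)]
      refine (invForm_gram_le hr0 _ k).trans ?_
      rw [hr, div_le_iff₀ hH']
      refine (Finset.sum_le_sum (g := fun _ => (1 : ℝ)) fun j _ => ?_).trans (by simp)
      have h := M.r_mem j.2 j.1.1 j.1.2
      exact mul_le_one₀ h.2 h.1 h.2
    have h3 : |invForm Λ x s| ≤ √(invForm Λ x x) * (H * √(Fintype.card X * Fintype.card A * H *
        Real.log (1 + K) + 2 * Real.log (K / ε))) := by
      apply abs_le_of_sq_le_sq _ (by positivity)
      rw [mul_pow, Real.sq_sqrt (invForm_self_nonneg hpd x)]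
      exact (invForm_sq_le hpd x s).trans
        (mul_le_mul_of_nonneg_left h1 (invForm_self_nonneg hpd x))
    have h4 : |invForm Λ x M.rewardVec| ≤
        √(invForm Λ x x) * √(Fintype.card X * Fintype.card A) := by
      apply abs_le_of_sq_le_sq _ (by positivity)
      rw [mul_pow, Real.sq_sqrt (invForm_self_nonneg hpd x)]
      exact (invForm_sq_le hpd x _).trans
        (mul_le_mul_of_nonneg_left h2 (invForm_self_nonneg hpd x))
    calc |invForm Λ x s - p.lamR * invForm Λ x M.rewardVec|
        ≤ |invForm Λ x s| + H * |invForm Λ x M.rewardVec| := by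
          refine (abs_sub _ _).trans ?_
          rw [abs_mul, hr, abs_of_pos hH']
      _ ≤ (H * √(Fintype.card X * Fintype.card A * H * Real.log (1 + K) +
          2 * Real.log (K / ε)) + H * √(Fintype.card X * Fintype.card A)) * √(invForm Λ x x) := by
        nlinarith
      _ ≤ p.betaR * √(invForm Λ x x) := by gcongr
  · have : Measurable[S.infoRew k] (S.traj j) := by
      rcases hj.lt_or_eq with h | rfl
      · exact (measurable_traj_infoIdx h).mono
          ((infoIdx_le_infoTraj k).trans (infoTraj_le_infoRew k)) le_rfl
      · exact measurable_traj_infoRew j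
    exact (measurable_from_top (f := fun τ : Trajectory X A H => τ.featAll i)).comp this
  · have hle := (infoIdx_le_infoTraj (S := S) k).trans (infoTraj_le_infoRew k)
    exact ((measurable_agg_infoIdx hj).mono hle le_rfl).sub
      ((measurable_from_top (f := fun τ : Trajectory X A H => τ.featAll ⬝ᵥ M.rewardVec)).comp
        ((measurable_traj_infoIdx hj).mono hle le_rfl))

lemma abs_kernelBackup_le {h : Fin H} {u : X → ℝ} {B : ℝ} (hu : ∀ x, |u x| ≤ B) (q : X × A) :
    |kernelBackup M.P h u q| ≤ B := by
  refine (Finset.abs_sum_le_sum_abs _ _).trans ?_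
  have hP := M.P_mem h q.1 q.2
  calc _ ≤ ∑ x', M.P h q.1 q.2 x' * B := by
        refine Finset.sum_le_sum fun x' _ => ?_
        rw [abs_mul, abs_of_nonneg (hP.1 x')]
        exact mul_le_mul_of_nonneg_left (hu x') (hP.1 x')
    _ = B := by rw [← Finset.sum_mul, hP.2, one_mul]

/-- The noise of the transition at step `h`, as seen by the function `u`. -/
def transNoise (M : MDP X A H) (h : Fin H) (u : X → ℝ) (τ : Trajectory X A H) : ℝ :=
  u (τ.next h) - kernelBackup M.P h u (τ.pair h)

lemma abs_transNoise_le {h : Fin H} {u : X → ℝ} {B : ℝ} (hu : ∀ x, |u x| ≤ B)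
    (τ : Trajectory X A H) : |transNoise M h u τ| ≤ 2 * B := by
  refine (abs_sub _ _).trans ?_
  linarith [hu (τ.next h), abs_kernelBackup_le (M := M) (h := h) hu (τ.pair h)]

/-- The trajectories before episode `k` and the state-action pair at step `h` of episode `k`. -/
def pairHistory (S : Interaction X A H p.m Ω) (h : Fin H) (k : ℕ) (ω : Ω) :
    (Fin k → Trajectory X A H) × (X × A) :=
  (fun j => S.traj j ω, (S.traj k ω).pair h)

lemma IsRun.comap_pairHistory_le (hS : IsRun μ M p K S) (h : Fin H) (k : ℕ) :
    MeasurableSpace.comap (pairHistory S h k) ⊤ ≤ mΩ := by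
  rintro s ⟨E, -, rfl⟩
  have h1 : Measurable fun ω => (fun j : Fin k => S.traj j ω, S.traj k ω) :=
    (measurable_pi_lambda _ fun j : Fin k => hS.meas_traj j).prodMk (hS.meas_traj k)
  exact h1 (MeasurableSet.of_discrete
    (s := (fun q : (Fin k → Trajectory X A H) × Trajectory X A H => (q.1, q.2.pair h)) ⁻¹' E))

lemma IsRun.isNoise_transNoise [Nonempty A] (hS : IsRun μ M p K S) (h : Fin H) {u : X → ℝ}
    {B : ℝ} (hu : ∀ x, |u x| ≤ B) {k : ℕ} (hk : k < K) :
    IsNoise μ (MeasurableSpace.comap (pairHistory S h k) ⊤)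
      fun ω => transNoise M h u (S.traj k ω) := by
  rintro Z hZ -
  -- The history takes finitely many values, so a test function is a function of it and is
  -- automatically bounded.
  obtain ⟨z, rfl⟩ : ∃ z, Z = z ∘ pairHistory S h k := by
    let _ : MeasurableSpace ((Fin k → Trajectory X A H) × (X × A)) := ⊤
    obtain ⟨z, -, hz⟩ := hZ.exists_eq_measurable_comp
    exact ⟨z, hz⟩
  have hB : 0 ≤ B := (abs_nonneg _).trans (hu M.init)
  obtain ⟨C, hC⟩ := (Set.finite_range fun q => |z q|).bddAbove
  have hC' : ∀ q, |z q| ≤ C := fun q => hC ⟨q, rfl⟩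
  have hpre : Measurable[S.infoTraj k] fun ω (j : Fin k) => S.traj j ω :=
    @measurable_pi_lambda Ω (Fin k) _ (S.infoTraj k) _ _ fun j =>
      (measurable_traj_infoIdx j.2).mono (infoIdx_le_infoTraj k) le_rfl
  have key := (integral_eq_of_condLaw (mΩ := mΩ) (μ := μ) (hS.infoTraj_le k) (hS.meas_traj k)
    (hS.law_traj k hk)
    -- The law is prescribed for whole trajectories, before the pair at step `h` is revealed. The
    -- pair is therefore treated as part of the draw, and the average vanishes because the next
    -- state is centred given the pair.
    (G := fun ω τ => z (fun j => S.traj j ω, τ.pair h) * transNoise M h u τ)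
    (fun τ => ((Measurable.of_discrete
      (f := fun q : Fin k → Trajectory X A H => z (q, τ.pair h))).comp hpre).mul_const _)
    (fun τ => ⟨C * (2 * B), Filter.Eventually.of_forall fun ω => by
      rw [abs_mul]
      exact mul_le_mul (hC' _) (abs_transNoise_le hu τ) (abs_nonneg _)
        ((abs_nonneg _).trans (hC' (fun j => S.traj j ω, τ.pair h)))⟩)).2.2
  refine Eq.trans key ?_
  refine (integral_congr_ae (Filter.Eventually.of_forall fun ω => ?_)).trans (integral_zero Ω ℝ)
  refine sum_trajProb_mul_eq_zero (isPolicy_policy k (S.idx k ω)) h (f := fun x a x' =>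
    z (fun j => S.traj j ω, (x, a)) * (u x' - kernelBackup M.P h u (x, a))) fun x a => ?_
  have hP := M.P_mem h x a
  have e : ∀ x', M.P h x a x' * (z (fun j => S.traj j ω, (x, a)) *
      (u x' - kernelBackup M.P h u (x, a))) = z (fun j => S.traj j ω, (x, a)) *
      (M.P h x a x' * u x' - M.P h x a x' * kernelBackup M.P h u (x, a)) := fun x' => by ring
  rw [Finset.sum_congr rfl fun x' _ => e x', ← Finset.mul_sum, Finset.sum_sub_distrib,
    ← Finset.sum_mul, hP.2, one_mul]
  simp [kernelBackup]

/-- Self-normalized concentration of the transition noise. -/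
lemma IsRun.measure_transNoise_le [Nonempty A] (hS : IsRun μ M p K S) (h : Fin H) {u : X → ℝ}
    {B : ℝ} (hB : 0 < B) (hu : ∀ x, |u x| ≤ B) {n : Type*} [Fintype n] [DecidableEq n]
    (f : X × A → n → ℝ) {k : ℕ} (hk : k ≤ K) {ε : ℝ} (hε : 0 < ε) :
    μ {ω | (2 * B) ^ 2 * (Real.log ((gram 1 (fun τ => f ((S.traj τ ω).pair h)) k).det /
        (gram 1 (fun τ => f ((S.traj τ ω).pair h)) 0).det) + 2 * Real.log (1 / ε)) <
      invForm (gram 1 (fun τ => f ((S.traj τ ω).pair h)) k)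
        (∑ τ ∈ Finset.range k, transNoise M h u (S.traj τ ω) • f ((S.traj τ ω).pair h))
        (∑ τ ∈ Finset.range k, transNoise M h u (S.traj τ ω) • f ((S.traj τ ω).pair h))} ≤
      ENNReal.ofReal ε := by
  have hcomap : ∀ (k : ℕ) (g : (Fin k → Trajectory X A H) × (X × A) → ℝ),
      Measurable[MeasurableSpace.comap (pairHistory S h k) ⊤] fun ω => g (pairHistory S h k ω) :=
    fun k g s _ => ⟨g ⁻¹' s, trivial, rfl⟩
  refine measure_selfNorm_le (μ := μ) one_pos (by positivity) hε
    (φ := fun τ ω => f ((S.traj τ ω).pair h)) (ε := fun τ ω => transNoise M h u (S.traj τ ω))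
    (𝓕 := fun k => MeasurableSpace.comap (pairHistory S h k) ⊤)
    (hS.comap_pairHistory_le h) (fun j _ => (measurable_from_top (f := transNoise M h u)).comp (hS.meas_traj j))
    (fun j _ => Filter.Eventually.of_forall fun ω => abs_transNoise_le hu _)
    (fun k _ j hj i => ?_) (fun k _ j hj => hcomap k fun q => transNoise M h u (q.1 ⟨j, hj⟩))
    (fun j hj => hS.isNoise_transNoise h hu hj) hk
  rcases hj.lt_or_eq with h1 | rfl
  · exact hcomap k fun q => f ((q.1 ⟨j, h1⟩).pair h) i
  · exact hcomap j fun q => f q.2 i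

end Run

lemma log_det_gram_one_le {n : Type*} [Fintype n] [DecidableEq n] {φ : ℕ → n → ℝ}
    (hφ : ∀ τ, φ τ ⬝ᵥ φ τ ≤ 1) {k K : ℕ} (hk : k ≤ K) :
    Real.log ((gram 1 φ k).det / (gram 1 φ 0).det) ≤ Fintype.card n * Real.log (1 + K) := by
  have h0 : (gram 1 φ 0).det = 1 := by simp [gram_zero]
  have hk' : (k : ℝ) ≤ K := by exact_mod_cast hk
  rw [h0, div_one, ← Real.log_pow]
  refine Real.log_le_log (det_gram_pos one_pos k) ((det_gram_le one_pos hφ k).trans ?_)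
  rw [mul_one]
  gcongr

/-! ### From transition noise to errors of the empirical kernel. -/

section Deterministic

variable {X A : Type*} [Fintype X] [Fintype A] [DecidableEq X] [DecidableEq A] {H : ℕ}
  {M : MDP X A H} {t : ℕ → Trajectory X A H}

/-- The error of the empirical kernel in terms of the transition noise. -/
lemma empKernel_sub_eq (k : ℕ) (h : Fin H) (u : X → ℝ) (q : X × A) :
    kernelBackup (empKernel t k) h u q - kernelBackup M.P h u q =
      ((∑ τ ∈ Finset.range k, if (t τ).pair h = q then transNoise M h u (t τ) else 0) -
        kernelBackup M.P h u q) / (1 + visits t k h q) := by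
  have hv := visits_nonneg (traj := t) k h q
  have hpos : 1 + visits t k h q ≠ 0 := by positivity
  rw [kernelBackup_empKernel, eq_div_iff hpos, sub_mul, div_mul_cancel₀ _ hpos]
  have : (∑ τ ∈ Finset.range k, if (t τ).pair h = q then transNoise M h u (t τ) else 0) =
      (∑ τ ∈ Finset.range k, if (t τ).pair h = q then u ((t τ).next h) else 0) -
        visits t k h q * kernelBackup M.P h u q := by
    rw [visits, Finset.sum_mul, ← Finset.sum_sub_distrib]
    refine Finset.sum_congr rfl fun τ _ => ?_
    split_ifs with h1
    · rw [transNoise, h1, one_mul]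
    · simp
  rw [this]
  ring

lemma gram_visit_eq_diagonal (k : ℕ) (h : Fin H) (q : X × A) :
    gram 1 (fun τ (_ : Unit) => if (t τ).pair h = q then (1 : ℝ) else 0) k =
      diagonal fun _ => 1 + visits t k h q := by
  ext i j
  simp only [gram, Matrix.add_apply, Matrix.smul_apply, one_apply, Matrix.sum_apply,
    vecMulVec_apply, diagonal_apply, visits, smul_eq_mul, if_true, mul_one]
  congr 1
  exact Finset.sum_congr rfl fun τ _ => by split_ifs <;> norm_num

/-- Bounds for sign vectors control the error of the empirical kernel for all functions. -/
lemma abs_empKernel_sub_le_of_sign {k : ℕ} {h : Fin H} {q : X × A} {c : ℝ}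
    (hs : ∀ s : X → Bool, |kernelBackup (empKernel t k) h (fun x => if s x then 1 else -1) q -
      kernelBackup M.P h (fun x => if s x then 1 else -1) q| ≤ c)
    {V : X → ℝ} {B : ℝ} (hV : ∀ x, |V x| ≤ B) :
    |kernelBackup (empKernel t k) h V q - kernelBackup M.P h V q| ≤ B * c := by
  classical
  have hB : 0 ≤ B := (abs_nonneg _).trans (hV q.1)
  have e : ∀ V : X → ℝ, kernelBackup (empKernel t k) h V q - kernelBackup M.P h V q =
      ∑ x, (empKernel t k h q.1 q.2 x - M.P h q.1 q.2 x) * V x := fun V => by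
    simp only [kernelBackup, sub_mul, Finset.sum_sub_distrib]
  have h1 := hs fun x => decide (0 ≤ empKernel t k h q.1 q.2 x - M.P h q.1 q.2 x)
  rw [e] at h1 ⊢
  refine (Finset.abs_sum_le_sum_abs _ _).trans ?_
  refine le_trans ?_ (mul_le_mul_of_nonneg_left ((le_abs_self _).trans h1) hB)
  rw [Finset.mul_sum]
  refine Finset.sum_le_sum fun x _ => ?_
  rw [abs_mul, mul_comm]
  refine mul_le_mul (hV x) (le_of_eq ?_) (abs_nonneg _) hB
  by_cases h0 : 0 ≤ empKernel t k h q.1 q.2 x - M.P h q.1 q.2 x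
  · rw [abs_of_nonneg h0]; simp only [h0, decide_true, if_true, mul_one]
  · rw [abs_of_neg (not_le.1 h0)]; simp [h0]

end Deterministic

/-! ### Failure probabilities of the seven events. -/

section Run

variable {X A : Type*} [Fintype X] [Fintype A] [DecidableEq X] [DecidableEq A] {H : ℕ}
  {Ω : Type*} [mΩ : MeasurableSpace Ω] {μ : Measure Ω} [IsProbabilityMeasure μ]
  {M : MDP X A H} {p : Params} {K : ℕ} {S : Interaction X A H p.m Ω}

/-- The empirical backups of fixed functions concentrate. -/
lemma IsRun.measure_fixedValue_le [Nonempty A] (hS : IsRun μ M p K S) {u : Fin H → X → ℝ} {B : ℝ}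
    (hB : 0 < B) (hu : ∀ h x, |u h x| ≤ B) {ε : ℝ} (hε : 0 < ε)
    (hb : 2 * ((2 * B) ^ 2 * (Fintype.card X * Fintype.card A * Real.log (1 + K) +
      2 * Real.log (K * H / ε))) + 2 * (Fintype.card X * Fintype.card A * B ^ 2) ≤ p.betaP ^ 2) :
    μ {ω | ∃ i : Fin K × Fin H, ¬ ∑ q, (1 + visits (S.traj · ω) i.1 i.2 q) *
      (kernelBackup (empKernel (S.traj · ω) i.1) i.2 (u i.2) q -
        kernelBackup M.P i.2 (u i.2) q) ^ 2 ≤ p.betaP ^ 2} ≤ ENNReal.ofReal ε := by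
  refine measure_exists_le fun ⟨k, h⟩ => ?_
  have hK : (0 : ℝ) < K := by exact_mod_cast k.pos
  have hH : (0 : ℝ) < H := by exact_mod_cast h.pos
  simp only [Fintype.card_prod, Fintype.card_fin, Nat.cast_mul]
  refine (measure_mono fun ω hω => ?_).trans (hS.measure_transNoise_le h hB (hu h)
    (fun q => Pi.single q 1) k.2.le (ε := ε / (K * H)) (by positivity))
  by_contra hcon
  refine hω ?_
  simp only [Set.mem_ofPred_eq, not_lt] at hcon
  have hlog := log_det_gram_one_le (φ := fun τ => (Pi.single ((S.traj τ ω).pair h) 1 : X × A → ℝ))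
    (fun τ => by simp) k.2.le
  have e := invForm_gram_feat (traj := (S.traj · ω)) k h
    (∑ τ ∈ Finset.range k, transNoise M h (u h) (S.traj τ ω) • Pi.single ((S.traj τ ω).pair h) 1)
    (∑ τ ∈ Finset.range k, transNoise M h (u h) (S.traj τ ω) • Pi.single ((S.traj τ ω).pair h) 1)
  simp only [Trajectory.feat_eq] at e
  rw [e, one_div_div] at hcon
  have hsum : ∀ q, (∑ τ ∈ Finset.range k, transNoise M h (u h) (S.traj τ ω) •
      (Pi.single ((S.traj τ ω).pair h) 1 : X × A → ℝ)) q =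
      ∑ τ ∈ Finset.range k, if (S.traj τ ω).pair h = q then
        transNoise M h (u h) (S.traj τ ω) else 0 := fun q => by
    simp [Finset.sum_apply, Pi.single_apply, eq_comm]
  simp only [hsum] at hcon
  -- The numerator of the error is the noise sum minus the regularization bias; with (s - b)² ≤ 2s²
  -- + 2b² the noise parts add up to the self-normalized form.
  have hle : ∀ q, (1 + visits (S.traj · ω) k h q) *
      (kernelBackup (empKernel (S.traj · ω) k) h (u h) q - kernelBackup M.P h (u h) q) ^ 2 ≤
      2 * ((∑ τ ∈ Finset.range k, if (S.traj τ ω).pair h = q then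
        transNoise M h (u h) (S.traj τ ω) else 0) * (∑ τ ∈ Finset.range k,
          if (S.traj τ ω).pair h = q then transNoise M h (u h) (S.traj τ ω) else 0) /
            (1 + visits (S.traj · ω) k h q)) + 2 * B ^ 2 := fun q => by
    have hv := visits_nonneg (traj := (S.traj · ω)) k h q
    rw [empKernel_sub_eq]
    set s := ∑ τ ∈ Finset.range k, if (S.traj τ ω).pair h = q then
      transNoise M h (u h) (S.traj τ ω) else 0
    set n := visits (S.traj · ω) k h q
    have hP : kernelBackup M.P h (u h) q ^ 2 ≤ B ^ 2 :=
      sq_le_sq' (abs_le.1 (abs_kernelBackup_le (hu h) q)).1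
        (abs_le.1 (abs_kernelBackup_le (hu h) q)).2
    set b := kernelBackup M.P h (u h) q
    have h1 : (1 + n) * ((s - b) / (1 + n)) ^ 2 = (s - b) ^ 2 / (1 + n) := by
      field_simp
    have h2 : (s - b) ^ 2 / (1 + n) ≤ (2 * (s * s) + 2 * b ^ 2) / (1 + n) := by
      gcongr
      nlinarith [sq_nonneg (s + b)]
    have h3 : b ^ 2 / (1 + n) ≤ B ^ 2 :=
      (div_le_self (sq_nonneg b) (by linarith)).trans hP
    rw [h1]
    refine h2.trans ?_
    rw [add_div, mul_div_assoc 2 (s * s), mul_div_assoc 2 (b ^ 2)]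
    linarith
  refine (Finset.sum_le_sum fun q _ => hle q).trans ?_
  rw [Finset.sum_add_distrib, ← Finset.mul_sum, Finset.sum_const, Finset.card_univ, nsmul_eq_mul]
  refine le_trans ?_ hb
  rw [Fintype.card_prod, Nat.cast_mul] at hlog ⊢
  have h1 := hcon.trans (mul_le_mul_of_nonneg_left (add_le_add_left hlog
    (2 * Real.log (K * H / ε))) (sq_nonneg (2 * B)))
  linarith

/-- The empirical kernels concentrate uniformly. -/
lemma IsRun.measure_kernel_le [Nonempty A] (hS : IsRun μ M p K S) {cT ε : ℝ} (hε : 0 < ε)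
    (hb : 2 * √(Real.log (1 + K) +
      2 * Real.log (K * (H * (Fintype.card X * Fintype.card A * 2 ^ Fintype.card X)) / ε)) + 1 ≤
        cT) :
    μ {ω | ∃ i : Fin K × Fin H × (X × A) × (X → Bool),
      ¬ |kernelBackup (empKernel (S.traj · ω) i.1) i.2.1 (fun x => if i.2.2.2 x then 1 else -1)
          i.2.2.1 - kernelBackup M.P i.2.1 (fun x => if i.2.2.2 x then 1 else -1) i.2.2.1| ≤
        cT * (1 / √(1 + visits (S.traj · ω) i.1 i.2.1 i.2.2.1))} ≤ ENNReal.ofReal ε := by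
  refine measure_exists_le fun ⟨k, h, q, s⟩ => ?_
  have hX : Nonempty X := ⟨M.init⟩
  have hK : (0 : ℝ) < K := by exact_mod_cast k.pos
  have hH : (0 : ℝ) < H := by exact_mod_cast h.pos
  have hX' : (0 : ℝ) < Fintype.card X := by exact_mod_cast Fintype.card_pos
  have hA' : (0 : ℝ) < Fintype.card A := by exact_mod_cast Fintype.card_pos
  have hcard : ((Fintype.card (Fin K × Fin H × (X × A) × (X → Bool)) : ℕ) : ℝ) =
      K * (H * (Fintype.card X * Fintype.card A * 2 ^ Fintype.card X)) := by simp
  rw [hcard]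
  set u : X → ℝ := fun x => if s x then 1 else -1 with hu
  have hu1 : ∀ x, |u x| ≤ 1 := fun x => by simp only [hu]; split_ifs <;> simp
  refine (measure_mono fun ω hω => ?_).trans (hS.measure_transNoise_le h one_pos hu1
    -- A one-dimensional feature for one pair: its log-determinant is at most log (1 + K) without
    -- the factor d, and the union over pairs and sign vectors is paid inside the logarithm.
    (fun q' (_ : Unit) => if q' = q then 1 else 0) k.2.le
    (ε := ε / (K * (H * (Fintype.card X * Fintype.card A * 2 ^ Fintype.card X)))) (by positivity))
  by_contra hcon
  refine hω ?_
  simp only [Set.mem_ofPred_eq, not_lt] at hcon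
  have hlog := log_det_gram_one_le
    (φ := fun τ (_ : Unit) => if (S.traj τ ω).pair h = q then (1 : ℝ) else 0)
    (fun τ => by by_cases hq : (S.traj τ ω).pair h = q <;> simp [dotProduct, hq]) k.2.le
  have hv := visits_nonneg (traj := (S.traj · ω)) k h q
  have h0 : 0 < 1 + visits (S.traj · ω) k h q := by linarith
  set T := ∑ τ ∈ Finset.range k, if (S.traj τ ω).pair h = q then
    transNoise M h u (S.traj τ ω) else 0 with hT
  set L := Real.log (1 + K) +
    2 * Real.log (K * (H * (Fintype.card X * Fintype.card A * 2 ^ Fintype.card X)) / ε) with hL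
  have hsum : (∑ τ ∈ Finset.range k, transNoise M h u (S.traj τ ω) •
      (fun _ : Unit => if (S.traj τ ω).pair h = q then (1 : ℝ) else 0)) = fun _ => T := by
    funext i
    simp [Finset.sum_apply, hT]
  rw [hsum, one_div_div] at hcon
  have hinv : invForm (gram 1 (fun τ (_ : Unit) => if (S.traj τ ω).pair h = q then
      (1 : ℝ) else 0) k) (fun _ => T) (fun _ => T) = T ^ 2 / (1 + visits (S.traj · ω) k h q) := by
    rw [gram_visit_eq_diagonal (t := (S.traj · ω)), invForm, inv_diagonal_of_pos fun _ => h0]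
    simp [dotProduct, mulVec_diagonal]
    ring
  rw [hinv] at hcon
  have h4 : T ^ 2 / (1 + visits (S.traj · ω) k h q) ≤ (2 * 1) ^ 2 * L := by
    refine hcon.trans (mul_le_mul_of_nonneg_left ?_ (by norm_num))
    rw [Fintype.card_unit, Nat.cast_one, one_mul] at hlog
    linarith
  set n := visits (S.traj · ω) k h q
  have hr : 1 ≤ √(1 + n) := Real.one_le_sqrt.2 (by linarith)
  have hr2 : √(1 + n) ^ 2 = 1 + n := Real.sq_sqrt h0.le
  have h5 : |T| ≤ 2 * √L * √(1 + n) := by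
    rw [div_le_iff₀ h0] at h4
    have hL0 : 0 ≤ L := by
      by_contra hneg
      nlinarith [sq_nonneg T, not_le.1 hneg]
    apply abs_le_of_sq_le_sq _ (by positivity)
    rw [mul_pow, mul_pow, Real.sq_sqrt hL0, hr2]
    linarith
  have h6 := abs_kernelBackup_le (M := M) (h := h) hu1 q
  change |kernelBackup (empKernel (S.traj · ω) k) h u q - kernelBackup M.P h u q| ≤ _
  rw [empKernel_sub_eq, abs_div, abs_of_pos h0, div_le_iff₀ h0]
  have h7 : cT * (1 / √(1 + n)) * (1 + n) = cT * √(1 + n) := by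
    nth_rewrite 2 [← hr2]
    field_simp
  rw [h7]
  calc _ ≤ 2 * √L * √(1 + n) + 1 := (abs_sub _ _).trans (add_le_add h5 h6)
    _ ≤ (2 * √L + 1) * √(1 + n) := by nlinarith
    _ ≤ cT * √(1 + n) := by gcongr

/-- The perturbations are bounded relative to their covariance. -/
lemma IsRun.measure_noise_le (hS : IsRun μ M p K S) (hp : p.lamP = 1) (hr : 0 < p.lamR)
    {βZ ε : ℝ} (hβ : 0 ≤ βZ) (hb : p.m * (√2 ^ (Fintype.card X * Fintype.card A * H) *
      Real.exp (-(βZ ^ 2 / 4))) ≤ ε / K) :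
    μ {ω | ∃ k : Fin K, epochStart p (S.traj · ω) k = k ∧
      ∃ i, S.ζ k ω i ∉ boundedNoise (covNoise p (S.traj · ω) k) βZ} ≤ ENNReal.ofReal ε := by
  refine measure_exists_le fun k => ?_
  rw [Fintype.card_fin]
  refine hS.measure_noise_event_le k.2
    (Bad := fun t => {z | ∃ i, z i ∉ boundedNoise (covNoise p t k) βZ})
    (fun t t' htt => by rw [covNoise_congr htt]) (fun t => ?_) fun t => ?_
  · have : {z : Fin p.m → Noise X A H | ∃ i, z i ∉ boundedNoise (covNoise p t k) βZ} =
        ⋃ i, (fun z => z i) ⁻¹' (boundedNoise (covNoise p t k) βZ)ᶜ := by ext z; simp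
    rw [this]
    exact MeasurableSet.iUnion fun i =>
      measurable_pi_apply i (measurableSet_boundedNoise _ _).compl
  · refine (pi_multivariateGaussian_boundedNoise (posSemidef_covNoise hp hr k) hβ).trans ?_
    rw [← ENNReal.ofReal_natCast, ← ENNReal.ofReal_mul (by positivity)]
    apply ENNReal.ofReal_le_ofReal
    simpa [Fintype.card_prod] using hb

/-- In every epoch some perturbation is optimistic. -/
lemma IsRun.measure_optimism_le (hS : IsRun μ M p K S) (hp : p.lamP = 1) (hr : 0 < p.lamR)
    (π : Fin H → X → A → ℝ) {ε : ℝ} (hb : ((8 : ℝ) / 9) ^ p.m ≤ ε / K) :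
    μ {ω | ∃ k : Fin K, epochStart p (S.traj · ω) k = k ∧
      ∀ i, occ (empKernel (S.traj · ω) k) π 0 M.init ⬝ᵥ (S.ζ k ω i) <
        √(occ (empKernel (S.traj · ω) k) π 0 M.init ⬝ᵥ covNoise p (S.traj · ω) k *ᵥ
          occ (empKernel (S.traj · ω) k) π 0 M.init)} ≤ ENNReal.ofReal ε := by
  refine measure_exists_le fun k => ?_
  rw [Fintype.card_fin]
  refine hS.measure_noise_event_le k.2
    (Bad := fun t => {z | ∀ i, occ (empKernel t k) π 0 M.init ⬝ᵥ ⇑(z i) <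
      √(occ (empKernel t k) π 0 M.init ⬝ᵥ covNoise p t k *ᵥ occ (empKernel t k) π 0 M.init)})
    (fun t t' htt => by rw [covNoise_congr htt, empKernel_congr htt]) (fun t => ?_) fun t => ?_
  · simp only [Set.ofPred_forall]
    refine MeasurableSet.iInter fun i => measurableSet_lt ?_ measurable_const
    simp only [dotProduct]
    fun_prop
  · exact (pi_multivariateGaussian_optimism (posSemidef_covNoise hp hr k) _).trans
      (ENNReal.ofReal_le_ofReal hb)

/-- Unclipped estimates contain Gaussian noise and are unbounded off the favourable event, while the
martingale inequality needs a bound everywhere. -/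
lemma abs_clip_le {B x : ℝ} (hB : 0 ≤ B) : |max (-B) (min B x)| ≤ B :=
  abs_le.2 ⟨le_max_left _ _, max_le (by linarith) (min_le_left _ _)⟩

/-- The random choice of the ensemble member concentrates. -/
lemma IsRun.measure_index_le (hS : IsRun μ M p K S) (hp : p.lamP = 1) (hK : 0 < K) (hm : 0 < p.m)
    {B ε : ℝ} (hB : 0 < B) (hε : 0 < ε) (hε1 : ε < 1) :
    μ {ω | 2 * B * √(2 * K * Real.log (1 / ε)) < ∑ k ∈ Finset.range K,
      (∑ j, weights p M.init (S.traj · ω) (S.agg · ω) (S.ζ · ω) k j *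
        max (-B) (min B (initValueHat p M.init (S.traj · ω) (S.agg · ω) (S.ζ · ω) k j)) -
        max (-B) (min B (initValueHat p M.init (S.traj · ω) (S.agg · ω) (S.ζ · ω) k
          (S.idx k ω))))} ≤ ENNReal.ofReal ε := by
  set c : ℕ → Ω → Fin p.m → ℝ := fun k ω j =>
    max (-B) (min B (initValueHat p M.init (S.traj · ω) (S.agg · ω) (S.ζ · ω) k j)) with hc
  set w : ℕ → Ω → Fin p.m → ℝ := fun k ω =>
    weights p M.init (S.traj · ω) (S.agg · ω) (S.ζ · ω) k with hw
  have hcB : ∀ k ω j, |c k ω j| ≤ B := fun k ω j => abs_clip_le hB.le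
  have hcm : ∀ {k k' : ℕ}, k ≤ k' → ∀ j, Measurable[S.infoIdx k'] fun ω => c k ω j := by
    intro k k' hkk j
    have h1 := @measurable_initValueHat Ω (S.infoIdx k') X A _ _ _ _ H p S.agg S.ζ k S.traj hp
      M.init (fun i hi => measurable_traj_infoIdx (hi.trans_le hkk))
      (fun i hi => measurable_agg_infoIdx (hi.trans_le hkk))
      (fun i hi => measurable_ζ_past_infoIdx (hi.trans hkk)) j
    exact Measurable.max measurable_const (Measurable.min measurable_const h1)
  have hwm : ∀ {k k' : ℕ}, k ≤ k' → ∀ j, Measurable[S.infoIdx k'] fun ω => w k ω j := by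
    intro k k' hkk j
    exact @measurable_weights Ω (S.infoIdx k') X A _ _ _ _ H p S.agg S.ζ k S.traj hp
      M.init (fun i hi => measurable_traj_infoIdx (hi.trans_le hkk))
      (fun i hi => measurable_agg_infoIdx (hi.trans_le hkk))
      (fun i hi => measurable_ζ_past_infoIdx (hi.le.trans hkk)) j
  have hsm : ∀ {k k' : ℕ}, k ≤ k' →
      Measurable[S.infoIdx k'] fun ω => ∑ j, w k ω j * c k ω j := fun hkk =>
    @Finset.measurable_sum _ _ _ _ _ _ (S.infoIdx _) _ _ fun j _ => (hwm hkk j).mul (hcm hkk j)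
  refine measure_sum_noise_le (μ := μ) (y := fun k ω => ∑ j, w k ω j * c k ω j -
    c k ω (S.idx k ω)) (𝓕 := S.infoIdx) hK (by positivity) hε hε1 hS.infoIdx_le
    (fun k _ => ?_) (fun k _ ω => ?_) (fun k _ j hj => ?_) fun k hk => ?_
  · exact ((hsm le_rfl).mono (hS.infoIdx_le k) le_rfl).sub (measurable_comp_countable
      (hS.meas_idx k) (f := fun j ω => c k ω j) fun j =>
        (hcm le_rfl j).mono (hS.infoIdx_le k) le_rfl)
  · obtain ⟨hpos, hsum⟩ := weights_pos_and_sum (p := p) (traj := (S.traj · ω)) (v := (S.agg · ω))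
      (ζ := (S.ζ · ω)) (x₁ := M.init) hm k
    have h1 : |∑ j, w k ω j * c k ω j| ≤ B := by
      refine (Finset.abs_sum_le_sum_abs _ _).trans ?_
      calc _ ≤ ∑ j, w k ω j * B := Finset.sum_le_sum fun j _ => by
            rw [abs_mul, abs_of_pos (hpos j)]
            exact mul_le_mul_of_nonneg_left (hcB k ω j) (hpos j).le
        _ = B := by rw [← Finset.sum_mul, hsum, one_mul]
    exact (abs_sub _ _).trans (by linarith [hcB k ω (S.idx k ω)])
  · exact (hsm hj.le).sub (@measurable_comp_countable Ω (S.infoIdx k) _ _ _ _ _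
      (measurable_idx_infoIdx hj) (fun i ω => c j ω i) fun i => hcm hj.le i)
  · have h := isNoise_of_condLaw (hS.infoIdx_le k) (hS.meas_idx k) (hS.law_idx k hk)
      (c := fun ω j => -c k ω j) (fun j => (hcm le_rfl j).neg)
      fun j => ⟨B, Filter.Eventually.of_forall fun ω => by rw [abs_neg]; exact hcB k ω j⟩
    convert h using 2 with ω
    simp only [mul_neg, Finset.sum_neg_distrib]
    ring

/-- The bonuses of the observed trajectories concentrate. -/
lemma IsRun.measure_bonus_le [Nonempty A] (hS : IsRun μ M p K S) (hp : p.lamP = 1) (hK : 0 < K)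
    {βZ c R ε : ℝ} (hR : 0 < R)
    (hbonus0 : ∀ (t : ℕ → Trajectory X A H) k τ, 0 ≤ bonus p t βZ c k τ)
    (hbonus : ∀ (t : ℕ → Trajectory X A H) k τ, bonus p t βZ c k τ ≤ R) (hε : 0 < ε) (hε1 : ε < 1) :
    μ {ω | R * √(2 * K * Real.log (1 / ε)) < ∑ k ∈ Finset.range K,
      (∑ τ, trajProb M (policy p (S.traj · ω) (S.agg · ω) (S.ζ · ω) k (S.idx k ω)) τ *
        bonus p (S.traj · ω) βZ c k τ - bonus p (S.traj · ω) βZ c k (S.traj k ω))} ≤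
      ENNReal.ofReal ε := by
  have htm : ∀ {j k : ℕ}, j < k → Measurable[S.infoTraj k] (S.traj j) := fun h =>
    (measurable_traj_infoIdx h).mono (infoIdx_le_infoTraj _) le_rfl
  have hbm : ∀ {k k' : ℕ}, k ≤ k' → ∀ τ,
      Measurable[S.infoTraj k'] fun ω => bonus p (S.traj · ω) βZ c k τ := fun hkk τ =>
    @measurable_bonus Ω (S.infoTraj _) X A _ _ _ _ H p _ S.traj
      (fun j hj => htm (hj.trans_le hkk)) βZ c τ
  have hidx : ∀ {k k' : ℕ}, k ≤ k' → Measurable[S.infoTraj k'] (S.idx k) := by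
    intro k k' hkk
    rcases hkk.lt_or_eq with h | rfl
    · exact (measurable_idx_infoIdx h).mono (infoIdx_le_infoTraj _) le_rfl
    · exact measurable_idx_infoTraj k
  have hpm : ∀ {k k' : ℕ}, k ≤ k' → ∀ h x a, Measurable[S.infoTraj k'] fun ω =>
      policy p (S.traj · ω) (S.agg · ω) (S.ζ · ω) k (S.idx k ω) h x a := by
    intro k k' hkk h x a
    exact @measurable_comp_countable Ω (S.infoTraj k') _ _ _ _ _ (hidx hkk)
      (fun i ω => policy p (S.traj · ω) (S.agg · ω) (S.ζ · ω) k i h x a) fun i =>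
      @measurable_policy Ω (S.infoTraj k') X A _ _ _ _ H p S.agg S.ζ k S.traj hp
        (fun j hj => htm (hj.trans_le hkk))
        (fun j hj => (measurable_agg_infoIdx (hj.trans_le hkk)).mono (infoIdx_le_infoTraj _) le_rfl)
        (fun j hj => (measurable_ζ_past_infoIdx (hj.le.trans hkk)).mono
          (infoIdx_le_infoTraj _) le_rfl) i h x a
  have hsm : ∀ {k k' : ℕ}, k ≤ k' → Measurable[S.infoTraj k'] fun ω =>
      ∑ τ, trajProb M (policy p (S.traj · ω) (S.agg · ω) (S.ζ · ω) k (S.idx k ω)) τ *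
        bonus p (S.traj · ω) βZ c k τ := fun hkk =>
    @Finset.measurable_sum _ _ _ _ _ _ (S.infoTraj _) _ _ fun τ _ =>
      (@measurable_trajProb Ω (S.infoTraj _) X A _ _ _ _ H M _ (hpm hkk) τ).mul (hbm hkk τ)
  refine measure_sum_noise_le (μ := μ) (y := fun k ω =>
    ∑ τ, trajProb M (policy p (S.traj · ω) (S.agg · ω) (S.ζ · ω) k (S.idx k ω)) τ *
        bonus p (S.traj · ω) βZ c k τ - bonus p (S.traj · ω) βZ c k (S.traj k ω))
    (𝓕 := S.infoTraj) hK hR hε hε1 hS.infoTraj_le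
    (fun k _ => ?_) (fun k _ ω => ?_) (fun k _ j hj => ?_) fun k hk => ?_
  · exact ((hsm le_rfl).mono (hS.infoTraj_le k) le_rfl).sub (measurable_comp_countable
      (hS.meas_traj k) (f := fun τ ω => bonus p (S.traj · ω) βZ c k τ) fun τ =>
        (hbm le_rfl τ).mono (hS.infoTraj_le k) le_rfl)
  · have hπ := isPolicy_policy (p := p) (traj := (S.traj · ω)) (v := (S.agg · ω))
      (ζ := (S.ζ · ω)) k (S.idx k ω)
    have h1 : ∑ τ, trajProb M (policy p (S.traj · ω) (S.agg · ω) (S.ζ · ω) k (S.idx k ω)) τ *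
        bonus p (S.traj · ω) βZ c k τ ≤ R := by
      calc _ ≤ ∑ τ, trajProb M (policy p (S.traj · ω) (S.agg · ω) (S.ζ · ω) k (S.idx k ω)) τ * R :=
            Finset.sum_le_sum fun τ _ =>
              mul_le_mul_of_nonneg_left (hbonus _ k τ) (trajProb_nonneg hπ τ)
        _ = R := by rw [← Finset.sum_mul, sum_trajProb hπ, one_mul]
    have h2 : 0 ≤ ∑ τ, trajProb M (policy p (S.traj · ω) (S.agg · ω) (S.ζ · ω) k (S.idx k ω)) τ *
        bonus p (S.traj · ω) βZ c k τ :=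
      Finset.sum_nonneg fun τ _ => mul_nonneg (trajProb_nonneg hπ τ) (hbonus0 _ k τ)
    have h3 := hbonus0 (S.traj · ω) k (S.traj k ω)
    have h4 := hbonus (S.traj · ω) k (S.traj k ω)
    exact abs_le.2 ⟨by linarith, by linarith⟩
  · exact (hsm hj.le).sub (@measurable_comp_countable Ω (S.infoTraj k) _ _ _ _ _
      (htm hj) (fun τ ω => bonus p (S.traj · ω) βZ c j τ) fun τ => hbm hj.le τ)
  · have h := isNoise_of_condLaw (hS.infoTraj_le k) (hS.meas_traj k) (hS.law_traj k hk)
      (c := fun ω τ => -bonus p (S.traj · ω) βZ c k τ) (fun τ => (hbm le_rfl τ).neg)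
      fun τ => ⟨R, Filter.Eventually.of_forall fun ω => by
        rw [abs_neg, abs_of_nonneg (hbonus0 _ k τ)]; exact hbonus _ k τ⟩
    convert h using 2 with ω
    simp only [mul_neg, Finset.sum_neg_distrib]
    rw [played]
    ring

end Run

/-! ### Assembly of the seven events. -/

section Run

variable {X A : Type*} [Fintype X] [Fintype A] [DecidableEq X] [DecidableEq A] {H : ℕ}
  {Ω : Type*} [mΩ : MeasurableSpace Ω] {μ : Measure Ω} [IsProbabilityMeasure μ]
  {M : MDP X A H} {p : Params} {K : ℕ} {S : Interaction X A H p.m Ω}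

/-- The high probability regret bound, for general parameters. -/
lemma IsRun.ofReal_le_measure_regret_le [Nonempty A] (hS : IsRun μ M p K S) (hp : p.lamP = 1)
    (hr : p.lamR = H) (hH : 0 < H) (hK : 0 < K) (hm : 0 < p.m) (hbR : 0 ≤ p.betaR)
    (hbP : 0 ≤ p.betaP) {πstar : Fin H → X → A → ℝ} (hπs : IsPolicy πstar) {ε : ℝ} (hε : 0 < ε)
    (hε1 : ε < 1) {βZ cT B U : ℝ} (hbZ : 0 ≤ βZ) (hcT : 0 ≤ cT) (hB : 0 < B)
    (hηx : 0 < p.etaX) (hηo : Fintype.card A ≠ 1 → 0 < p.etaO) (hηo0 : 0 ≤ p.etaO)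
    (hreward : H * √(Fintype.card X * Fintype.card A * H * Real.log (1 + K) +
      2 * Real.log (K / ε)) + H * √(Fintype.card X * Fintype.card A) ≤ p.betaR)
    (hfixed : 2 * ((2 * H) ^ 2 * (Fintype.card X * Fintype.card A * Real.log (1 + K) +
      2 * Real.log (K * H / ε))) + 2 * (Fintype.card X * Fintype.card A * (H : ℝ) ^ 2) ≤
        p.betaP ^ 2)
    (hkernel : 2 * √(Real.log (1 + K) +
      2 * Real.log (K * (H * (Fintype.card X * Fintype.card A * 2 ^ Fintype.card X)) / ε)) + 1 ≤
        cT)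
    (hnoise : p.m * (√2 ^ (Fintype.card X * Fintype.card A * H) *
      Real.exp (-(βZ ^ 2 / 4))) ≤ ε / K)
    (hopt : ((8 : ℝ) / 9) ^ p.m ≤ ε / K)
    (hBle : H + p.betaR + βZ * √(2 * p.betaR ^ 2 + 2 * H ^ 2 * p.betaP ^ 2) ≤ B)
    (hU : ∀ E : ℝ, (E - 1) * Real.log 2 ≤
      2 * (Fintype.card X * Fintype.card A * H) * Real.log (1 + K) →
      H * (Real.log (Fintype.card A) * E / p.etaO + 2 * p.etaO * B ^ 2 * K) +
      (Real.log p.m * E / p.etaX + 2 * p.etaX * B ^ 2 * K) +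
      2 * B * √(2 * K * Real.log (1 / ε)) + B * (1 + cT * H) * √(2 * K * Real.log (1 / ε)) +
      ((p.betaR + 2 * βZ * p.betaR) *
        √(K * (2 * (Fintype.card X * Fintype.card A * H * Real.log (1 + K)))) +
      (B * cT + βZ * √(2 * H) * p.betaP) *
        (2 * √2 * H * √(Fintype.card X * Fintype.card A * K))) ≤ U) :
    ENNReal.ofReal (1 - 7 * ε) ≤ μ {ω | regret M p K S πstar ω ≤ U} := by
  have hr0 : 0 < p.lamR := by rw [hr]; exact_mod_cast hH
  have hH' : (0 : ℝ) < H := by exact_mod_cast hH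
  have e1 := hS.measure_reward_le hr hH hε hreward
  have e2 := hS.measure_fixedValue_le (u := fun h => M.valueFun πstar h.succ) hH'
    (fun h x => valueFun_bounds hπs _ x) hε hfixed
  have e3 := hS.measure_kernel_le hε hkernel
  have e4 := hS.measure_noise_le hp hr0 hbZ hnoise
  have e5 := hS.measure_optimism_le hp hr0 πstar hopt
  have e6 := hS.measure_index_le hp hK hm hB hε hε1
  have hc : 0 ≤ B * cT := by positivity
  have e7 := hS.measure_bonus_le hp hK (βZ := βZ) (c := B * cT) (R := B * (1 + cT * H))
    (by positivity) (fun t k τ => bonus_nonneg hbR hbZ hc k τ)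
    (fun t k τ => (bonus_le hp hr hH hbR hbZ hc k τ).trans (by linarith)) hε hε1
  set s1 := {ω | ∃ k : Fin K, ¬ ∀ x, |x ⬝ᵥ (thetaHat p (S.traj · ω) (S.agg · ω) k -
    M.rewardVec)| ≤ p.betaR * √(invForm (covAll p (S.traj · ω) k) x x)}
  set s2 := {ω | ∃ i : Fin K × Fin H, ¬ ∑ q, (1 + visits (S.traj · ω) i.1 i.2 q) *
      (kernelBackup (empKernel (S.traj · ω) i.1) i.2 (M.valueFun πstar i.2.succ) q -
        kernelBackup M.P i.2 (M.valueFun πstar i.2.succ) q) ^ 2 ≤ p.betaP ^ 2}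
  set s3 := {ω | ∃ i : Fin K × Fin H × (X × A) × (X → Bool),
      ¬ |kernelBackup (empKernel (S.traj · ω) i.1) i.2.1 (fun x => if i.2.2.2 x then 1 else -1)
          i.2.2.1 - kernelBackup M.P i.2.1 (fun x => if i.2.2.2 x then 1 else -1) i.2.2.1| ≤
        cT * (1 / √(1 + visits (S.traj · ω) i.1 i.2.1 i.2.2.1))}
  set s4 := {ω | ∃ k : Fin K, epochStart p (S.traj · ω) k = k ∧
      ∃ i, S.ζ k ω i ∉ boundedNoise (covNoise p (S.traj · ω) k) βZ}
  set s5 := {ω | ∃ k : Fin K, epochStart p (S.traj · ω) k = k ∧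
      ∀ i, occ (empKernel (S.traj · ω) k) πstar 0 M.init ⬝ᵥ (S.ζ k ω i) <
        √(occ (empKernel (S.traj · ω) k) πstar 0 M.init ⬝ᵥ covNoise p (S.traj · ω) k *ᵥ
          occ (empKernel (S.traj · ω) k) πstar 0 M.init)}
  set s6 := {ω | 2 * B * √(2 * K * Real.log (1 / ε)) < ∑ k ∈ Finset.range K,
      (∑ j, weights p M.init (S.traj · ω) (S.agg · ω) (S.ζ · ω) k j *
        max (-B) (min B (initValueHat p M.init (S.traj · ω) (S.agg · ω) (S.ζ · ω) k j)) -
        max (-B) (min B (initValueHat p M.init (S.traj · ω) (S.agg · ω) (S.ζ · ω) k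
          (S.idx k ω))))}
  set s7 := {ω | B * (1 + cT * H) * √(2 * K * Real.log (1 / ε)) < ∑ k ∈ Finset.range K,
      (∑ τ, trajProb M (policy p (S.traj · ω) (S.agg · ω) (S.ζ · ω) k (S.idx k ω)) τ *
        bonus p (S.traj · ω) βZ (B * cT) k τ - bonus p (S.traj · ω) βZ (B * cT) k (S.traj k ω))}
  -- A cover of the whole space by the regret event and the bad events gives the lower bound by
  -- subadditivity, without measurability of the regret.
  have hcover : (Set.univ : Set Ω) ⊆ {ω | regret M p K S πstar ω ≤ U} ∪
      (s1 ∪ (s2 ∪ (s3 ∪ (s4 ∪ (s5 ∪ (s6 ∪ s7)))))) := by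
    intro ω _
    by_contra hcon
    simp only [Set.mem_union, not_or] at hcon
    obtain ⟨h0, h1, h2, h3, h4, h5, h6, h7⟩ := hcon
    have hg : IsGood M p K πstar (S.traj · ω) (S.agg · ω) (S.ζ · ω) βZ cT := by
      refine ⟨fun k hk => ?_, fun k hk h => ?_, fun k hk h q V C hV => ?_,
        fun k hk hs i => ?_, fun k hk hs => ?_⟩
      · by_contra hc; exact h1 ⟨⟨k, hk⟩, hc⟩
      · by_contra hc; exact h2 ⟨(⟨k, hk⟩, h), hc⟩
      · rw [mul_assoc]
        refine abs_empKernel_sub_le_of_sign (fun s => ?_) hV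
        by_contra hc; exact h3 ⟨(⟨k, hk⟩, h, q, s), hc⟩
      · by_contra hc; exact h4 ⟨⟨k, hk⟩, hs, i, hc⟩
      · by_contra hc
        refine h5 ⟨⟨k, hk⟩, hs, fun i => ?_⟩
        by_contra hi
        exact hc ⟨i, not_lt.1 hi⟩
    exact h0 ((sum_regret_le hg hp hr hH hm hbR hbP hbZ hcT hπs hB hBle hηx hηo hηo0 (S.idx · ω)
      (not_lt.1 h6) (not_lt.1 h7)).trans (hU _ (epochCount_mul_log_two_le hp hr hH K)))
  have hbad : μ (s1 ∪ (s2 ∪ (s3 ∪ (s4 ∪ (s5 ∪ (s6 ∪ s7)))))) ≤ ENNReal.ofReal (7 * ε) := by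
    have e : ENNReal.ofReal (7 * ε) = ENNReal.ofReal ε + (ENNReal.ofReal ε + (ENNReal.ofReal ε +
        (ENNReal.ofReal ε + (ENNReal.ofReal ε + (ENNReal.ofReal ε + ENNReal.ofReal ε))))) := by
      rw [show 7 * ε = ε + (ε + (ε + (ε + (ε + (ε + ε))))) by ring]
      iterate 6 rw [ENNReal.ofReal_add hε.le (by positivity)]
    rw [e]
    exact (measure_union_le _ _).trans (add_le_add e1 <|
      (measure_union_le _ _).trans <| add_le_add e2 <| (measure_union_le _ _).trans <|
      add_le_add e3 <| (measure_union_le _ _).trans <| add_le_add e4 <|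
      (measure_union_le _ _).trans <| add_le_add e5 <| (measure_union_le _ _).trans <|
      add_le_add e6 e7)
  rw [ENNReal.ofReal_sub _ (by positivity), ENNReal.ofReal_one, tsub_le_iff_right,
    ← measure_univ (μ := μ)]
  exact (measure_mono hcover).trans ((measure_union_le _ _).trans (add_le_add le_rfl hbad))

end Run

/-! ### The choice of parameters -/

lemma sqrt_le_of_le_sq {y c : ℝ} (hc : 0 ≤ c) (h : y ≤ c ^ 2) : √y ≤ c :=
  Real.sqrt_le_iff.2 ⟨hc, h⟩

/-- In units of √(DL) the noise part is at most √3 ≤ 7/4 and the bias at most 1; the total 11/4 is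
below 2√2. -/
lemma reward_radius_le {D d h L l₁ l₂ : ℝ} (hD : 1 ≤ D) (hd : d ≤ D) (hh : 0 ≤ h) (hL : 1 ≤ L)
    (h₁ : l₁ ≤ L) (h₂ : l₂ ≤ L) : h * √(D * l₁ + 2 * l₂) + h * √d ≤ 2 * h * √(2 * D * L) := by
  have hDL : D ≤ D * L := le_mul_of_one_le_right (by linarith) hL
  have hLD : L ≤ D * L := le_mul_of_one_le_left (by linarith) hD
  have hs : √(D * L) ^ 2 = D * L := Real.sq_sqrt (by nlinarith)
  have h3 : √(D * l₁ + 2 * l₂) ≤ 7 / 4 * √(D * L) := by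
    refine sqrt_le_of_le_sq (by positivity) ?_
    rw [mul_pow, hs]
    nlinarith [mul_le_mul_of_nonneg_left h₁ (by linarith : (0 : ℝ) ≤ D)]
  have h4 : √d ≤ √(D * L) := Real.sqrt_le_sqrt (hd.trans hDL)
  have h5 : 11 / 8 * √(D * L) ≤ √(2 * D * L) := by
    apply Real.le_sqrt_of_sq_le
    rw [mul_pow, hs]
    nlinarith
  nlinarith

/-- The sign vectors add x log 2 to the logarithm; L ≥ 5 absorbs this and the trailing 1 into the
constant 4.1. -/
lemma kernel_radius_le {x L l₁ l₂ : ℝ} (hx : 1 ≤ x) (hL : 5 ≤ L) (h₁ : l₁ ≤ L)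
    (h₂ : l₂ ≤ L + x * Real.log 2) : 2 * √(l₁ + 2 * l₂) + 1 ≤ 41 / 10 * √(x * L) := by
  have hlog := Real.log_two_lt_d9
  have hxL : 5 * x ≤ x * L := by nlinarith
  have hLx : L ≤ x * L := le_mul_of_one_le_left (by linarith) hx
  have hs : √(x * L) ^ 2 = x * L := Real.sq_sqrt (by nlinarith)
  have h3 : √(l₁ + 2 * l₂) ≤ 182 / 100 * √(x * L) := by
    refine sqrt_le_of_le_sq (by positivity) ?_
    rw [mul_pow, hs]
    nlinarith
  have h4 : 22 / 10 ≤ √(x * L) := by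
    apply Real.le_sqrt_of_sq_le
    nlinarith
  linarith

/-- With s = √(3dhGck) the learning rate is s/(kβ). The epoch term is then at most (13/9)βs and the
quadratic term equals 2βs, together below (7/2)βs. If c = 0 both terms vanish. -/
lemma hedge_bound {d h G c k β E : ℝ} (hd : 0 < d) (hh : 0 < h) (hG : 0 < G) (hc : 0 ≤ c)
    (hk : 0 < k) (hβ : 0 < β) (hE : E ≤ 13 / 3 * (d * h * G)) :
    c * E / √(3 * d * h * G * c / (k * β ^ 2)) +
      2 * √(3 * d * h * G * c / (k * β ^ 2)) * β ^ 2 * k ≤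
      7 / 2 * (β * √(3 * d * h * G * c * k)) := by
  rcases hc.eq_or_lt with rfl | hc
  · simp
  set s := √(3 * d * h * G * c * k) with hs
  have hs0 : 0 < s := Real.sqrt_pos.2 (by positivity)
  have hs2 : s ^ 2 = 3 * d * h * G * c * k := Real.sq_sqrt (by positivity)
  have hη : √(3 * d * h * G * c / (k * β ^ 2)) = s / (k * β) := by
    rw [Real.sqrt_eq_iff_mul_self_eq (by positivity) (by positivity), div_mul_div_comm, ← sq, hs2]
    field_simp
  rw [hη]
  have h1 : c * E / (s / (k * β)) ≤ 13 / 9 * (β * s) := by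
    rw [div_div_eq_mul_div, div_le_iff₀ hs0]
    have : c * E * (k * β) ≤ c * (13 / 3 * (d * h * G)) * (k * β) := by gcongr
    refine this.trans (le_of_eq ?_)
    rw [show 13 / 9 * (β * s) * s = 13 / 9 * β * s ^ 2 by ring, hs2]
    ring
  have h2 : 2 * (s / (k * β)) * β ^ 2 * k = 2 * (β * s) := by field_simp
  rw [h2]
  have : 0 < β * s := by positivity
  linarith

/-- The two logarithms satisfy Gc ≤ L²/4 by AM-GM, and √(3/4) ≤ 7/8. -/
lemma sqrt_hedge_le {d h G c k L : ℝ} (hd : 0 ≤ d) (hh : 0 ≤ h) (hG : 0 ≤ G) (hc : 0 ≤ c)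
    (hk : 0 ≤ k) (hL : G + c ≤ L) :
    √(3 * d * h * G * c * k) ≤ 7 / 8 * (√d * √h * √k * √L ^ 2) := by
  have hL0 : 0 ≤ L := by linarith
  refine sqrt_le_of_le_sq (by positivity) ?_
  have e : (7 / 8 * (√d * √h * √k * √L ^ 2)) ^ 2 =
      49 / 64 * (√d ^ 2 * √h ^ 2 * √k ^ 2 * (√L ^ 2) ^ 2) := by ring
  rw [e, Real.sq_sqrt hd, Real.sq_sqrt hh, Real.sq_sqrt hk, Real.sq_sqrt hL0]
  have h1 : G * c ≤ L ^ 2 / 4 := by nlinarith [sq_nonneg (G - c)]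
  have h2 : d * h * k * (G * c) ≤ d * h * k * (L ^ 2 / 4) := by gcongr
  have h3 : 0 ≤ d * h * k * L ^ 2 := by positivity
  nlinarith

lemma sqrt_const_mul_le {c C u v : ℝ} (hC : 0 ≤ C) (hu : 0 ≤ u) (huv : u ≤ v) (hc : c ≤ C ^ 2) :
    √(c * u) ≤ C * √v := by
  refine sqrt_le_of_le_sq (by positivity) ?_
  rw [mul_pow, Real.sq_sqrt (hu.trans huv)]
  exact mul_le_mul hc huv hu (sq_nonneg C)

/-- The variables are the square roots of K, H, |X||A|, |X| and of the logarithm, so that all terms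
become monomials. Each is dominated by one of the two monomials below U times l⁴. -/
lemma regret_terms_le {k h d x l U B cT bR bZ bP T₁ T₂ w y z q : ℝ} (hk : 0 ≤ k) (hh : 1 ≤ h)
    (hd : 1 ≤ d) (hx : 1 ≤ x) (hl : 2 ≤ l) (hU₁ : k * d ^ 3 * h ^ 8 ≤ U)
    (hU₂ : k * d ^ 3 * h ^ 7 * x ≤ U) (hB0 : 0 ≤ B) (hB : B ≤ 47 * (h ^ 5 * d ^ 2 * l ^ 2))
    (hcT : cT = 41 / 10 * (x * l)) (hbR0 : 0 ≤ bR) (hbR : bR ≤ 3 * (h ^ 3 * d * l))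
    (hbZ0 : 0 ≤ bZ) (hbZ : bZ ≤ 10 / 3 * (d * h * l)) (hbP0 : 0 ≤ bP)
    (hbP : bP ≤ 7 * (h ^ 2 * d * l))
    (hT₁ : T₁ ≤ 7 / 2 * (B * (7 / 8 * (d * h * k * l ^ 2))))
    (hT₂ : T₂ ≤ 7 / 2 * (B * (7 / 8 * (d * h * k * l ^ 2)))) (hw : w ≤ 3 / 2 * (k * l))
    (hy : y ≤ 3 / 2 * (k * d * h * l)) (hz : z ≤ d * k) (hz0 : 0 ≤ z)
    (hq : q ≤ 3 / 2 * h) :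
    h ^ 2 * T₁ + T₂ + 2 * B * w + B * (1 + cT * h ^ 2) * w +
      ((bR + 2 * bZ * bR) * y + (B * cT + bZ * q * bP) * (2 * √2 * h ^ 2 * z)) ≤
      1747 * U * l ^ 4 := by
  have hl0 : 0 ≤ l := by linarith
  have hh0 : 0 ≤ h := by linarith
  have hd0 : 0 ≤ d := by linarith
  have hx0 : 0 ≤ x := by linarith
  have hcT0 : 0 ≤ cT := by rw [hcT]; positivity
  have hU0 : 0 ≤ U := le_trans (by positivity) hU₁
  -- Since l ≥ 2, a term with fewer logarithms gains a factor 2 for each missing power of l.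
  have hln : ∀ n ≤ 4, l ^ n * 2 ^ (4 - n) ≤ l ^ 4 := fun n hn => by
    calc l ^ n * 2 ^ (4 - n) ≤ l ^ n * l ^ (4 - n) := by gcongr
      _ = l ^ 4 := by rw [← pow_add]; congr 1; omega
  obtain ⟨V, hV⟩ : ∃ V, U * l ^ 4 = V := ⟨_, rfl⟩
  have hV0 : 0 ≤ V := by rw [← hV]; positivity
  have mono₁ : ∀ i ≤ 8, ∀ j ≤ 3, ∀ n ≤ 4,
      k * d ^ j * h ^ i * (l ^ n * 2 ^ (4 - n)) ≤ V := fun i hi j hj n hn => by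
    rw [← hV]
    refine mul_le_mul (le_trans ?_ hU₁) (hln n hn) (by positivity) hU0
    gcongr
  have mono₂ : ∀ i ≤ 7, ∀ j ≤ 3, ∀ n ≤ 4,
      k * d ^ j * h ^ i * x * (l ^ n * 2 ^ (4 - n)) ≤ V := fun i hi j hj n hn => by
    rw [← hV]
    refine mul_le_mul (le_trans ?_ hU₂) (hln n hn) (by positivity) hU0
    gcongr
  have t1 : h ^ 2 * T₁ ≤ 144 * V := by
    calc _ ≤ h ^ 2 * (7 / 2 * (47 * (h ^ 5 * d ^ 2 * l ^ 2) * (7 / 8 * (d * h * k * l ^ 2)))) := by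
          refine mul_le_mul_of_nonneg_left (hT₁.trans ?_) (by positivity)
          gcongr
      _ = 7 / 2 * 47 * (7 / 8) * (k * d ^ 3 * h ^ 8 * (l ^ 4 * 2 ^ (4 - 4))) := by norm_num; ring
      _ ≤ 7 / 2 * 47 * (7 / 8) * V := by
        gcongr; exact mono₁ 8 (by norm_num) 3 (by norm_num) 4 (by norm_num)
      _ ≤ _ := by linarith
  have t2 : T₂ ≤ 144 * V := by
    calc _ ≤ (7 / 2 * (47 * (h ^ 5 * d ^ 2 * l ^ 2) * (7 / 8 * (d * h * k * l ^ 2)))) := by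
          refine hT₂.trans ?_
          gcongr
      _ = 7 / 2 * 47 * (7 / 8) * (k * d ^ 3 * h ^ 6 * (l ^ 4 * 2 ^ (4 - 4))) := by norm_num; ring
      _ ≤ 7 / 2 * 47 * (7 / 8) * V := by
        gcongr; exact mono₁ 6 (by norm_num) 3 (by norm_num) 4 (by norm_num)
      _ ≤ _ := by linarith
  have t3 : 2 * B * w ≤ 141 / 2 * V := by
    calc _ ≤ 2 * (47 * (h ^ 5 * d ^ 2 * l ^ 2)) * (3 / 2 * (k * l)) :=
          (mul_le_mul_of_nonneg_left hw (by positivity)).trans (by gcongr)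
      _ = 141 / 2 * (k * d ^ 2 * h ^ 5 * (l ^ 3 * 2 ^ (4 - 3))) := by norm_num; ring
      _ ≤ _ := by gcongr; exact mono₁ 5 (by norm_num) 2 (by norm_num) 3 (by norm_num)
  have t4 : B * (1 + cT * h ^ 2) * w ≤ 325 * V := by
    calc _ ≤ 47 * (h ^ 5 * d ^ 2 * l ^ 2) * (1 + cT * h ^ 2) * (3 / 2 * (k * l)) :=
          (mul_le_mul_of_nonneg_left hw (by positivity)).trans (by gcongr)
      _ = 141 / 4 * (k * d ^ 2 * h ^ 5 * (l ^ 3 * 2 ^ (4 - 3))) +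
          47 * (41 / 10) * (3 / 2) * (k * d ^ 2 * h ^ 7 * x * (l ^ 4 * 2 ^ (4 - 4))) := by
        rw [hcT]; norm_num; ring
      _ ≤ 141 / 4 * V + 47 * (41 / 10) * (3 / 2) * V := by
        gcongr
        · exact mono₁ 5 (by norm_num) 2 (by norm_num) 3 (by norm_num)
        · exact mono₂ 7 (by norm_num) 2 (by norm_num) 4 (by norm_num)
      _ ≤ _ := by linarith
  have t5 : (bR + 2 * bZ * bR) * y ≤ 17 * V := by
    calc _ ≤ (3 * (h ^ 3 * d * l) + 2 * (10 / 3 * (d * h * l)) * (3 * (h ^ 3 * d * l))) *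
          (3 / 2 * (k * d * h * l)) :=
          (mul_le_mul_of_nonneg_left hy (by positivity)).trans (by gcongr)
      _ = 9 / 8 * (k * d ^ 2 * h ^ 4 * (l ^ 2 * 2 ^ (4 - 2))) +
          15 * (k * d ^ 3 * h ^ 5 * (l ^ 3 * 2 ^ (4 - 3))) := by norm_num; ring
      _ ≤ 9 / 8 * V + 15 * V := by
        gcongr
        · exact mono₁ 4 (by norm_num) 2 (by norm_num) 2 (by norm_num)
        · exact mono₁ 5 (by norm_num) 3 (by norm_num) 3 (by norm_num)
      _ ≤ _ := by linarith
  have t6 : (B * cT + bZ * q * bP) * (2 * √2 * h ^ 2 * z) ≤ 316 * V := by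
    have h2 : √2 ≤ 3 / 2 := sqrt_le_of_le_sq (by norm_num) (by norm_num)
    have h3 : B * cT + bZ * q * bP ≤ 47 * (h ^ 5 * d ^ 2 * l ^ 2) * (41 / 10 * (x * l)) +
        10 / 3 * (d * h * l) * (3 / 2 * h) * (7 * (h ^ 2 * d * l)) := by
      have h4 : bZ * q * bP ≤ bZ * (3 / 2 * h) * bP := by gcongr
      have h5 : bZ * (3 / 2 * h) * bP ≤
        10 / 3 * (d * h * l) * (3 / 2 * h) * (7 * (h ^ 2 * d * l)) := by gcongr
      have h6 : B * cT ≤ 47 * (h ^ 5 * d ^ 2 * l ^ 2) * (41 / 10 * (x * l)) := by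
        rw [hcT]; gcongr
      linarith
    calc _ ≤ (47 * (h ^ 5 * d ^ 2 * l ^ 2) * (41 / 10 * (x * l)) +
          10 / 3 * (d * h * l) * (3 / 2 * h) * (7 * (h ^ 2 * d * l))) *
          (2 * (3 / 2) * h ^ 2 * (d * k)) :=
          (mul_le_mul_of_nonneg_right h3 (by positivity)).trans (by gcongr)
      _ = 47 * (41 / 10) * (3 / 2) * (k * d ^ 3 * h ^ 7 * x * (l ^ 3 * 2 ^ (4 - 3))) +
          105 / 4 * (k * d ^ 3 * h ^ 6 * (l ^ 2 * 2 ^ (4 - 2))) := by norm_num; ring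
      _ ≤ 47 * (41 / 10) * (3 / 2) * V + 105 / 4 * V := by
        gcongr
        · exact mono₂ 7 (by norm_num) 3 (by norm_num) 3 (by norm_num)
        · exact mono₁ 6 (by norm_num) 3 (by norm_num) 2 (by norm_num)
      _ ≤ _ := by linarith
  -- The six bounds add up to 1016.5 V.
  calc _ ≤ 1747 * V := by linarith
    _ = 1747 * U * l ^ 4 := by rw [← hV]; ring

lemma log_div_le_log_div {u v δ : ℝ} (hu : 0 < u) (huv : u ≤ v) (hδ : 0 < δ) :
    Real.log (u / δ) ≤ Real.log (v / δ) :=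
  Real.log_le_log (by positivity) (by gcongr)

/-! ### Ensemble size, noise tail and confidence radii. -/

section Sizes

variable {K : ℕ} {δ : ℝ}

lemma eighteen_le_ensembleSize (hK : 1 ≤ K) (hδ : 0 < δ) (hδ1 : δ < 1) :
    18 ≤ ensembleSize K δ := by
  have hK' : (1 : ℝ) ≤ K := by exact_mod_cast hK
  refine Nat.lt_ceil.2 ?_
  have h7 : Real.log 7 ≤ Real.log (7 * K / δ) := by
    refine Real.log_le_log (by norm_num) ?_
    rw [le_div_iff₀ hδ]; nlinarith
  have h17 : (17 : ℝ) < 9 * Real.log 7 := by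
    have e : 9 * Real.log 7 = Real.log (7 ^ 9) := by rw [Real.log_pow]; norm_num
    rw [e, Real.lt_log_iff_exp_lt (by norm_num)]
    have e2 : Real.exp 17 = Real.exp 1 ^ 17 := by rw [← Real.exp_nat_mul]; norm_num
    rw [e2]
    calc Real.exp 1 ^ 17 < 2.7182818286 ^ 17 := by
          gcongr; exact Real.exp_one_lt_d9
      _ < 7 ^ 9 := by norm_num
  push_cast
  linarith

/-- 8/9 ≤ e^{-1/9}, which explains the factor 9 in the ensemble size. -/
lemma eight_ninths_pow_le (hK : 1 ≤ K) (hδ : 0 < δ) :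
    ((8 : ℝ) / 9) ^ ensembleSize K δ ≤ δ / 7 / K := by
  have hK' : (0 : ℝ) < K := by exact_mod_cast hK
  have h1 : (8 : ℝ) / 9 ≤ Real.exp (-(1 / 9)) := by
    have := Real.add_one_le_exp (-(1 / 9) : ℝ); linarith
  have h2 : 9 * Real.log (7 * K / δ) ≤ ensembleSize K δ := Nat.le_ceil _
  calc ((8 : ℝ) / 9) ^ ensembleSize K δ ≤ Real.exp (-(1 / 9)) ^ ensembleSize K δ := by gcongr
    _ = Real.exp (-(ensembleSize K δ / 9)) := by rw [← Real.exp_nat_mul]; ring_nf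
    _ ≤ Real.exp (-Real.log (7 * K / δ)) := by gcongr; linarith
    _ = δ / 7 / K := by
      rw [Real.exp_neg, Real.exp_log (by positivity), inv_div, div_div]

/-- With √2 ≤ e^{1/2} the exponent is at most D/2 - 11DL/4 ≤ -L, using D ≤ DL and L ≤ DL. -/
lemma noise_tail_le {D : ℕ} {m k L : ℝ} (hD : 1 ≤ D) (hm : 0 < m) (hk : 0 < k) (hδ : 0 < δ)
    (hL : L = Real.log (14 * m * k / δ)) (hL1 : 1 ≤ L) :
    m * (√2 ^ D * Real.exp (-(√(11 * D * L) ^ 2 / 4))) ≤ δ / 7 / k := by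
  have hD' : (1 : ℝ) ≤ D := by exact_mod_cast hD
  have h2 : √2 ≤ Real.exp (1 / 2) := by
    refine sqrt_le_of_le_sq (Real.exp_pos _).le ?_
    rw [← Real.exp_nat_mul]
    have := Real.add_one_le_exp (1 : ℝ)
    norm_num at this ⊢
    linarith
  have h3 : √(11 * D * L) ^ 2 = 11 * D * L := Real.sq_sqrt (by positivity)
  have h4 : L ≤ D * L := le_mul_of_one_le_left (by linarith) hD'
  have h5 : (D : ℝ) ≤ D * L := le_mul_of_one_le_right (by linarith) hL1
  calc m * (√2 ^ D * Real.exp (-(√(11 * D * L) ^ 2 / 4)))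
      ≤ m * (Real.exp (1 / 2) ^ D * Real.exp (-(11 * D * L / 4))) := by rw [h3]; gcongr
    _ = m * Real.exp (D * (1 / 2) - 11 * D * L / 4) := by
      rw [← Real.exp_nat_mul, ← Real.exp_add]; ring_nf
    _ ≤ m * Real.exp (-L) := by gcongr; linarith
    _ = δ / 14 / k := by
      rw [hL, Real.exp_neg, Real.exp_log (by positivity)]; field_simp
    _ ≤ δ / 7 / k := by gcongr; norm_num

/-- In units of h·bP the terms are at most 1/4, 1/2 and 1.53 bZ, and 3/4 ≤ 0.47 bZ because bZ ≥ 2.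
Hence β_Q bounds the value estimates. -/
lemma value_radius_le {h bR bP bZ : ℝ} (hh : 0 ≤ h) (hbP : 4 ≤ bP) (hbZ : 2 ≤ bZ)
    (hbR : bR ^ 2 ≤ (h * bP) ^ 2 / 6) :
    h + bR + bZ * √(2 * bR ^ 2 + 2 * h ^ 2 * bP ^ 2) ≤ 2 * h * bP * bZ := by
  have hT : 0 ≤ h * bP := by positivity
  have h1 : √(2 * bR ^ 2 + 2 * h ^ 2 * bP ^ 2) ≤ 153 / 100 * (h * bP) := by
    refine sqrt_le_of_le_sq (by positivity) ?_
    nlinarith [sq_nonneg (h * bP)]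
  have h2 : bR ≤ 1 / 2 * (h * bP) := by
    refine le_of_sq_le_sq ?_ (by positivity)
    nlinarith [sq_nonneg (h * bP)]
  have h3 : bZ * √(2 * bR ^ 2 + 2 * h ^ 2 * bP ^ 2) ≤ bZ * (153 / 100 * (h * bP)) := by gcongr
  have h4 : 4 * h ≤ h * bP := by nlinarith
  nlinarith

lemma fixed_radius_le {d h L l₁ l₂ : ℝ} (hd : 1 ≤ d) (hL : 1 ≤ L) (h₁ : l₁ ≤ L) (h₂ : l₂ ≤ L) :
    2 * ((2 * h) ^ 2 * (d * l₁ + 2 * l₂)) + 2 * (d * h ^ 2) ≤ (4 * h * √(3 * d * L)) ^ 2 := by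
  have hs : √(3 * d * L) ^ 2 = 3 * d * L := Real.sq_sqrt (by positivity)
  have h3 : d * l₁ + 2 * l₂ ≤ 3 * (d * L) := by
    have h4 := mul_le_mul_of_nonneg_left h₁ (by linarith : (0 : ℝ) ≤ d)
    have h5 : L ≤ d * L := le_mul_of_one_le_left (by linarith) hd
    linarith
  have h4 : (2 * h) ^ 2 * (d * l₁ + 2 * l₂) ≤ (2 * h) ^ 2 * (3 * (d * L)) := by gcongr
  have h5 : d * h ^ 2 ≤ d * L * h ^ 2 := by
    gcongr; exact le_mul_of_one_le_right (by linarith) hL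
  rw [mul_pow (4 * h), hs]
  nlinarith [mul_nonneg (by positivity : (0 : ℝ) ≤ d * L) (sq_nonneg h)]

end Sizes

/-! ### Numerical evaluation of the bound for the tuned parameters. -/

section Tuning

variable {x a h k m δ : ℝ}

lemma log_one_add_le {c : ℝ} (hk : 1 ≤ k) (hδ : 0 < δ) (hδ1 : δ < 1) (hc : 2 * k ≤ c) :
    Real.log (1 + k) ≤ Real.log (c / δ) := by
  refine Real.log_le_log (by linarith) ?_
  rw [le_div_iff₀ hδ]
  nlinarith

lemma one_le_log_div {u : ℝ} (hu : 1 ≤ u) (hδ : 0 < δ) (hδ1 : δ < 1) :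
    1 ≤ Real.log (14 * u / δ) := by
  rw [Real.le_log_iff_exp_le (by positivity), le_div_iff₀ hδ]
  have h1 := Real.exp_one_lt_d9
  have h2 := Real.exp_pos 1
  nlinarith

lemma five_le_log_div {u : ℝ} (hu : 18 ≤ u) (hδ : 0 < δ) (hδ1 : δ < 1) :
    5 ≤ Real.log (20 * u / δ) := by
  rw [Real.le_log_iff_exp_le (by positivity), le_div_iff₀ hδ]
  have e : Real.exp 5 = Real.exp 1 ^ 5 := by rw [← Real.exp_nat_mul]; norm_num
  have h1 : Real.exp 5 ≤ 200 := by
    rw [e]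
    calc Real.exp 1 ^ 5 ≤ 2.7182818286 ^ 5 := by gcongr; exact Real.exp_one_lt_d9.le
      _ ≤ 200 := by norm_num
  have h3 := Real.exp_pos 5
  nlinarith

/-- The initial epoch is absorbed through log 2 ≤ D log (2k): the constant is 3/log 2 < 13/3. -/
lemma epochs_le {D E : ℝ} (hD : 1 ≤ D) (hk : 1 ≤ k)
    (hE : (E - 1) * Real.log 2 ≤ 2 * D * Real.log (1 + k)) :
    E ≤ 13 / 3 * (D * Real.log (2 * k)) := by
  have h2 := Real.log_two_gt_d9
  have h3 : Real.log (1 + k) ≤ Real.log (2 * k) := Real.log_le_log (by linarith) (by linarith)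
  have h4 : Real.log 2 ≤ Real.log (2 * k) := Real.log_le_log (by norm_num) (by linarith)
  have h5 : D * Real.log (1 + k) ≤ D * Real.log (2 * k) := by gcongr
  have h6 : Real.log (2 * k) ≤ D * Real.log (2 * k) := le_mul_of_one_le_left (by linarith) hD
  by_contra hcon
  rw [not_le] at hcon
  have h7 : 13 / 3 * (D * Real.log (2 * k)) * Real.log 2 ≤ E * Real.log 2 := by gcongr
  have h8 : 0 < D * Real.log (2 * k) := by linarith
  nlinarith

variable (hx : 1 ≤ x) (ha : 1 ≤ a) (hh : 1 ≤ h) (hk : 1 ≤ k) (hm : 18 ≤ m) (hδ : 0 < δ)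
  (hδ1 : δ < 1)

include hx ha hh hk hm hδ hδ1

lemma five_le_log : 5 ≤ Real.log (20 * k * h * x * a * m / δ) := by
  have h1 : 1 ≤ k * h * x * a :=
    one_le_mul_of_one_le_of_one_le (one_le_mul_of_one_le_of_one_le
      (one_le_mul_of_one_le_of_one_le hk hh) hx) ha
  rw [show 20 * k * h * x * a * m = 20 * (k * h * x * a * m) by ring]
  exact five_le_log_div (by nlinarith) hδ hδ1

/-- The arithmetic of the regret bound. -/
lemma tuned_regret_le {bR bP bZ ηo ηx E : ℝ}
    (hbR : bR = 2 * h * √(2 * (x * a) * h * Real.log (14 * k / δ)))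
    (hbP : bP = 4 * h * √(3 * (x * a) * Real.log (14 * k * h / δ)))
    (hbZ : bZ = √(11 * (x * a) * h * Real.log (14 * m * k / δ)))
    (hηo : ηo = √(3 * (x * a) * h * Real.log (2 * k) * Real.log a / (k * (2 * h * bP * bZ) ^ 2)))
    (hηx : ηx = √(3 * (x * a) * h * Real.log (2 * k) * Real.log m / (k * (2 * h * bP * bZ) ^ 2)))
    (hE : (E - 1) * Real.log 2 ≤ 2 * (x * a * h) * Real.log (1 + k)) :
    h * (Real.log a * E / ηo + 2 * ηo * (2 * h * bP * bZ) ^ 2 * k) +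
      (Real.log m * E / ηx + 2 * ηx * (2 * h * bP * bZ) ^ 2 * k) +
      2 * (2 * h * bP * bZ) * √(2 * k * Real.log (1 / (δ / 7))) +
      (2 * h * bP * bZ) * (1 + 41 / 10 * (√x * √(Real.log (20 * k * h * x * a * m / δ))) * h) *
        √(2 * k * Real.log (1 / (δ / 7))) +
      ((bR + 2 * bZ * bR) * √(k * (2 * (x * a * h * Real.log (1 + k)))) +
      ((2 * h * bP * bZ) * (41 / 10 * (√x * √(Real.log (20 * k * h * x * a * m / δ)))) +
        bZ * √(2 * h) * bP) * (2 * √2 * h * √(x * a * k))) ≤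
    1747 * √(k * x ^ 3 * a ^ 3 * h ^ 7 * max h x) *
      Real.log (20 * k * h * x * a * m / δ) ^ 2 := by
  have hL5 := five_le_log hx ha hh hk hm hδ hδ1
  have hd : 1 ≤ x * a := one_le_mul_of_one_le_of_one_le hx ha
  have hkh : 1 ≤ k * h := one_le_mul_of_one_le_of_one_le hk hh
  have hcomm : 20 * k * h * x * a * m = 20 * (k * h * (x * a) * m) := by ring
  have hu₁ : k ≤ k * h := le_mul_of_one_le_right (by linarith) hh
  have hu₂ : k * h ≤ k * h * (x * a) := le_mul_of_one_le_right (by linarith) hd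
  have hu₃ : k * h * (x * a) ≤ k * h * (x * a) * m :=
    le_mul_of_one_le_right (by linarith) (by linarith)
  have hkm : k * m ≤ k * h * (x * a) * m := by gcongr; linarith
  have hka : k * a ≤ k * h * (x * a) := by
    have h1 : a ≤ x * a := le_mul_of_one_le_left (by linarith) hx
    exact mul_le_mul hu₁ h1 (by linarith) (by linarith)
  have hlog : ∀ u : ℝ, 0 < u → u ≤ 20 * (k * h * (x * a) * m) →
      Real.log (u / δ) ≤ Real.log (20 * k * h * x * a * m / δ) := fun u hu huv =>
    log_div_le_log_div hu (by rw [hcomm]; exact huv) hδ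
  have hlog' : ∀ u : ℝ, 0 < u → u ≤ 20 * (k * h * (x * a) * m) →
      Real.log u ≤ Real.log (20 * k * h * x * a * m / δ) := fun u hu huv => by
    refine le_trans (Real.log_le_log hu ?_) (hlog u hu huv)
    rw [le_div_iff₀ hδ]; nlinarith
  have hl₃ := hlog (14 * k) (by positivity) (by linarith)
  have hl₁ := hlog (14 * k * h) (by positivity) (by linarith)
  have hl₂ := hlog (14 * m * k) (by positivity) (by linarith)
  have hl₇ : Real.log (1 / (δ / 7)) ≤ Real.log (20 * k * h * x * a * m / δ) := by
    rw [one_div_div]; exact hlog 7 (by norm_num) (by linarith)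
  have hlk : Real.log (1 + k) ≤ Real.log (20 * k * h * x * a * m / δ) :=
    hlog' _ (by linarith) (by linarith)
  have hGa : Real.log (2 * k) + Real.log a ≤ Real.log (20 * k * h * x * a * m / δ) := by
    rw [← Real.log_mul (by positivity) (by positivity)]
    exact hlog' _ (by positivity) (by linarith)
  have hGm : Real.log (2 * k) + Real.log m ≤ Real.log (20 * k * h * x * a * m / δ) := by
    rw [← Real.log_mul (by positivity) (by positivity)]
    exact hlog' _ (by positivity) (by linarith)
  have h3 : 1 ≤ Real.log (14 * k / δ) := one_le_log_div hk hδ hδ1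
  have h1 : 1 ≤ Real.log (14 * k * h / δ) := by rw [mul_assoc]; exact one_le_log_div hkh hδ hδ1
  have h2 : 1 ≤ Real.log (14 * m * k / δ) := by
    rw [mul_assoc]; exact one_le_log_div (by nlinarith) hδ hδ1
  have h7 : 0 ≤ Real.log (1 / (δ / 7)) := Real.log_nonneg (by
    rw [one_div_div, le_div_iff₀ hδ]; linarith)
  have hk7 : 0 ≤ Real.log (1 + k) := Real.log_nonneg (by linarith)
  -- From here on only the inequalities between the logarithms matter.
  generalize Real.log (20 * k * h * x * a * m / δ) = L at *
  generalize Real.log (14 * k / δ) = L₃ at *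
  generalize Real.log (14 * k * h / δ) = L₁ at *
  generalize Real.log (14 * m * k / δ) = L₂ at *
  generalize Real.log (1 / (δ / 7)) = L₇ at *
  have hE' := epochs_le (by nlinarith : 1 ≤ x * a * h) hk hE
  have hG : 0 < Real.log (2 * k) := Real.log_pos (by linarith)
  have hloga : 0 ≤ Real.log a := Real.log_nonneg ha
  have hlogm : 0 ≤ Real.log m := Real.log_nonneg (by linarith)
  have hx0 : 0 < x := by linarith
  have ha0 : 0 < a := by linarith
  have hh0 : 0 < h := by linarith
  have hk0 : 0 < k := by linarith
  have hL0 : 0 < L := by linarith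
  have ex : ∀ y : ℝ, 0 ≤ y → √(x * a * h * y) = √(x * a) * √h * √y := fun y hy => by
    rw [Real.sqrt_mul (by positivity), Real.sqrt_mul (by positivity)]
  have hsh : √h ^ 2 = h := Real.sq_sqrt hh0.le
  have bR_le : bR ≤ 3 * (√h ^ 3 * √(x * a) * √L) := by
    have h5 := sqrt_const_mul_le (c := 2) (C := 3 / 2) (u := x * a * h * L₃) (v := x * a * h * L)
      (by norm_num) (by positivity) (by gcongr) (by norm_num)
    rw [ex L hL0.le] at h5
    rw [hbR, show 2 * (x * a) * h * L₃ = 2 * (x * a * h * L₃) by ring]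
    calc _ ≤ 2 * h * (3 / 2 * (√(x * a) * √h * √L)) := by gcongr
      _ = 3 * (√h ^ 2 * √h * √(x * a) * √L) := by rw [hsh]; ring
      _ = _ := by ring
  have bZ_le : bZ ≤ 3317 / 1000 * (√(x * a) * √h * √L) := by
    have h5 := sqrt_const_mul_le (c := 11) (C := 3317 / 1000) (u := x * a * h * L₂)
      (v := x * a * h * L) (by norm_num) (by positivity) (by gcongr) (by norm_num)
    rw [ex L hL0.le] at h5
    rw [hbZ, show 11 * (x * a) * h * L₂ = 11 * (x * a * h * L₂) by ring]
    exact h5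
  have bP_le : bP ≤ 4 * (1733 / 1000) * (√h ^ 2 * √(x * a) * √L) := by
    have h5 := sqrt_const_mul_le (c := 3) (C := 1733 / 1000) (u := x * a * L₁)
      (v := x * a * L) (by norm_num) (by positivity) (by gcongr) (by norm_num)
    rw [Real.sqrt_mul (by positivity) L] at h5
    rw [hbP, show 3 * (x * a) * L₁ = 3 * (x * a * L₁) by ring, hsh]
    calc _ ≤ 4 * h * (1733 / 1000 * (√(x * a) * √L)) := by gcongr
      _ = _ := by ring
  have hbR0 : 0 ≤ bR := by rw [hbR]; positivity
  have hbP0 : 0 < bP := by rw [hbP]; positivity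
  have hbZ0 : 0 < bZ := by rw [hbZ]; positivity
  have hB0 : 0 < 2 * h * bP * bZ := by positivity
  have B_le : 2 * h * bP * bZ ≤ 47 * (√h ^ 5 * √(x * a) ^ 2 * √L ^ 2) := by
    calc 2 * h * bP * bZ ≤ 2 * h * (4 * (1733 / 1000) * (√h ^ 2 * √(x * a) * √L)) *
          (3317 / 1000 * (√(x * a) * √h * √L)) := by gcongr
      _ = 2 * 4 * (1733 / 1000) * (3317 / 1000) *
          ((√h ^ 2) * √h ^ 2 * √h * √(x * a) ^ 2 * √L ^ 2) := by rw [hsh]; ring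
      _ = 2 * 4 * (1733 / 1000) * (3317 / 1000) * (√h ^ 5 * √(x * a) ^ 2 * √L ^ 2) := by ring
      _ ≤ _ := mul_le_mul_of_nonneg_right (by norm_num) (by positivity)
  have hT₁ := hedge_bound (by linarith : 0 < x * a) hh0 hG hloga hk0 hB0 hE'
  have hT₂ := hedge_bound (by linarith : 0 < x * a) hh0 hG hlogm hk0 hB0 hE'
  rw [← hηo] at hT₁
  rw [← hηx] at hT₂
  have hs₁ := sqrt_hedge_le (by linarith : 0 ≤ x * a) hh0.le hG.le hloga hk0.le hGa
  have hs₂ := sqrt_hedge_le (by linarith : 0 ≤ x * a) hh0.le hG.le hlogm hk0.le hGm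
  have hw : √(2 * k * L₇) ≤ 3 / 2 * (√k * √L) := by
    rw [mul_assoc, ← Real.sqrt_mul hk0.le]
    exact sqrt_const_mul_le (by norm_num) (by positivity) (by gcongr) (by norm_num)
  have hy : √(k * (2 * (x * a * h * Real.log (1 + k)))) ≤
      3 / 2 * (√k * √(x * a) * √h * √L) := by
    rw [show k * (2 * (x * a * h * Real.log (1 + k))) = 2 * (x * a * h * (k * Real.log (1 + k)))
      by ring, show √k * √(x * a) * √h * √L = √(x * a) * √h * (√k * √L) by ring,
      ← Real.sqrt_mul hk0.le, ← ex _ (by positivity)]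
    exact sqrt_const_mul_le (by norm_num) (by positivity) (by gcongr) (by norm_num)
  have hq : √(2 * h) ≤ 3 / 2 * √h :=
    sqrt_const_mul_le (by norm_num) hh0.le le_rfl (by norm_num)
  have hsq : ∀ i j n : ℕ, (√k * √(x * a) ^ i * √h ^ j * √x ^ n) ^ 2 =
      k * (x * a) ^ i * h ^ j * x ^ n := fun i j n => by
    simp only [mul_pow, ← pow_mul, mul_comm _ 2]
    simp only [pow_mul, Real.sq_sqrt hk0.le, hsh, Real.sq_sqrt hx0.le,
      Real.sq_sqrt (by positivity : 0 ≤ x * a), mul_pow]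
  have hU₁ : √k * √(x * a) ^ 3 * √h ^ 8 ≤ √(k * x ^ 3 * a ^ 3 * h ^ 7 * max h x) := by
    apply Real.le_sqrt_of_sq_le
    have := hsq 3 8 0
    rw [pow_zero, mul_one, pow_zero, mul_one] at this
    rw [this]
    calc _ = k * x ^ 3 * a ^ 3 * h ^ 7 * h := by ring
      _ ≤ _ := by gcongr; exact le_max_left _ _
  have hU₂ : √k * √(x * a) ^ 3 * √h ^ 7 * √x ≤ √(k * x ^ 3 * a ^ 3 * h ^ 7 * max h x) := by
    apply Real.le_sqrt_of_sq_le
    have := hsq 3 7 1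
    rw [pow_one, pow_one] at this
    rw [this]
    calc _ = k * x ^ 3 * a ^ 3 * h ^ 7 * x := by ring
      _ ≤ _ := by gcongr; exact le_max_right _ _
  have hl : 2 ≤ √L := Real.le_sqrt_of_sq_le (by linarith)
  have key := regret_terms_le (Real.sqrt_nonneg k) (Real.one_le_sqrt.2 hh) (Real.one_le_sqrt.2 hd)
    (Real.one_le_sqrt.2 hx) hl hU₁ hU₂ hB0.le B_le rfl hbR0 bR_le hbZ0.le
    (bZ_le.trans (mul_le_mul_of_nonneg_right (by norm_num) (by positivity))) hbP0.le (bP_le.trans (mul_le_mul_of_nonneg_right (by norm_num) (by positivity)))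
    (hT₁.trans (by gcongr)) (hT₂.trans (by gcongr)) hw hy
    (Real.sqrt_mul (by positivity : 0 ≤ x * a) k).le (Real.sqrt_nonneg _) hq
  rw [hsh, show √L ^ 4 = (√L ^ 2) ^ 2 by ring, Real.sq_sqrt hL0.le] at key
  exact key

end Tuning

section Radii

variable {a h k m δ : ℝ}

lemma kernel_radius_tuned_le {X : ℕ} (hx : (1 : ℝ) ≤ X) (ha : 1 ≤ a) (hh : 1 ≤ h) (hk : 1 ≤ k)
    (hm : 18 ≤ m) (hδ : 0 < δ) (hδ1 : δ < 1) :
    2 * √(Real.log (1 + k) + 2 * Real.log (k * (h * (X * a * 2 ^ X)) / (δ / 7))) + 1 ≤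
      41 / 10 * (√X * √(Real.log (20 * k * h * X * a * m / δ))) := by
  have hd : 1 ≤ X * a := one_le_mul_of_one_le_of_one_le hx ha
  have hhd : 1 ≤ h * (X * a) := one_le_mul_of_one_le_of_one_le hh hd
  have hkq : k ≤ k * (h * (X * a)) := le_mul_of_one_le_right (by linarith) hhd
  have hqm : k * (h * (X * a)) * 18 ≤ k * (h * (X * a)) * m := by gcongr
  have hX : (0 : ℝ) < X := by linarith
  have ha0 : 0 < a := by linarith
  have hh0 : 0 < h := by linarith
  have hk0 : 0 < k := by linarith
  have e : 20 * k * h * X * a * m = 20 * (k * (h * (X * a)) * m) := by ring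
  rw [← Real.sqrt_mul hX.le]
  refine kernel_radius_le hx (five_le_log hx ha hh hk hm hδ hδ1)
    (log_one_add_le hk hδ hδ1 (by rw [e]; linarith)) ?_
  rw [show k * (h * (X * a * 2 ^ X)) / (δ / 7) = 7 * (k * (h * (X * a))) / δ * 2 ^ X by
      field_simp, Real.log_mul (by positivity) (by positivity), Real.log_pow]
  exact add_le_add (log_div_le_log_div (by positivity) (by rw [e]; linarith) hδ) le_rfl

lemma value_radius_tuned_le {d h L₁ L₃ bR bP bZ : ℝ} (hd : 0 ≤ d) (hh : 1 ≤ h) (hL₃ : 0 ≤ L₃)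
    (hL : L₃ ≤ L₁) (hbP4 : 4 ≤ bP) (hbZ2 : 2 ≤ bZ) (hbR : bR = 2 * h * √(2 * d * h * L₃))
    (hbP : bP = 4 * h * √(3 * d * L₁)) :
    h + bR + bZ * √(2 * bR ^ 2 + 2 * h ^ 2 * bP ^ 2) ≤ 2 * h * bP * bZ := by
  refine value_radius_le (by linarith) hbP4 hbZ2 ?_
  have hL₁ : 0 ≤ L₁ := hL₃.trans hL
  have h1 : h * L₃ ≤ h ^ 2 * L₁ := by
    gcongr; nlinarith
  have h2 := mul_le_mul_of_nonneg_left h1 (by positivity : 0 ≤ 8 * h ^ 2 * d)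
  have h3 : bR ^ 2 = 8 * h ^ 2 * d * (h * L₃) := by
    rw [hbR, mul_pow (2 * h), Real.sq_sqrt (by positivity)]; ring
  have h4 : (h * bP) ^ 2 / 6 = 8 * h ^ 2 * d * (h ^ 2 * L₁) := by
    rw [hbP, ← mul_assoc, mul_pow (h * (4 * h)), Real.sq_sqrt (by positivity)]; ring
  rw [h3, h4]
  exact h2

end Radii

end REPO

end

/-! ### The theorem for the tuned parameters. -/

open REPO in
theorem mainTheorem3 {X A : Type*} [Fintype X] [Fintype A] [DecidableEq X] [DecidableEq A]
    {H K : ℕ} (hH : 1 ≤ H) (hK : 1 ≤ K) (δ : ℝ) (hδ : 0 < δ) (hδ1 : δ < 1)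
    (M : REPO.MDP X A H)
    (p : REPO.Params) (hp : p = REPO.tunedParams (Fintype.card X) (Fintype.card A) H K δ)
    {Ω : Type*} [MeasurableSpace Ω] (μ : MeasureTheory.Measure Ω)
    [MeasureTheory.IsProbabilityMeasure μ]
    (S : REPO.Interaction X A H p.m Ω) (hS : REPO.IsRun μ M p K S)
    (πstar : Fin H → X → A → ℝ) (hπ : REPO.IsOptimal M πstar) :
    ENNReal.ofReal (1 - δ) ≤
      μ {ω | REPO.regret M p K S πstar ω ≤
        1747 * √(K * (Fintype.card X : ℝ) ^ 3 * (Fintype.card A : ℝ) ^ 3 * (H : ℝ) ^ 7 *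
            max (H : ℝ) (Fintype.card X : ℝ)) *
          Real.log (20 * K * H * Fintype.card X * Fintype.card A * p.m / δ) ^ 2} := by
  have hX : Nonempty X := ⟨M.init⟩
  -- The comparator has a probability vector at the first step, which exists because H ≥ 1.
  have hA : Nonempty A := by
    by_contra hA
    rw [not_nonempty_iff] at hA
    have := (hπ.1 ⟨0, hH⟩ M.init).2
    simp at this
  have hm18 : 18 ≤ p.m := by rw [hp]; exact eighteen_le_ensembleSize hK hδ hδ1
  have hopt : ((8 : ℝ) / 9) ^ p.m ≤ δ / 7 / K := by rw [hp]; exact eight_ninths_pow_le hK hδ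
  have hlamP : p.lamP = 1 := by rw [hp]; rfl
  have hlamR : p.lamR = H := by rw [hp]; rfl
  have hk1 : (1 : ℝ) ≤ K := by exact_mod_cast hK
  have hh1 : (1 : ℝ) ≤ H := by exact_mod_cast hH
  have hm1 : (18 : ℝ) ≤ p.m := by exact_mod_cast hm18
  have hx1 : (1 : ℝ) ≤ Fintype.card X := by exact_mod_cast Fintype.card_pos
  have ha1 : (1 : ℝ) ≤ Fintype.card A := by exact_mod_cast Fintype.card_pos
  have hbR : p.betaR = 2 * H * √(2 * (Fintype.card X * Fintype.card A) * H *
    Real.log (14 * K / δ)) := by rw [hp]; rfl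
  have hbP : p.betaP = 4 * H * √(3 * (Fintype.card X * Fintype.card A) *
    Real.log (14 * K * H / δ)) := by rw [hp]; rfl
  -- The noise radius β_ζ is no input of the algorithm; it enters only through the learning rates.
  obtain ⟨bZ, hbZ⟩ : ∃ bZ, bZ = √(11 * (Fintype.card X * Fintype.card A) * H *
    Real.log (14 * p.m * K / δ)) := ⟨_, rfl⟩
  have hηo : p.etaO = √(3 * (Fintype.card X * Fintype.card A) * H * Real.log (2 * K) *
      Real.log (Fintype.card A) / (K * (2 * H * p.betaP * bZ) ^ 2)) := by
    rw [hbZ, hp]; rfl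
  have hηx : p.etaX = √(3 * (Fintype.card X * Fintype.card A) * H * Real.log (2 * K) *
      Real.log p.m / (K * (2 * H * p.betaP * bZ) ^ 2)) := by
    rw [hbZ, hp]; rfl
  have hd : 1 ≤ (Fintype.card X * Fintype.card A : ℝ) := one_le_mul_of_one_le_of_one_le hx1 ha1
  have hdh : 1 ≤ (Fintype.card X * Fintype.card A * H : ℝ) := one_le_mul_of_one_le_of_one_le hd hh1
  have hkh : 1 ≤ (K * H : ℝ) := one_le_mul_of_one_le_of_one_le hk1 hh1
  have hmk : 1 ≤ (p.m * K : ℝ) := one_le_mul_of_one_le_of_one_le (by linarith) hk1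
  have hL₃ : 1 ≤ Real.log (14 * K / δ) := one_le_log_div hk1 hδ hδ1
  have hL₁ : 1 ≤ Real.log (14 * K * H / δ) := by rw [mul_assoc]; exact one_le_log_div hkh hδ hδ1
  have hL₂ : 1 ≤ Real.log (14 * p.m * K / δ) := by
    rw [mul_assoc]; exact one_le_log_div hmk hδ hδ1
  have hL₃₁ : Real.log (14 * K / δ) ≤ Real.log (14 * K * H / δ) :=
    log_div_le_log_div (by linarith) (le_mul_of_one_le_right (by linarith) hh1) hδ
  have hdiv : ∀ u : ℝ, u / (δ / 7) = 7 * u / δ := fun u => by field_simp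
  have hbR0 : 0 ≤ p.betaR := by rw [hbR]; positivity
  have hbP4 : 4 ≤ p.betaP := by
    have : 1 ≤ √(3 * (Fintype.card X * Fintype.card A) * Real.log (14 * K * H / δ)) :=
      Real.one_le_sqrt.2 (by nlinarith)
    rw [hbP]; nlinarith
  have hbZ2 : 2 ≤ bZ := by
    rw [hbZ]
    apply Real.le_sqrt_of_sq_le
    nlinarith
  have hB0 : 0 < 2 * H * p.betaP * bZ := by positivity
  have hlogm : 0 < Real.log p.m := Real.log_pos (by linarith)
  have hlogk : 0 < Real.log (2 * K) := Real.log_pos (by linarith)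
  have hU := fun E : ℝ => tuned_regret_le (E := E) hx1 ha1 hh1 hk1 hm1 hδ hδ1 hbR hbP hbZ hηo hηx
  have hreward : H * √(Fintype.card X * Fintype.card A * H * Real.log (1 + K) +
      2 * Real.log (K / (δ / 7))) + H * √(Fintype.card X * Fintype.card A) ≤ p.betaR := by
    rw [hdiv, hbR, show 2 * (Fintype.card X * Fintype.card A : ℝ) * H * Real.log (14 * K / δ) =
      2 * (Fintype.card X * Fintype.card A * H) * Real.log (14 * K / δ) by ring]
    exact reward_radius_le hdh (le_mul_of_one_le_right (by linarith) hh1) (by linarith) hL₃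
      (log_one_add_le hk1 hδ hδ1 (by linarith))
      (log_div_le_log_div (by linarith) (by linarith) hδ)
  have hfixed : 2 * ((2 * H) ^ 2 * (Fintype.card X * Fintype.card A * Real.log (1 + K) +
      2 * Real.log (K * H / (δ / 7)))) + 2 * (Fintype.card X * Fintype.card A * (H : ℝ) ^ 2) ≤
        p.betaP ^ 2 := by
    rw [hdiv, hbP]
    exact fixed_radius_le hd hL₁ ((log_one_add_le hk1 hδ hδ1 (by linarith)).trans hL₃₁)
      (log_div_le_log_div (by linarith) (by linarith) hδ)
  have hkernel : 2 * √(Real.log (1 + K) + 2 * Real.log (K * (H * (Fintype.card X *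
      Fintype.card A * 2 ^ Fintype.card X)) / (δ / 7))) + 1 ≤ 41 / 10 * (√(Fintype.card X) *
        √(Real.log (20 * K * H * Fintype.card X * Fintype.card A * p.m / δ))) :=
    kernel_radius_tuned_le hx1 ha1 hh1 hk1 hm1 hδ hδ1
  have hnoise : p.m * (√2 ^ (Fintype.card X * Fintype.card A * H) *
      Real.exp (-(bZ ^ 2 / 4))) ≤ δ / 7 / K := by
    have h1 : 1 ≤ Fintype.card X * Fintype.card A * H := by exact_mod_cast hdh
    have h2 := noise_tail_le h1 (by linarith : (0 : ℝ) < p.m) (by linarith : (0 : ℝ) < K) hδ rfl hL₂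
    rw [hbZ]
    push_cast at h2
    rwa [← mul_assoc 11] at h2
  have hball : H + p.betaR + bZ * √(2 * p.betaR ^ 2 + 2 * H ^ 2 * p.betaP ^ 2) ≤
      2 * H * p.betaP * bZ :=
    value_radius_tuned_le (by positivity) hh1 (by linarith) hL₃₁ hbP4 hbZ2 hbR hbP
  have key := hS.ofReal_le_measure_regret_le hlamP hlamR hH hK (by omega) hbR0 (by linarith) hπ.1
    (by positivity) (by linarith) (by linarith) (by positivity) hB0 (by rw [hηx]; positivity)
    -- At least two actions make log |A|, and with it the learning rate, positive.
    (fun hA1 => by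
      have h1 : (1 : ℝ) < Fintype.card A := by
        have := Fintype.card_pos (α := A)
        exact_mod_cast (by omega : 1 < Fintype.card A)
      have := Real.log_pos h1
      rw [hηo]; positivity)
    (by rw [hηo]; positivity) hreward hfixed hkernel hnoise hopt hball hU
  rwa [mul_div_cancel₀ δ (by norm_num : (7 : ℝ) ≠ 0)] at key
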